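/- Let $p$ be a prime, let $g\in\mathbb Z[x_1^{\pm1},\dots,x_n^{\pm1}]$, and let $f(\mathbf x)=1-t\,g(\mathbf x)$. Let $\Delta\subset\mathbb R^n$ be the Newton polytope of $f$ (the convex hull of the exponents of its monomials), and assume that $\Delta$ is reflexive: it has dimension $n$, contains $\mathbf 0$, and each of its codimension-one faces is given by an equation $\sum_i a_ix_i=1$ with $a_i\in\mathbb Z$. For $\mathbf u\in\mathbb Z^n$ let $\deg(\mathbf u)$ be the unique integer $d\ge 0$ such that $\mathbf u$ lies on the boundary of $d\Delta$, and for $S\subset\mathbb R^n$ put $S_{\mathbb Z}=S\cap\mathbb Z^n$. Fix $t^\sigma\in t^p\,(1+p\,t\,\mathbb Z_p[[t]])$ and put $f^\sigma(\mathbf x)=1-t^\sigma g(\mathbf x)$. For $1\le k<p$ the $k$-th Hasse–Witt matrix $HW^{(k)}$ is the square matrix indexed by $\mathbf u,\mathbf v\in(k\Delta)_{\mathbb Z}$ whose $(\mathbf u,\mathbf v)$-entry is the coefficient of $\mathbf x^{p\mathbf v-\mathbf u}$ in $$F^{(k)}(\mathbf x)=f(\mathbf x)^{p-k}\sum_{r=0}^{k-1}\bigl(f^\sigma(\mathbf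 x^p)-f(\mathbf x)^p\bigr)^r f^\sigma(\mathbf x^p)^{k-1-r},$$ divided by $t^{\,p\deg(\mathbf v)-\deg(\mathbf u)}$. Put $L(k)=\sum_{\ell=1}^{k}\bigl(\#(k\Delta)_{\mathbb Z}-\#(\ell\Delta)_{\mathbb Z}\bigr)$. The $k$-th Hasse–Witt condition is said to hold if $p^{-L(\ell)}\det HW^{(\ell)}\in\mathbb Z_p[[t]]^\times$ for each $1\le\ell\le k$. A proper (nonempty) face $\tau$ of $\Delta$ is called a simplex of volume $1$ if it has $\dim(\tau)+1$ vertices and all lattice points in the $\mathbb R_{\ge0}$-cone generated by $\tau$ are integer linear combinations of the vertices of $\tau$. **Theorem.** Suppose that $p>n$, that all proper faces of $\Delta$ are simplices of volume $1$, and that all (nonzero) coefficients of $g$ are in $\mathbb Z_p^\times$. Then the $k$-th Hasse–Witt condition holds for every $k<p$. -/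

import Mathlib

open scoped Pointwise

noncomputable section

namespace HasseWitt

/-! ### Lattice polytopes and their faces -/

/-- The inclusion `ℤⁿ ⊂ ℝⁿ`. -/
def toReal {n : ℕ} (u : Fin n → ℤ) : Fin n → ℝ := fun i => (u i : ℝ)

/-- The dimension of (the affine hull of) a subset of `ℝⁿ`. -/
def dim {n : ℕ} (S : Set (Fin n → ℝ)) : ℕ := Module.finrank ℝ (vectorSpan ℝ S)

/-- `τ` is a proper face of the polytope `Δ`: nonempty, different from `Δ`, and the set of points
of `Δ` where some linear functional attains its maximum over `Δ`. -/
structure IsProperFace {n : ℕ} (Δ τ : Set (Fin n → ℝ)) : Prop where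
  nonempty : τ.Nonempty
  isExposed : IsExposed ℝ Δ τ
  ne : τ ≠ Δ

/-- A lattice polytope is reflexive if it has maximal dimension, contains `0`, and each of its
faces of codimension one is given by an equation `∑ aᵢ xᵢ = 1` with integral `aᵢ`. -/
structure IsReflexive {n : ℕ} (Δ : Set (Fin n → ℝ)) : Prop where
  isLatticePolytope : ∃ V : Finset (Fin n → ℤ), Δ = convexHull ℝ (toReal '' (V : Set (Fin n → ℤ)))
  dim_eq : dim Δ = n
  zero_mem : (0 : Fin n → ℝ) ∈ Δ
  facet : ∀ τ : Set (Fin n → ℝ), IsProperFace Δ τ → dim τ + 1 = n →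
    ∃ a : Fin n → ℤ, τ = {x ∈ Δ | ∑ i, (a i : ℝ) * x i = 1}

/-- The face `τ` is a simplex of volume one: it has `dim τ + 1` vertices, and every lattice point
of the `ℝ_{≥0}`-cone generated by `τ` is an integer linear combination of the vertices. -/
structure IsUnimodularSimplex {n : ℕ} (τ : Set (Fin n → ℝ)) : Prop where
  card_vertices : (Set.extremePoints ℝ τ).ncard = dim τ + 1
  lattice : ∀ u : Fin n → ℤ, toReal u ∈ PointedCone.hull ℝ τ →
    toReal u ∈ Submodule.span ℤ (Set.extremePoints ℝ τ)

/-- The degree of a lattice point `u` with respect to `Δ`: the natural number `d` such that `u`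
lies on the boundary of `d Δ` (it exists and is unique for reflexive `Δ ⊂ ℝⁿ`, `n ≥ 1`;
for `n = 0` the value is `0`). -/
def deg {n : ℕ} (Δ : Set (Fin n → ℝ)) (u : Fin n → ℤ) : ℕ :=
  sInf {d : ℕ | toReal u ∈ frontier ((d : ℝ) • Δ)}

/-! ### Laurent polynomials -/

/-- Laurent polynomials in `x₁, …, xₙ` over `R`. -/
abbrev Laurent (R : Type*) [CommRing R] (n : ℕ) := AddMonoidAlgebra R (Fin n → ℤ)

/-- The Newton polytope: the convex hull of the support. -/
def newtonPolytope {R : Type*} [CommRing R] {n : ℕ} (A : Laurent R n) : Set (Fin n → ℝ) :=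
  convexHull ℝ (toReal '' (A.coeff.support : Set (Fin n → ℤ)))

/-- The Laurent polynomial `1 - s g(x)` over a ring `R`, for `s ∈ R` and `g` with integral
coefficients. -/
def oneSub {R : Type*} [CommRing R] {n : ℕ} (s : R) (g : Laurent ℤ n) : Laurent R n :=
  1 - s • AddMonoidAlgebra.mapRingHom (Fin n → ℤ) (Int.castRingHom R) g

/-- The substitution `x ↦ x^p` on Laurent polynomials. -/
def substPow {R : Type*} [CommRing R] {n : ℕ} (p : ℕ) : Laurent R n →+* Laurent R n :=
  AddMonoidAlgebra.mapDomainRingHom R (nsmulAddMonoidHom p)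

/-- The Newton polytope `Δ` of `f = 1 - t g(x)`, regarded as a Laurent polynomial over `ℤ[t]`. -/
def polytope {n : ℕ} (g : Laurent ℤ n) : Set (Fin n → ℝ) :=
  newtonPolytope (oneSub (Polynomial.X : Polynomial ℤ) g)

theorem finite_lattice {n : ℕ} (g : Laurent ℤ n) (k : ℕ) :
    {u : Fin n → ℤ | toReal u ∈ (k : ℝ) • polytope g}.Finite := by
  have hb : Bornology.IsBounded ((k : ℝ) • polytope g) := by
    refine Bornology.IsBounded.smul₀ ?_ _
    exact (isBounded_convexHull).2 ((Finset.finite_toSet _).image _).isBounded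
  obtain ⟨C, hC⟩ := hb.exists_norm_le
  refine (Set.finite_Icc (fun _ : Fin n => -⌈C⌉) (fun _ => ⌈C⌉)).subset ?_
  intro u hu
  have h : ∀ i, |(u i : ℝ)| ≤ C := fun i => by
    simpa [toReal] using (norm_le_pi_norm (toReal u) i).trans (hC _ hu)
  constructor <;> intro i
  · have h1 : (-⌈C⌉ : ℝ) ≤ u i := by
      have := (abs_le.1 (h i)).1
      have := Int.le_ceil C
      linarith
    exact_mod_cast h1
  · have h1 : (u i : ℝ) ≤ ⌈C⌉ := (abs_le.1 (h i)).2.trans (Int.le_ceil C)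
    exact_mod_cast h1

/-- The finite set `(kΔ)_ℤ` of lattice points of `kΔ`. -/
def latticePoints {n : ℕ} (g : Laurent ℤ n) (k : ℕ) : Finset (Fin n → ℤ) :=
  (finite_lattice g k).toFinset

/-! ### Hasse–Witt matrices -/

variable (p : ℕ) [Fact p.Prime] {n : ℕ} (g : Laurent ℤ n) (tσ : PowerSeries ℤ_[p])

/-- The Laurent polynomial
`F^{(k)}(x) = f(x)^{p-k} ∑_{r<k} (f^σ(x^p) - f(x)^p)^r f^σ(x^p)^{k-1-r}` over `ℤ_p[[t]]`,
where `f = 1 - t g` and `f^σ = 1 - t^σ g`. -/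
def hwPolynomial (k : ℕ) : Laurent (PowerSeries ℤ_[p]) n :=
  let f : Laurent (PowerSeries ℤ_[p]) n := oneSub PowerSeries.X g
  let fσ : Laurent (PowerSeries ℤ_[p]) n := substPow p (oneSub tσ g)
  f ^ (p - k) * ∑ r ∈ Finset.range k, (fσ - f ^ p) ^ r * fσ ^ (k - 1 - r)

/-- The `k`-th Hasse–Witt matrix, indexed by `u, v ∈ (kΔ)_ℤ`: the coefficient of `x^{pv-u}` in
`F^{(k)}` divided by `t^{p deg v - deg u}`. The exponent may be negative, so the division is
carried out in the ring of Laurent series in `t` over `ℤ_p`. -/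
def hwMatrix (k : ℕ) : Matrix (latticePoints g k) (latticePoints g k) (LaurentSeries ℤ_[p]) :=
  fun u v =>
    HahnSeries.single
        (-((p : ℤ) * deg (polytope g) v.1 - deg (polytope g) u.1)) (1 : ℤ_[p]) *
      HahnSeries.ofPowerSeries ℤ ℤ_[p] ((hwPolynomial p g tσ k).coeff (p • v.1 - u.1))

/-- `L(k) = ∑_{ℓ=1}^k (#(kΔ)_ℤ - #(ℓΔ)_ℤ)`; for `0 ∈ Δ` no term is negative. -/
def hwExponent (k : ℕ) : ℕ :=
  ∑ l ∈ Finset.Icc 1 k, ((latticePoints g k).card - (latticePoints g l).card)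

/-- The `k`-th Hasse–Witt condition: for `1 ≤ ℓ ≤ k` the determinant of the `ℓ`-th Hasse–Witt
matrix is `p^{L(ℓ)}` times a unit of `ℤ_p[[t]]`. -/
def HasseWittCondition (k : ℕ) : Prop :=
  ∀ l : ℕ, 1 ≤ l → l ≤ k → ∃ hw : (PowerSeries ℤ_[p])ˣ,
    (hwMatrix p g tσ l).det =
      (p : LaurentSeries ℤ_[p]) ^ hwExponent g l *
        HahnSeries.ofPowerSeries ℤ ℤ_[p] (hw : PowerSeries ℤ_[p])

end HasseWitt

end

open scoped Pointwise

noncomputable section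

/-! Put `f = 1 - t g` and `f^σ(x^p) - f^p = p G`; here `G` has coefficients in `ℤ_p[[t]]`. A
geometric sum gives `F^{(k)} f^k = f^σ(x^p)^k - p^k G^k`. So, up to normalizing powers of `t`, the
Hasse–Witt matrix describes the Cartier operator modulo `p^k`, taking `x^u / f^k` to combinations of
`x^v / (f^σ)^k`. Moreover `L(k)` is the sum of `deg u - 1` over the nonzero `u` in `kΔ`
(`hwExponent_eq_sum`).

Divisibility over `ℤ_p[[t]]`: the `r`-th term of `F^{(k)}` carries `p^r`, and its Cartier image has
pole order at most `r + 1`. Expanding by pole order, with Nakayama's lemma in `t`, puts each row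
into the span of vectors divisible by `p^(deg v - 1)` (`hwRow_mem_span`). Hence `p^L(k)` divides the
determinant (`exists_matrix_det_dvd`), and the quotient is a unit as soon as its value at `t = 0` is
one.

At `t = 0`: the cones over the proper faces form a complete unimodular fan, and only lattice points
in a common cone interact. The lowest coefficients of `f^(-k)` are multinomial. Up to a unit
depending on `u`, the coefficient of `x^u / f^k` at `b` is a factor depending only on `b` times
`Q_u(b)`, with `Q_u` a polynomial of degree at most `k` without constant term. Passing from `b` to
`p b` introduces a quotient of `p`-adic gamma type, congruent modulo `p^k` to `R(p b)` with `R(0) =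
1`; this rests on Newton interpolation and `k < p`. Expanding in monomials, the coefficient matrix
at the points `b` is `U W`, and at the points `p b` it is `U T D W` modulo `p^k`, where `T` is
unitriangular and `D` is diagonal with entries `p^(deg - 1)`. These exponents are below `k`, so the
congruence determines the determinant up to a unit (`det_eq_of_congruence`,
`det_eq_of_cartier_congruence`).

Reflexivity enters by placing the origin in the interior of `Δ`, which makes the gauge of `Δ`
available for building the fan (`IsReflexive.zero_mem_interior`, `IsUnimodularPolytope.fan`). -/

namespace HasseWitt

/-! ### Functions on `ℕ` with highly divisible differences -/

section Differences

variable {S : Type*} [CommRing S]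

/-- The first `J` iterated differences of `φ` satisfy `π ^ min (a + j) k ∣ Δ^j φ`. -/
def DiffDvd (π : S) (k : ℕ) : ℕ → ℕ → (ℕ → S) → Prop
  | 0, a, φ => ∀ m, π ^ min a k ∣ φ m
  | J + 1, a, φ => (∀ m, π ^ min a k ∣ φ m) ∧ DiffDvd π k J (a + 1) (fun m => φ (m + 1) - φ m)

variable {π : S} {k : ℕ}

theorem DiffDvd.dvd {J a : ℕ} {φ : ℕ → S} (h : DiffDvd π k J a φ) (m : ℕ) :
    π ^ min a k ∣ φ m := by
  cases J with
  | zero => exact h m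
  | succ J => exact h.1 m

theorem DiffDvd.of_succ {J a : ℕ} {φ : ℕ → S} (h : DiffDvd π k (J + 1) a φ) :
    DiffDvd π k J a φ := by
  induction J generalizing a φ with
  | zero => exact h.1
  | succ J ih => exact ⟨h.1, ih h.2⟩

theorem DiffDvd.shift {J a : ℕ} {φ : ℕ → S} (h : DiffDvd π k J a φ) :
    DiffDvd π k J a (fun m => φ (m + 1)) := by
  induction J generalizing a φ with
  | zero => exact fun m => h (m + 1)
  | succ J ih => exact ⟨fun m => h.1 (m + 1), ih h.2⟩

theorem DiffDvd.add {J a : ℕ} {φ ψ : ℕ → S} (h : DiffDvd π k J a φ) (h' : DiffDvd π k J a ψ) :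
    DiffDvd π k J a (fun m => φ m + ψ m) := by
  induction J generalizing a φ ψ with
  | zero => exact fun m => dvd_add (h m) (h' m)
  | succ J ih =>
    refine ⟨fun m => dvd_add (h.1 m) (h'.1 m), ?_⟩
    convert ih h.2 h'.2 using 2
    ring

/-- Leibniz rule for differences: `Δ(φψ)(m) = Δφ(m) ψ(m) + φ(m+1) Δψ(m)`. -/
theorem DiffDvd.mul {J a b : ℕ} {φ ψ : ℕ → S} (h : DiffDvd π k J a φ) (h' : DiffDvd π k J b ψ) :
    DiffDvd π k J (a + b) (fun m => φ m * ψ m) := by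
  have key : ∀ {J a b : ℕ} {φ ψ : ℕ → S}, DiffDvd π k J a φ → DiffDvd π k J b ψ → ∀ m,
      π ^ min (a + b) k ∣ φ m * ψ m := by
    intro J a b φ ψ h h' m
    refine dvd_trans (pow_dvd_pow π ?_) ((pow_add π (min a k) (min b k)).dvd.trans
      (mul_dvd_mul (h.dvd m) (h'.dvd m)))
    omega
  induction J generalizing a b φ ψ with
  | zero => exact key h h'
  | succ J ih =>
    refine ⟨key h h', ?_⟩
    have h1 := ih h.2 h'.of_succ
    have h2 := ih h.of_succ.shift h'.2
    rw [add_right_comm] at h1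
    rw [← add_assoc] at h2
    convert h1.add h2 using 2
    ring

/-- All exponents are capped at `k`, so whatever vanishes modulo `π ^ k` is negligible. -/
theorem diffDvd_of_pow_dvd {J a : ℕ} {φ : ℕ → S} (h : ∀ m, π ^ k ∣ φ m) : DiffDvd π k J a φ := by
  induction J generalizing a φ with
  | zero => exact fun m => (pow_dvd_pow π (min_le_right a k)).trans (h m)
  | succ J ih =>
    exact ⟨fun m => (pow_dvd_pow π (min_le_right a k)).trans (h m),
      ih fun m => dvd_sub (h (m + 1)) (h m)⟩

theorem diffDvd_const {J a : ℕ} {x : S} (h : π ^ a ∣ x) : DiffDvd π k J a (fun _ => x) := by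
  have h' : π ^ min a k ∣ x := (pow_dvd_pow π (min_le_left a k)).trans h
  cases J with
  | zero => exact fun _ => h'
  | succ J => exact ⟨fun _ => h', diffDvd_of_pow_dvd fun m => by simp⟩

theorem diffDvd_mul_natCast (J : ℕ) : DiffDvd π k J 0 (fun m => π * (m : S)) := by
  cases J with
  | zero => intro m; simp
  | succ J =>
    refine ⟨fun m => by simp, ?_⟩
    have : (fun m : ℕ => π * ((m + 1 : ℕ) : S) - π * (m : S)) = fun _ => π := by
      funext m; push_cast; ring
    rw [this]
    exact diffDvd_const (by simp)

/-- The first difference of `π m` is the constant `π`; the Leibniz rule extends this to powers of `π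
m`. -/
theorem diffDvd_eval (J : ℕ) (P : Polynomial S) :
    DiffDvd π k J 0 (fun m => P.eval (π * (m : S))) := by
  induction P using Polynomial.induction_on' with
  | add P Q hP hQ => simpa using hP.add hQ
  | monomial i a =>
    have hpow : DiffDvd π k J 0 (fun m => (π * (m : S)) ^ i) := by
      induction i with
      | zero => simpa using diffDvd_const (by simp)
      | succ i ih => simpa [pow_succ] using ih.mul (diffDvd_mul_natCast J)
    simpa using (diffDvd_const (x := a) (by simp)).mul hpow

theorem DiffDvd.dvd_fwdDiff_iter {J a : ℕ} {φ : ℕ → S} (h : DiffDvd π k J a φ) {j : ℕ}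
    (hj : j ≤ J) (m : ℕ) : π ^ min (a + j) k ∣ (fwdDiff 1)^[j] φ m := by
  induction j generalizing J a φ with
  | zero => simpa using h.dvd m
  | succ j ih =>
    obtain ⟨J, rfl⟩ : ∃ J', J = J' + 1 := ⟨J - 1, by omega⟩
    have := ih h.2 (by omega)
    rw [Function.iterate_succ_apply]
    rwa [show a + 1 + j = a + (j + 1) by ring] at this

/-- A solution of `φ (m + 1) = (1 + q m) φ m` has highly divisible differences if `q` has. -/
theorem diffDvd_of_recurrence {φ q : ℕ → S} (hq : ∀ J, DiffDvd π k J 1 q)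
    (h : ∀ m, φ (m + 1) = (1 + q m) * φ m) (J : ℕ) : DiffDvd π k J 0 φ := by
  induction J with
  | zero => intro m; simp
  | succ J ih =>
    refine ⟨fun m => by simp, ?_⟩
    -- The difference is `q φ`, so the exponent `1` of `q` turns the bound on `J` differences of `φ`
    -- into one on `J + 1`.
    have : (fun m => φ (m + 1) - φ m) = fun m => q m * φ m := by
      funext m; rw [h]; ring
    rw [this]
    exact (hq J).mul ih

/-- Newton interpolation: a function with highly divisible differences is congruent to a
polynomial in `π m`. -/
theorem exists_polynomial_of_diffDvd {φ : ℕ → S} (h : ∀ J, DiffDvd π k J 0 φ)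
    (hk : ∀ j < k, IsUnit ((j.factorial : ℕ) : S)) (hk0 : 0 < k) :
    ∃ Q : Polynomial S, Q.coeff 0 = φ 0 ∧ ∀ m : ℕ, π ^ k ∣ φ m - Q.eval (π * (m : S)) := by
  classical
  have hd : ∀ j, ∃ d : S, j < k → (fwdDiff 1)^[j] φ 0 = π ^ j * d := by
    intro j
    by_cases hj : j < k
    · obtain ⟨d, hd⟩ := (h j).dvd_fwdDiff_iter le_rfl 0
      exact ⟨d, fun _ => by rwa [zero_add, min_eq_left hj.le] at hd⟩
    · exact ⟨0, fun h => absurd h hj⟩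
  choose d hd using hd
  have hw : ∀ j, ∃ w : S, j < k → (j.factorial : S) * w = 1 := by
    intro j
    by_cases hj : j < k
    · obtain ⟨w, hw⟩ := (hk j hj).exists_right_inv
      exact ⟨w, fun _ => hw⟩
    · exact ⟨0, fun h => absurd h hj⟩
  choose w hw using hw
  -- Newton's series `∑ C(m,j) Δ^j φ(0)`, where `Δ^j φ(0) = π^j d_j` and `π^j j! C(m,j) = ∏_{i<j} (π
  -- m - π i)`; `w j` inverts `j!`.
  refine ⟨∑ j ∈ Finset.range k, Polynomial.C (d j * w j) *
    ∏ i ∈ Finset.range j, (Polynomial.X - Polynomial.C (π * (i : S))), ?_, fun m => ?_⟩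
  · rw [Polynomial.coeff_zero_eq_eval_zero, Polynomial.eval_finsetSum]
    rw [Finset.sum_eq_single_of_mem 0 (Finset.mem_range.2 hk0)]
    · have h0 := hd 0 hk0
      have h1 := hw 0 hk0
      simp only [Function.iterate_zero, id_eq, pow_zero, one_mul] at h0
      simp only [Nat.factorial_zero, Nat.cast_one, one_mul] at h1
      simp [h0, h1]
    · intro j _ hj
      rw [Polynomial.eval_mul, Polynomial.eval_prod]
      rw [Finset.prod_eq_zero (i := 0) (Finset.mem_range.2 (Nat.pos_of_ne_zero hj)) (by simp),
        mul_zero]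
  · have hN := shift_eq_sum_fwdDiff_iter 1 φ m 0
    rw [zero_add, smul_eq_mul, mul_one] at hN
    -- The sum is padded with vanishing binomials so that its first `k` terms can always be split
    -- off; the others are divisible by `π ^ k`.
    have hN' : φ m = ∑ j ∈ Finset.range (m + 1 + k), m.choose j • (fwdDiff 1)^[j] φ 0 := by
      rw [hN]
      refine Finset.sum_subset (Finset.range_subset_range.2 (by omega)) fun j _ hj => ?_
      rw [Nat.choose_eq_zero_of_lt (by simpa using hj), zero_smul]
    have hQ : Polynomial.eval (π * (m : S)) (∑ j ∈ Finset.range k, Polynomial.C (d j * w j) *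
        ∏ i ∈ Finset.range j, (Polynomial.X - Polynomial.C (π * (i : S)))) =
        ∑ j ∈ Finset.range k, m.choose j • (fwdDiff 1)^[j] φ 0 := by
      rw [Polynomial.eval_finsetSum]
      refine Finset.sum_congr rfl fun j hj => ?_
      have hj := Finset.mem_range.1 hj
      have hprod : ∏ i ∈ Finset.range j, (π * (m : S) - π * (i : S)) =
          π ^ j * ((j.factorial : S) * (m.choose j : S)) := by
        have h1 : ∏ i ∈ Finset.range j, (π * (m : S) - π * (i : S)) =
            π ^ j * ∏ i ∈ Finset.range j, ((m : S) - i) := by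
          simp only [← mul_sub, Finset.prod_mul_distrib, Finset.prod_const, Finset.card_range]
        rw [h1, ← Nat.cast_mul, ← Nat.descFactorial_eq_factorial_mul_choose,
          ← descPochhammer_eval_eq_descFactorial, descPochhammer_eval_eq_prod_range]
      rw [Polynomial.eval_mul, Polynomial.eval_C, Polynomial.eval_prod]
      simp only [Polynomial.eval_sub, Polynomial.eval_X, Polynomial.eval_C]
      rw [hprod, hd j hj, nsmul_eq_mul]
      linear_combination (d j * π ^ j * (m.choose j : S)) * hw j hj
    rw [hN', hQ, add_comm (m + 1) k, Finset.sum_range_add, add_sub_cancel_left]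
    refine Finset.dvd_sum fun j _ => ?_
    rw [nsmul_eq_mul]
    refine Dvd.dvd.mul_left ?_ _
    have := (h (k + j)).dvd_fwdDiff_iter le_rfl 0
    rwa [min_eq_right (by omega)] at this

end Differences

/-! ### The `p`-adic gamma quotient `(p m)! / (p ^ m m!)` -/

section GammaQuotient

/-- The product of the integers up to `p m` that are prime to `p`, that is,
`(p m)! / (p ^ m m!)`. -/
def primeToFactorial (p m : ℕ) : ℕ :=
  ∏ i ∈ Finset.range m, ∏ a ∈ Finset.range (p - 1), (p * i + (a + 1))

theorem factorial_mul_eq {p : ℕ} (hp : 0 < p) (m : ℕ) :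
    (p * m).factorial = p ^ m * m.factorial * primeToFactorial p m := by
  induction m with
  | zero => simp [primeToFactorial]
  | succ m ih =>
    have h1 : (p * (m + 1)).factorial =
        (p * m).factorial * ∏ a ∈ Finset.range p, (p * m + (a + 1)) := by
      rw [mul_add, mul_one, ← Nat.factorial_mul_ascFactorial, Nat.ascFactorial_eq_prod_range]
      congr 1
      exact Finset.prod_congr rfl fun a _ => by ring
    obtain ⟨p, rfl⟩ : ∃ q, p = q + 1 := ⟨p - 1, by omega⟩
    rw [h1, ih, Finset.prod_range_succ, primeToFactorial, primeToFactorial,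
      Finset.prod_range_succ, Nat.factorial_succ]
    simp only [Nat.add_sub_cancel]
    ring

variable (p : ℕ) [hp : Fact p.Prime]

/-- Both sides are monic of degree `p - 1` and vanish at the `p - 1` nonzero residues. -/
theorem prod_X_add_C_zmod :
    ∏ a ∈ Finset.range (p - 1), (Polynomial.X + Polynomial.C ((a + 1 : ℕ) : ZMod p)) =
      Polynomial.X ^ (p - 1) - 1 := by
  have hp2 := hp.out.two_le
  have hm1 : (∏ a ∈ Finset.range (p - 1),
      (Polynomial.X + Polynomial.C ((a + 1 : ℕ) : ZMod p))).Monic :=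
    Polynomial.monic_prod_of_monic _ _ fun a _ => Polynomial.monic_X_add_C _
  have hd1 : (∏ a ∈ Finset.range (p - 1),
      (Polynomial.X + Polynomial.C ((a + 1 : ℕ) : ZMod p))).degree = ((p - 1 : ℕ) : WithBot ℕ) := by
    rw [Polynomial.degree_prod]
    simp only [Polynomial.degree_X_add_C]
    simp
  have hm2 : (Polynomial.X ^ (p - 1) - 1 : Polynomial (ZMod p)).Monic :=
    Polynomial.monic_X_pow_sub_C 1 (by omega)
  have hd2 : (Polynomial.X ^ (p - 1) - 1 : Polynomial (ZMod p)).degree = ((p - 1 : ℕ) : WithBot ℕ) :=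
    Polynomial.degree_X_pow_sub_C (by omega) 1
  refine Polynomial.eq_of_degree_sub_lt_of_eval_finset_eq
    (Finset.univ.erase (0 : ZMod p)) ?_ ?_
  · rw [Finset.card_erase_of_mem (Finset.mem_univ _), Finset.card_univ, ZMod.card, ← hd1]
    exact Polynomial.degree_sub_lt_left (hd1.trans hd2.symm) hm1.ne_zero (by rw [hm1, hm2])
  · intro x hx
    have hx0 : x ≠ 0 := Finset.ne_of_mem_erase hx
    rw [Polynomial.eval_prod, Polynomial.eval_sub, Polynomial.eval_pow, Polynomial.eval_X,
      Polynomial.eval_one, ZMod.pow_card_sub_one_eq_one hx0, sub_self]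
    have hv := ZMod.val_lt (-x)
    have hv0 : (-x).val ≠ 0 := by simpa using hx0
    refine Finset.prod_eq_zero (i := (-x).val - 1) (Finset.mem_range.2 (by omega)) ?_
    rw [Nat.sub_add_cancel (by omega)]
    simp

theorem exists_prod_X_add_C_padic : ∃ S : Polynomial ℤ_[p],
    ∏ a ∈ Finset.range (p - 1), (Polynomial.X + Polynomial.C ((a + 1 : ℕ) : ℤ_[p])) =
      Polynomial.X ^ (p - 1) - 1 + Polynomial.C (p : ℤ_[p]) * S := by
  have h : Polynomial.C (p : ℤ) ∣
      (∏ a ∈ Finset.range (p - 1), (Polynomial.X + Polynomial.C ((a + 1 : ℕ) : ℤ))) -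
        (Polynomial.X ^ (p - 1) - 1) := by
    rw [Polynomial.C_dvd_iff_dvd_coeff]
    intro i
    rw [← ZMod.intCast_zmod_eq_zero_iff_dvd]
    have := congrArg (fun P => Polynomial.coeff P i) (sub_eq_zero.2 (prod_X_add_C_zmod p))
    rw [← Polynomial.coeff_zero (R := ZMod p) i, ← this]
    change Int.castRingHom (ZMod p) _ = _
    rw [← Polynomial.coeff_map]
    simp [Polynomial.map_prod]
  obtain ⟨S, hS⟩ := h
  refine ⟨S.map (Int.castRingHom _), ?_⟩
  have := congrArg (Polynomial.map (Int.castRingHom ℤ_[p])) (sub_eq_iff_eq_add'.1 hS)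
  simpa [Polynomial.map_prod] using this

theorem isUnit_factorial_padic {j : ℕ} (hj : j < p) : IsUnit ((j.factorial : ℕ) : ℤ_[p]) := by
  rw [PadicInt.isUnit_iff, PadicInt.norm_natCast_eq_one_iff]
  rw [hp.out.coprime_iff_not_dvd, hp.out.dvd_factorial]
  omega

theorem isUnit_primeToFactorial (m : ℕ) : IsUnit ((primeToFactorial p m : ℕ) : ℤ_[p]) := by
  rw [PadicInt.isUnit_iff, PadicInt.norm_natCast_eq_one_iff, primeToFactorial]
  refine Nat.Coprime.prod_right fun i _ => Nat.Coprime.prod_right fun a ha => ?_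
  rw [Nat.coprime_mul_left_add_right, hp.out.coprime_iff_not_dvd]
  have := Finset.mem_range.1 ha
  exact Nat.not_dvd_of_pos_of_lt (by omega) (by omega)

/-- Up to the factor `(p - 1)! ^ m`, the quotient `(p m)! / (p ^ m m!)` is congruent modulo `p ^ k`
to a polynomial in `p m`. -/
theorem exists_polynomial_primeToFactorial {k : ℕ} (hk0 : 0 < k) (hk : k < p) :
    ∃ Q : Polynomial ℤ_[p], Q.coeff 0 = 1 ∧ ∀ m : ℕ, (p : ℤ_[p]) ^ k ∣
      primeToFactorial p m - (((p - 1).factorial : ℕ) : ℤ_[p]) ^ m * Q.eval ((p : ℤ_[p]) * m) := by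
  have hp2 := hp.out.two_le
  obtain ⟨w, hw⟩ := (isUnit_factorial_padic p (show p - 1 < p by omega)).exists_right_inv
  obtain ⟨S, hS⟩ := exists_prod_X_add_C_padic p
  set ρ : Polynomial ℤ_[p] :=
    ∏ a ∈ Finset.range (p - 1), (Polynomial.X + Polynomial.C ((a + 1 : ℕ) : ℤ_[p])) with hρ
  set r : ℤ_[p] := (((p - 1).factorial : ℕ) : ℤ_[p]) with hr
  have hr0 : r = ρ.eval 0 := by
    rw [hr, hρ, Polynomial.eval_prod, ← Finset.prod_range_add_one_eq_factorial]
    push_cast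
    simp
  have hstep : ∀ m : ℕ, (primeToFactorial p (m + 1) : ℤ_[p]) =
      primeToFactorial p m * ρ.eval ((p : ℤ_[p]) * m) := by
    intro m
    rw [primeToFactorial, Finset.prod_range_succ, ← primeToFactorial, hρ, Polynomial.eval_prod]
    simp
  have hrS : r = -1 + p * S.eval 0 := by
    rw [hr0, hS]
    simp [show p - 1 ≠ 0 by omega]
  have hρS : ∀ x, ρ.eval x = x ^ (p - 1) - 1 + p * S.eval x := by
    intro x; rw [hS]; simp
  -- Dividing by `ρ(0)^m = (p-1)!^m` gives the recurrence with ratio `ρ(p m) / ρ(0)`. As `ρ =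
  -- X^(p-1) - 1 + p S`, the ratio minus `1` consists of a multiple of `(p m)^(p-1)`, which is zero
  -- modulo `p^k` because `k < p`, and of `p` times a polynomial in `p m`.
  have hdiff : ∀ J, DiffDvd (p : ℤ_[p]) k J 0 (fun m => w ^ m * primeToFactorial p m) := by
    refine diffDvd_of_recurrence
      (q := fun m => w * ((p : ℤ_[p]) * m) ^ (p - 1) +
        (p : ℤ_[p]) * (Polynomial.C w * (S - Polynomial.C (S.eval 0))).eval ((p : ℤ_[p]) * m))
      (fun J => DiffDvd.add (diffDvd_of_pow_dvd fun m => ?_)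
        ((diffDvd_const (a := 1) (by simp)).mul (diffDvd_eval J _)))
      (fun m => ?_)
    · refine Dvd.dvd.mul_left ?_ _
      rw [mul_pow]
      exact (pow_dvd_pow _ (by omega)).mul_right _
    · simp only [Polynomial.eval_mul, Polynomial.eval_sub, Polynomial.eval_C]
      rw [hstep, pow_succ, hρS]
      linear_combination (-(w ^ m * (primeToFactorial p m : ℤ_[p]) * w)) * hrS +
        (w ^ m * (primeToFactorial p m : ℤ_[p])) * hw
  obtain ⟨Q, hQ0, hQ⟩ := exists_polynomial_of_diffDvd hdiff
    (fun j hj => isUnit_factorial_padic p (hj.trans hk)) hk0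
  refine ⟨Q, by simpa [primeToFactorial] using hQ0, fun m => ?_⟩
  have h1 : r ^ m * w ^ m = 1 := by rw [← mul_pow, hw, one_pow]
  have h2 : (primeToFactorial p m : ℤ_[p]) - r ^ m * Q.eval ((p : ℤ_[p]) * m) =
      r ^ m * (w ^ m * primeToFactorial p m - Q.eval ((p : ℤ_[p]) * m)) := by
    linear_combination (-(primeToFactorial p m : ℤ_[p])) * h1
  rw [h2]
  exact (hQ m).mul_left _

theorem dvd_pow_sub_one_of_isUnit {γ : ℤ_[p]} (hγ : IsUnit γ) :
    (p : ℤ_[p]) ∣ γ ^ (p - 1) - 1 := by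
  rw [← Ideal.mem_span_singleton, ← PadicInt.maximalIdeal_eq_span_p, ← PadicInt.ker_toZMod,
    RingHom.mem_ker, map_sub, map_pow, map_one,
    ZMod.pow_card_sub_one_eq_one (hγ.map PadicInt.toZMod).ne_zero, sub_self]

/-- The recurrence here has the constant `q = γ^(p-1) - 1`, divisible by `p` by Fermat. -/
theorem exists_polynomial_pow {k : ℕ} (hk0 : 0 < k) (hk : k < p) {γ : ℤ_[p]} (hγ : IsUnit γ) :
    ∃ Q : Polynomial ℤ_[p], Q.coeff 0 = 1 ∧ ∀ m : ℕ, (p : ℤ_[p]) ^ k ∣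
      γ ^ ((p - 1) * m) - Q.eval ((p : ℤ_[p]) * m) := by
  obtain ⟨Q, hQ0, hQ⟩ := exists_polynomial_of_diffDvd (π := (p : ℤ_[p])) (k := k)
    (φ := fun m => γ ^ ((p - 1) * m))
    (diffDvd_of_recurrence (q := fun m => γ ^ (p - 1) - 1)
      (fun J => diffDvd_const (by simpa using dvd_pow_sub_one_of_isUnit p hγ))
      (fun m => by ring))
    (fun j hj => isUnit_factorial_padic p (hj.trans hk)) hk0
  exact ⟨Q, by simpa using hQ0, hQ⟩

/-- Truncated geometric series: `1 - Q Q' = (1 - Q)^(k+1)`, and `1 - Q` is divisible by `X`. -/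
theorem exists_polynomial_inverse {k : ℕ} {Q : Polynomial ℤ_[p]} (hQ : Q.coeff 0 = 1) :
    ∃ Q' : Polynomial ℤ_[p], Q'.coeff 0 = 1 ∧ ∀ m : ℕ, (p : ℤ_[p]) ^ (k + 1) ∣
      1 - Q.eval ((p : ℤ_[p]) * m) * Q'.eval ((p : ℤ_[p]) * m) := by
  refine ⟨∑ j ∈ Finset.range (k + 1), (1 - Q) ^ j, ?_, fun m => ?_⟩
  · rw [Polynomial.coeff_zero_eq_eval_zero] at hQ ⊢
    simp [Polynomial.eval_finsetSum, hQ, Finset.sum_range_succ']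
  · have h1 := mul_neg_geom_sum (1 - Q) (k + 1)
    rw [sub_sub_cancel] at h1
    rw [← Polynomial.eval_mul, h1]
    simp only [Polynomial.eval_sub, Polynomial.eval_one, Polynomial.eval_pow, sub_sub_cancel]
    refine pow_dvd_pow_of_dvd ?_ _
    have h2 : Polynomial.X ∣ 1 - Q := by
      rw [Polynomial.X_dvd_iff]; simp [hQ]
    obtain ⟨P, hP⟩ := h2
    have h3 := congrArg (Polynomial.eval ((p : ℤ_[p]) * m)) hP
    simp only [Polynomial.eval_sub, Polynomial.eval_one, Polynomial.eval_mul,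
      Polynomial.eval_X] at h3
    rw [h3, mul_assoc]
    exact dvd_mul_right _ _

/-- The quotient of multinomial-type factors occurring in the Cartier operation on a simplex is
congruent modulo `p ^ k` to a polynomial in `p B` with constant term `1`. -/
theorem exists_mvPolynomial_gammaQuotient {V : Type*} [Fintype V] {k : ℕ} (hk0 : 0 < k) (hk : k < p)
    (γ : V → ℤ_[p]) (hγ : ∀ i, IsUnit (γ i)) :
    ∃ R : MvPolynomial V ℤ_[p], MvPolynomial.constantCoeff R = 1 ∧ ∀ B : V →₀ ℕ,
      (p : ℤ_[p]) ^ k ∣ primeToFactorial p B.degree * ∏ i, γ i ^ ((p - 1) * B i) -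
        (∏ i, (primeToFactorial p (B i) : ℤ_[p])) *
          MvPolynomial.eval (fun i => (p : ℤ_[p]) * B i) R := by
  obtain ⟨Q, hQ0, hQ⟩ := exists_polynomial_primeToFactorial p hk0 hk
  obtain ⟨Q', hQ'0, hQ'⟩ := exists_polynomial_inverse p (k := k - 1) hQ0
  choose P hP0 hP using fun i => exists_polynomial_pow p hk0 hk (hγ i)
  rw [Nat.sub_add_cancel hk0] at hQ'
  -- `Q` at the sum of the variables serves the numerator, `Q'` the denominators and `P i` the
  -- powers of `γ i`. The factors `(p-1)!^(B i)` multiply to `(p-1)!^(deg B)` and cancel.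
  refine ⟨Polynomial.aeval (∑ i, MvPolynomial.X i) Q *
    ∏ i, (Polynomial.aeval (MvPolynomial.X i) (Q' * P i)), ?_, fun B => ?_⟩
  · rw [map_mul, map_prod]
    have : ∀ (q : Polynomial ℤ_[p]) (x : MvPolynomial V ℤ_[p]),
        MvPolynomial.constantCoeff x = 0 →
        MvPolynomial.constantCoeff (Polynomial.aeval x q) = q.coeff 0 := by
      intro q x hx
      rw [Polynomial.aeval_def, Polynomial.hom_eval₂, hx, Polynomial.eval₂_at_zero]
      simp [MvPolynomial.algebraMap_eq]
    rw [this _ _ (by simp), hQ0, one_mul]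
    refine Finset.prod_eq_one fun i _ => ?_
    rw [this _ _ (by simp), Polynomial.mul_coeff_zero, hQ'0, hP0, one_mul]
  · have hev : ∀ (q : Polynomial ℤ_[p]) (x : MvPolynomial V ℤ_[p]) (y : V → ℤ_[p]),
        MvPolynomial.eval y (Polynomial.aeval x q) = q.eval (MvPolynomial.eval y x) := by
      intro q x y
      rw [Polynomial.aeval_def, Polynomial.hom_eval₂, Polynomial.eval]
      congr 1
      ext; simp [MvPolynomial.algebraMap_eq]
    rw [map_mul, map_prod]
    simp only [hev, map_sum, MvPolynomial.eval_X, Polynomial.eval_mul]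
    rw [← Finset.mul_sum, ← Nat.cast_sum, ← Finsupp.degree_eq_sum]
    rw [← Ideal.mem_span_singleton, ← Ideal.Quotient.eq]
    have e1 := fun m => Ideal.Quotient.eq.2 (Ideal.mem_span_singleton.2 (hQ m))
    have e2 := fun m => Ideal.Quotient.eq.2 (Ideal.mem_span_singleton.2 (hQ' m))
    have e3 := fun i m => Ideal.Quotient.eq.2 (Ideal.mem_span_singleton.2 (hP i m))
    simp only [map_mul, map_prod, map_one] at e1 e2 e3 ⊢
    simp only [e1, e3]
    rw [Finset.prod_mul_distrib, Finset.prod_mul_distrib]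
    have e4 : ∀ B : V →₀ ℕ, (∏ i, (Ideal.Quotient.mk (Ideal.span {(p : ℤ_[p]) ^ k}))
        (Q.eval ((p : ℤ_[p]) * B i))) * ∏ i, (Ideal.Quotient.mk (Ideal.span {(p : ℤ_[p]) ^ k}))
        (Q'.eval ((p : ℤ_[p]) * B i)) = 1 := by
      intro B
      rw [← Finset.prod_mul_distrib]
      exact Finset.prod_eq_one fun i _ => (e2 (B i)).symm
    simp only [map_pow]
    rw [Finset.prod_pow_eq_pow_sum, ← Finsupp.degree_eq_sum]
    linear_combination (-(Ideal.Quotient.mk (Ideal.span {(p : ℤ_[p]) ^ k})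
      (((p - 1).factorial : ℕ) : ℤ_[p]) ^ B.degree *
      (Ideal.Quotient.mk (Ideal.span {(p : ℤ_[p]) ^ k}) (Q.eval ((p : ℤ_[p]) * B.degree))) *
      ∏ i, (Ideal.Quotient.mk (Ideal.span {(p : ℤ_[p]) ^ k}))
        ((P i).eval ((p : ℤ_[p]) * B i)))) * e4 B

end GammaQuotient

/-! ### Determinants -/

section Determinants

/-- Sorting by `d` makes the matrix block triangular with diagonal blocks. -/
theorem det_of_graded_triangular {ι S : Type*} [Fintype ι] [DecidableEq ι] [CommRing S]
    (A : Matrix ι ι S) (d : ι → ℕ) (h : ∀ i j, A i j ≠ 0 → i = j ∨ d i < d j) :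
    A.det = ∏ i, A i i := by
  have hb : A.BlockTriangular d := fun i j hij => by
    by_contra hne
    rcases h i j hne with rfl | h'
    · exact lt_irrefl _ hij
    · exact lt_asymm hij h'
  rw [hb.det]
  have hblock : ∀ a, (A.toSquareBlock d a).det = ∏ i : {i // d i = a}, A i i := by
    intro a
    have : A.toSquareBlock d a = Matrix.diagonal fun i : {i // d i = a} => A i i := by
      ext i j
      rw [Matrix.toSquareBlock_def, Matrix.of_apply, Matrix.diagonal_apply]
      split_ifs with hij
      · rw [hij]
      · by_contra hne
        rcases h i j hne with h' | h'
        · exact hij (Subtype.ext h')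
        · rw [i.2, j.2] at h'
          exact lt_irrefl _ h'
    rw [this, Matrix.det_diagonal]
  simp only [hblock]
  rw [← Finset.prod_fiberwise_of_maps_to (s := Finset.univ) (t := Finset.univ.image d) (g := d)
    (fun i hi => Finset.mem_image_of_mem _ hi)]
  refine Finset.prod_congr rfl fun a _ => ?_
  exact (Finset.prod_subtype (p := fun i => d i = a) _ (by simp) fun i => A i i).symm

variable {p : ℕ} [Fact p.Prime] {ι : Type*} [Fintype ι] [DecidableEq ι]

theorem isUnit_det_add_smul {T : Matrix ι ι ℤ_[p]} (hT : IsUnit T.det) (Y : Matrix ι ι ℤ_[p]) :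
    IsUnit (T + (p : ℤ_[p]) • Y).det := by
  rw [← isUnit_map_iff (IsLocalRing.residue ℤ_[p])] at hT ⊢
  rw [RingHom.map_det] at hT ⊢
  have hp : IsLocalRing.residue ℤ_[p] (p : ℤ_[p]) = 0 := by
    rw [IsLocalRing.residue_eq_zero_iff, PadicInt.maximalIdeal_eq_span_p]
    exact Ideal.mem_span_singleton_self _
  have h : (IsLocalRing.residue ℤ_[p]).mapMatrix (T + (p : ℤ_[p]) • Y) =
      (IsLocalRing.residue ℤ_[p]).mapMatrix T := by
    ext i j
    simp [hp]
  rwa [h]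

/-- If `H X ≡ U T D V` modulo `p ^ k`, where `X = U V` and `T` are invertible and `D` is diagonal
with entries `p ^ e i`, `e i < k`, then `det H` is `det D` up to a unit. -/
theorem det_eq_of_congruence {H X U T V Y : Matrix ι ι ℤ_[p]} {e : ι → ℕ} {k : ℕ}
    (he : ∀ i, e i < k) (hX : IsUnit X.det) (hUV : X = U * V) (hT : IsUnit T.det)
    (h : H * X = U * T * Matrix.diagonal (fun i => (p : ℤ_[p]) ^ e i) * V +
      (p : ℤ_[p]) ^ k • Y) :
    ∃ c : ℤ_[p], IsUnit c ∧ H.det = (p : ℤ_[p]) ^ (∑ i, e i) * c := by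
  have hU : IsUnit U.det := by
    rw [hUV, Matrix.det_mul] at hX; exact isUnit_of_mul_isUnit_left hX
  have hV : IsUnit V.det := by
    rw [hUV, Matrix.det_mul] at hX; exact isUnit_of_mul_isUnit_right hX
  set Z : Matrix ι ι ℤ_[p] := U⁻¹ * Y * V⁻¹
  -- Since `e i < k`, the error satisfies `p^k Z = p Z' D`. It is absorbed into `T`, which changes
  -- only modulo `p` and stays invertible.
  set Z' : Matrix ι ι ℤ_[p] := Z * Matrix.diagonal fun i => (p : ℤ_[p]) ^ (k - 1 - e i)
  have hZ : (p : ℤ_[p]) • Z' * Matrix.diagonal (fun i => (p : ℤ_[p]) ^ e i) =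
      (p : ℤ_[p]) ^ k • Z := by
    rw [Matrix.smul_mul, Matrix.mul_assoc, Matrix.diagonal_mul_diagonal]
    ext i j
    rw [Matrix.smul_apply, Matrix.mul_diagonal, Matrix.smul_apply, ← pow_add, smul_eq_mul,
      smul_eq_mul, mul_left_comm, ← pow_succ', mul_comm]
    congr 2
    have := he j
    omega
  have hY : U * Z * V = Y := by
    simp only [Z, ← Matrix.mul_assoc]
    rw [Matrix.mul_nonsing_inv _ hU, Matrix.one_mul, Matrix.mul_assoc,
      Matrix.nonsing_inv_mul _ hV, Matrix.mul_one]
  have hfac : H * X = U * (T + (p : ℤ_[p]) • Z') *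
      Matrix.diagonal (fun i => (p : ℤ_[p]) ^ e i) * V := by
    rw [h, Matrix.mul_add, Matrix.add_mul, Matrix.add_mul, Matrix.mul_assoc U ((p : ℤ_[p]) • Z'),
      hZ, Matrix.mul_smul, Matrix.smul_mul, hY]
  have hdet := congrArg Matrix.det hfac
  simp only [Matrix.det_mul, Matrix.det_diagonal, Finset.prod_pow_eq_pow_sum] at hdet
  obtain ⟨x, hx⟩ := hX.exists_right_inv
  refine ⟨U.det * (T + (p : ℤ_[p]) • Z').det * V.det * x, ?_, ?_⟩
  · exact ((hU.mul (isUnit_det_add_smul hT Z')).mul hV).mul (IsUnit.of_mul_eq_one _ (by rw [mul_comm]; exact hx))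
  · linear_combination x * hdet - H.det * hx

end Determinants

/-! ### Complete unimodular fans -/

/-- Coordinates on a lattice `Λ` with respect to a complete unimodular fan with rays through
`vert i`: each `u` is uniquely a sum of vertices spanning a common cone, with multiplicities
`coord u`. -/
structure UnimodularFan (Λ V : Type*) [AddCommGroup Λ] [Fintype V] where
  vert : V → Λ
  coord : Λ → V →₀ ℕ
  sum_coord : ∀ u, ∑ i, coord u i • vert i = u
  degree_add_le : ∀ u v, (coord (u + v)).degree ≤ (coord u).degree + (coord v).degree
  coord_add : ∀ u v, (coord (u + v)).degree = (coord u).degree + (coord v).degree →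
    coord (u + v) = coord u + coord v
  coord_sum : ∀ (v : Λ) (m : V →₀ ℕ), m.support ⊆ (coord v).support →
    coord (∑ i, m i • vert i) = m

namespace UnimodularFan

variable {Λ V : Type*} [AddCommGroup Λ] [Fintype V] (Φ : UnimodularFan Λ V)

/-- The degree of a lattice point. -/
def degree (u : Λ) : ℕ := (Φ.coord u).degree

theorem coord_injective : Function.Injective Φ.coord := fun u v h => by
  rw [← Φ.sum_coord u, ← Φ.sum_coord v, h]

@[simp] theorem coord_zero : Φ.coord 0 = 0 := by
  simpa using Φ.coord_sum 0 0 (by simp)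

@[simp] theorem degree_zero : Φ.degree 0 = 0 := by simp [degree]

theorem degree_eq_zero {u : Λ} : Φ.degree u = 0 ↔ u = 0 := by
  rw [degree, Finsupp.degree_eq_zero_iff, ← Φ.coord_zero, Φ.coord_injective.eq_iff]

theorem degree_add (u v : Λ) : Φ.degree (u + v) ≤ Φ.degree u + Φ.degree v := Φ.degree_add_le u v

theorem degree_le_add_sub (u v : Λ) : Φ.degree v ≤ Φ.degree u + Φ.degree (v - u) := by
  simpa using Φ.degree_add u (v - u)

theorem coord_nsmul (m : ℕ) (u : Λ) : Φ.coord (m • u) = m • Φ.coord u := by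
  have h := Φ.coord_sum u (m • Φ.coord u) Finsupp.support_smul
  rw [← h]
  congr 1
  conv_lhs => rw [← Φ.sum_coord u]
  simp [Finset.smul_sum, mul_smul]

theorem degree_nsmul (m : ℕ) (u : Λ) : Φ.degree (m • u) = m * Φ.degree u := by
  simp [degree, coord_nsmul]

theorem coord_sub {u v : Λ} (h : Φ.coord u ≤ Φ.coord v) :
    Φ.coord (v - u) = Φ.coord v - Φ.coord u := by
  have h' := Φ.coord_sum v (Φ.coord v - Φ.coord u) Finsupp.support_tsub
  rw [← h']
  congr 1
  conv_lhs => rw [← Φ.sum_coord u, ← Φ.sum_coord v, ← Finset.sum_sub_distrib]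
  refine Finset.sum_congr rfl fun i _ => ?_
  rw [Finsupp.tsub_apply, sub_nsmul _ (h i), sub_eq_add_neg]

theorem degree_add_degree_sub {u v : Λ} (h : Φ.coord u ≤ Φ.coord v) :
    Φ.degree u + Φ.degree (v - u) = Φ.degree v := by
  rw [degree, degree, degree, Φ.coord_sub h, ← map_add, add_tsub_cancel_of_le h]

/-- Equality in the subadditivity of the degree puts `u` and `v - u` into one cone, where
coordinates add. This translates extremal powers of `t` into the geometry of the fan. -/
theorem coord_le_iff {u v : Λ} :
    Φ.coord u ≤ Φ.coord v ↔ Φ.degree u + Φ.degree (v - u) = Φ.degree v := by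
  refine ⟨Φ.degree_add_degree_sub, fun h => ?_⟩
  have := Φ.coord_add u (v - u) (by rw [add_sub_cancel]; exact h.symm)
  rw [add_sub_cancel] at this
  rw [this]
  exact le_self_add

theorem exists_coord_eq {v : Λ} {m : V →₀ ℕ} (h : m.support ⊆ (Φ.coord v).support) :
    ∃ u, Φ.coord u = m := ⟨_, Φ.coord_sum v m h⟩

theorem coord_vert {v : Λ} {i : V} (h : Φ.coord v i ≠ 0) :
    Φ.coord (Φ.vert i) = Finsupp.single i 1 := by
  classical
  have := Φ.coord_sum v (Finsupp.single i 1)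
    (Finsupp.support_single_subset.trans (by simpa using h))
  rwa [Finset.sum_eq_single i (by intro j _ hj; simp [hj.symm]) (by simp),
    Finsupp.single_eq_same, one_smul] at this

theorem eq_vert_of_degree_eq_one {u : Λ} (h : Φ.degree u = 1) :
    ∃ i, u = Φ.vert i ∧ Φ.coord u = Finsupp.single i 1 := by
  classical
  obtain ⟨i, hi⟩ : ∃ i, Φ.coord u i ≠ 0 := by
    by_contra hne
    push Not at hne
    have : Φ.coord u = 0 := Finsupp.ext hne
    rw [degree, this] at h
    simp at h
  have hle : Finsupp.single i 1 ≤ Φ.coord u := by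
    rw [Finsupp.single_le_iff]; omega
  have hdeg : (Φ.coord u - Finsupp.single i 1).degree = 0 := by
    have := congrArg Finsupp.degree (add_tsub_cancel_of_le hle)
    rw [map_add, Finsupp.degree_single] at this
    rw [degree] at h
    omega
  rw [Finsupp.degree_eq_zero_iff] at hdeg
  have heq : Φ.coord u = Finsupp.single i 1 := le_antisymm (tsub_eq_zero_iff_le.1 hdeg) hle
  exact ⟨i, Φ.coord_injective (heq.trans (Φ.coord_vert hi).symm), heq⟩

end UnimodularFan

theorem coeff_mul_eq_sum {S Λ : Type*} [CommRing S] [AddCommGroup Λ] (x y : AddMonoidAlgebra S Λ)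
    (w : Λ) : (x * y).coeff w = ∑ a ∈ x.coeff.support, x.coeff a * y.coeff (w - a) := by
  classical
  rw [AddMonoidAlgebra.coeff_mul, Finsupp.sum]
  refine Finset.sum_congr rfl fun a _ => ?_
  rw [Finsupp.sum]
  simp only [← eq_sub_iff_add_eq']
  rw [Finset.sum_ite_eq']
  split_ifs with h
  · rfl
  · rw [Finsupp.notMem_support_iff.1 h, mul_zero]

namespace UnimodularFan

variable {Λ V : Type*} [AddCommGroup Λ] [Fintype V] (Φ : UnimodularFan Λ V)

/-! ### Top coefficients of powers -/

section TopCoefficients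

variable {g : AddMonoidAlgebra ℤ Λ} (hg : ∀ w, g.coeff w ≠ 0 → Φ.degree w ≤ 1)
include hg

theorem degree_le_of_coeff_pow_ne_zero (m : ℕ) {w : Λ} (hw : (g ^ m).coeff w ≠ 0) :
    Φ.degree w ≤ m := by
  classical
  induction m generalizing w with
  | zero =>
    rw [pow_zero, AddMonoidAlgebra.one_def, AddMonoidAlgebra.coeff_single,
      Finsupp.single_apply] at hw
    have : (0 : Λ) = w := by by_contra h; simp [h] at hw
    simp [← this]
  | succ m ih =>
    rw [pow_succ', coeff_mul_eq_sum] at hw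
    obtain ⟨a, _, ha⟩ := Finset.exists_ne_zero_of_sum_ne_zero hw
    have h1 := hg a (left_ne_zero_of_mul ha)
    have h2 := ih (right_ne_zero_of_mul ha)
    have h3 := Φ.degree_le_add_sub a w
    omega

/-- The multinomial formula for the top coefficients of `g ^ m`. -/
theorem coeff_pow_mul_factorial (m : ℕ) {w : Λ} (hw : Φ.degree w = m) :
    (g ^ m).coeff w * ∏ i, ((Φ.coord w i).factorial : ℤ) =
      m.factorial * ∏ i, g.coeff (Φ.vert i) ^ Φ.coord w i := by
  classical
  induction m generalizing w with
  | zero =>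
    rw [Φ.degree_eq_zero] at hw
    subst hw
    simp [AddMonoidAlgebra.one_def]
  | succ m ih =>
    set I := (Φ.coord w).support
    set F : Λ → ℤ := fun a => g.coeff a * (g ^ m).coeff (w - a)
    have hle : ∀ i ∈ I, Φ.coord (Φ.vert i) ≤ Φ.coord w := by
      intro i hi
      have hi := Finsupp.mem_support_iff.1 hi
      rw [Φ.coord_vert hi, Finsupp.single_le_iff]
      omega
    have hinj : Set.InjOn Φ.vert I := by
      intro i hi j hj hij
      have h1 := Φ.coord_vert (Finsupp.mem_support_iff.1 hi)
      rw [hij, Φ.coord_vert (Finsupp.mem_support_iff.1 hj)] at h1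
      exact ((Finsupp.single_left_inj one_ne_zero).1 h1).symm
    have hsum : (g ^ (m + 1)).coeff w = ∑ i ∈ I, F (Φ.vert i) := by
      rw [pow_succ', coeff_mul_eq_sum, ← Finset.sum_image (f := F) hinj]
      have h1 : ∑ a ∈ g.coeff.support, F a = ∑ a ∈ g.coeff.support ∪ I.image Φ.vert, F a := by
        refine Finset.sum_subset Finset.subset_union_left fun a _ ha => ?_
        simp only [F, Finsupp.notMem_support_iff.1 ha, zero_mul]
      have h2 : ∑ a ∈ I.image Φ.vert, F a = ∑ a ∈ g.coeff.support ∪ I.image Φ.vert, F a := by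
        refine Finset.sum_subset Finset.subset_union_right fun a _ ha => ?_
        by_contra hne
        -- The bounds `deg a ≤ 1` and `deg (w - a) ≤ m` must both be equalities, so `a` is a vertex
        -- of the cone containing `w`.
        have d1 := hg a (left_ne_zero_of_mul hne)
        have d2 := Φ.degree_le_of_coeff_pow_ne_zero hg m (right_ne_zero_of_mul hne)
        have d3 := Φ.degree_le_add_sub a w
        have hcoord := Φ.coord_le_iff.2 (show Φ.degree a + Φ.degree (w - a) = Φ.degree w by omega)
        obtain ⟨i, rfl, hi⟩ := Φ.eq_vert_of_degree_eq_one (show Φ.degree a = 1 by omega)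
        refine ha (Finset.mem_image_of_mem _ (Finsupp.mem_support_iff.2 ?_))
        have := hcoord i
        rw [hi, Finsupp.single_eq_same] at this
        omega
      rw [h2, ← h1]
    -- Removing the vertex `i` lowers the `i`-th coordinate by one, which costs the factor `coord w
    -- i`; these factors add up to `m + 1`.
    have hterm : ∀ i ∈ I, F (Φ.vert i) * ∏ j, ((Φ.coord w j).factorial : ℤ) =
        Φ.coord w i * (m.factorial * ∏ j, g.coeff (Φ.vert j) ^ Φ.coord w j) := by
      intro i hi
      have hi0 := Finsupp.mem_support_iff.1 hi
      have hc := Φ.coord_sub (hle i hi)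
      have hd := Φ.degree_add_degree_sub (hle i hi)
      have hv := Φ.coord_vert hi0
      have hd1 : Φ.degree (Φ.vert i) = 1 := by rw [degree, hv, Finsupp.degree_single]
      have h := ih (w := w - Φ.vert i) (by omega)
      rw [hc, hv] at h
      have hci : ∀ j ≠ i, (Φ.coord w - Finsupp.single i 1 : V →₀ ℕ) j = Φ.coord w j := by
        intro j hj
        simp [hj.symm]
      have hcii : (Φ.coord w - Finsupp.single i 1 : V →₀ ℕ) i = Φ.coord w i - 1 := by simp
      have e1 : ∏ j ∈ Finset.univ.erase i,
          (((Φ.coord w - Finsupp.single i 1 : V →₀ ℕ) j).factorial : ℤ) =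
          ∏ j ∈ Finset.univ.erase i, ((Φ.coord w j).factorial : ℤ) :=
        Finset.prod_congr rfl fun j hj => by rw [hci j (Finset.ne_of_mem_erase hj)]
      have e2 : ∏ j ∈ Finset.univ.erase i,
          g.coeff (Φ.vert j) ^ (Φ.coord w - Finsupp.single i 1 : V →₀ ℕ) j =
          ∏ j ∈ Finset.univ.erase i, g.coeff (Φ.vert j) ^ Φ.coord w j :=
        Finset.prod_congr rfl fun j hj => by rw [hci j (Finset.ne_of_mem_erase hj)]
      rw [← Finset.mul_prod_erase _ _ (Finset.mem_univ i),
        ← Finset.mul_prod_erase _ _ (Finset.mem_univ i), hcii, e1, e2] at h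
      rw [← Finset.mul_prod_erase _ _ (Finset.mem_univ i),
        ← Finset.mul_prod_erase _ (fun j => g.coeff (Φ.vert j) ^ Φ.coord w j)
          (Finset.mem_univ i)]
      obtain ⟨c, hc⟩ : ∃ c, Φ.coord w i = c + 1 := ⟨_, (Nat.succ_pred hi0).symm⟩
      rw [hc, Nat.factorial_succ, pow_succ]
      rw [hc, Nat.add_sub_cancel] at h
      push_cast
      simp only [F]
      linear_combination (g.coeff (Φ.vert i) * ((c : ℤ) + 1)) * h
    rw [hsum, Finset.sum_mul, Finset.sum_congr rfl hterm, ← Finset.sum_mul]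
    have hd : ∑ i ∈ I, (Φ.coord w i : ℤ) = m + 1 := by
      have : ∑ i ∈ I, Φ.coord w i = m + 1 := hw
      exact_mod_cast this
    rw [hd, Nat.factorial_succ]
    push_cast
    ring

end TopCoefficients

/-- The coefficient of `t ^ degree w x ^ w` in `(1 - t g) ^ (-k)`. -/
def leadCoeff (g : AddMonoidAlgebra ℤ Λ) (k : ℕ) (w : Λ) : ℤ :=
  ((Φ.degree w + (k - 1)).choose (k - 1) : ℤ) * (g ^ Φ.degree w).coeff w

open Classical in
/-- The coefficient of `t ^ (degree b - degree u) x ^ (b - u)` in `(1 - t g) ^ (-k)`. -/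
def testCoeff (g : AddMonoidAlgebra ℤ Λ) (k : ℕ) (u b : Λ) : ℤ :=
  if Φ.coord u ≤ Φ.coord b then Φ.leadCoeff g k (b - u) else 0

theorem testCoeff_self (g : AddMonoidAlgebra ℤ Λ) (k : ℕ) (u : Λ) : Φ.testCoeff g k u u = 1 := by
  simp [testCoeff, leadCoeff, AddMonoidAlgebra.one_def]

/-- The multinomial formula for `b - u` is combined with the binomial of `(1 - X)^(-k)`. The falling
factorials vanish unless `coord u ≤ coord b`, so the formula is uniform in `u`, as the expansion in
polynomials requires. -/
theorem testCoeff_formula {g : AddMonoidAlgebra ℤ Λ} (hg : ∀ w, g.coeff w ≠ 0 → Φ.degree w ≤ 1)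
    {k : ℕ} (hk : 0 < k) {u b : Λ} (hu : Φ.degree u ≤ k) (hb : b ≠ 0) :
    Φ.testCoeff g k u b * (∏ i, g.coeff (Φ.vert i) ^ Φ.coord u i) *
        (∏ i, ((Φ.coord b i).factorial : ℤ)) * (k - 1).factorial =
      (Φ.degree b - 1).factorial * (∏ i, ((Φ.coord b i).descFactorial (Φ.coord u i) : ℤ)) *
        (Φ.degree b).ascFactorial (k - Φ.degree u) *
        ∏ i, g.coeff (Φ.vert i) ^ Φ.coord b i := by
  classical
  rw [testCoeff]
  split_ifs with hle
  · have hc := Φ.coord_sub hle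
    have hd := Φ.degree_add_degree_sub hle
    have hm := Φ.coeff_pow_mul_factorial hg (Φ.degree (b - u)) rfl
    have hfac : ∀ i, ((Φ.coord b i).factorial : ℤ) =
        (Φ.coord (b - u) i).factorial * (Φ.coord b i).descFactorial (Φ.coord u i) := by
      intro i
      rw [hc, Finsupp.tsub_apply]
      exact_mod_cast (Nat.factorial_mul_descFactorial (hle i)).symm
    have hpow : ∀ i, g.coeff (Φ.vert i) ^ Φ.coord b i =
        g.coeff (Φ.vert i) ^ Φ.coord (b - u) i * g.coeff (Φ.vert i) ^ Φ.coord u i := by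
      intro i
      rw [← pow_add, hc, Finsupp.tsub_apply, Nat.sub_add_cancel (hle i)]
    have hb0 : 0 < Φ.degree b := Nat.pos_of_ne_zero fun h => hb (Φ.degree_eq_zero.1 h)
    have hch : ((Φ.degree (b - u) + (k - 1)).choose (k - 1) : ℤ) * (Φ.degree (b - u)).factorial *
        (k - 1).factorial =
        (Φ.degree b - 1).factorial * (Φ.degree b).ascFactorial (k - Φ.degree u) := by
      have h1 := Nat.add_choose_mul_factorial_mul_factorial (Φ.degree (b - u)) (k - 1)
      have h2 := Nat.factorial_mul_ascFactorial (Φ.degree b - 1) (k - Φ.degree u)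
      rw [Nat.sub_add_cancel hb0, show Φ.degree b - 1 + (k - Φ.degree u) =
        Φ.degree (b - u) + (k - 1) by omega, ← h1] at h2
      exact_mod_cast h2.symm
    simp only [hfac, hpow, Finset.prod_mul_distrib, leadCoeff]
    linear_combination ((Φ.degree (b - u) + (k - 1)).choose (k - 1) : ℤ) *
      (∏ i, g.coeff (Φ.vert i) ^ Φ.coord u i) *
      (∏ i, ((Φ.coord b i).descFactorial (Φ.coord u i) : ℤ)) * (k - 1).factorial * hm +
      (∏ i, g.coeff (Φ.vert i) ^ Φ.coord u i) *
      (∏ i, ((Φ.coord b i).descFactorial (Φ.coord u i) : ℤ)) *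
      (∏ i, g.coeff (Φ.vert i) ^ Φ.coord (b - u) i) * hch
  · obtain ⟨i, hi⟩ : ∃ i, ¬ Φ.coord u i ≤ Φ.coord b i := by
      by_contra h; push Not at h; exact hle h
    have : ∏ i, ((Φ.coord b i).descFactorial (Φ.coord u i) : ℤ) = 0 :=
      Finset.prod_eq_zero (Finset.mem_univ i) (by
        rw [Nat.descFactorial_eq_zero_iff_lt.2 (not_le.1 hi), Nat.cast_zero])
    simp [this]

end UnimodularFan

namespace UnimodularFan

variable {Λ V : Type*} [AddCommGroup Λ] [Fintype V] (Φ : UnimodularFan Λ V)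

/-! ### Polynomial functions on the fan -/

section Polynomials

variable {S : Type*} [CommRing S]

/-- The polynomial `∏ᵢ [xᵢ]_{uᵢ} · ∏_{j < k - deg u} (∑ᵢ xᵢ + j)`, where `[x]_m` is the falling
factorial. -/
def cartierPoly (S : Type*) [CommRing S] (k : ℕ) (u : Λ) : MvPolynomial V S :=
  (∏ i, ∏ j ∈ Finset.range (Φ.coord u i), (MvPolynomial.X i - MvPolynomial.C (j : S))) *
    ∏ j ∈ Finset.range (k - Φ.degree u), (∑ i, MvPolynomial.X i + MvPolynomial.C (j : S))

theorem eval_cartierPoly (k : ℕ) (u : Λ) (B : V →₀ ℕ) :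
    MvPolynomial.eval (fun i => (B i : S)) (Φ.cartierPoly S k u) =
      (∏ i, ((B i).descFactorial (Φ.coord u i) : S)) *
        (B.degree.ascFactorial (k - Φ.degree u) : S) := by
  simp only [cartierPoly, map_mul, map_prod, map_sub, map_add, map_sum, MvPolynomial.eval_X,
    MvPolynomial.eval_C]
  congr 1
  · refine Finset.prod_congr rfl fun i _ => ?_
    rw [← descPochhammer_eval_eq_descFactorial, descPochhammer_eval_eq_prod_range]
  · rw [Nat.ascFactorial_eq_prod_range, ← Nat.cast_sum, ← Finsupp.degree_eq_sum]
    push_cast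
    rfl

/-- The factor with `j = 0` has no constant term; it sits in the second product if `u = 0` and in
the first otherwise. This yields the spare factor `p` at arguments `p b`. -/
theorem constantCoeff_cartierPoly {k : ℕ} (hk : 0 < k) (u : Λ) :
    MvPolynomial.constantCoeff (Φ.cartierPoly S k u) = 0 := by
  rw [cartierPoly, map_mul]
  by_cases hu : u = 0
  · subst hu
    rw [map_prod (g := MvPolynomial.constantCoeff) (s := Finset.range _)]
    rw [Finset.prod_eq_zero (i := 0) (s := Finset.range _)
      (Finset.mem_range.2 (by simpa using hk)) (by simp), mul_zero]
  · obtain ⟨i, hi⟩ : ∃ i, Φ.coord u i ≠ 0 := by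
      by_contra hne
      push Not at hne
      exact hu (Φ.coord_injective ((Finsupp.ext hne).trans Φ.coord_zero.symm))
    rw [map_prod, Finset.prod_eq_zero (Finset.mem_univ i), zero_mul]
    rw [map_prod, Finset.prod_eq_zero (i := 0)
      (Finset.mem_range.2 (Nat.pos_of_ne_zero hi)) (by simp)]

theorem totalDegree_cartierPoly_le {k : ℕ} {u : Λ} (hu : Φ.degree u ≤ k) :
    (Φ.cartierPoly S k u).totalDegree ≤ k := by
  have h1 : ∀ i (j : ℕ),
      (MvPolynomial.X i - MvPolynomial.C (j : S) : MvPolynomial V S).totalDegree ≤ 1 := by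
    intro i j
    rw [sub_eq_add_neg, ← map_neg]
    refine (MvPolynomial.totalDegree_add _ _).trans
      (max_le ?_ ((MvPolynomial.totalDegree_C _).trans_le zero_le_one))
    exact (MvPolynomial.totalDegree_monomial_le _ _).trans (by simp)
  have h2 : ∀ j : ℕ,
      (∑ i, MvPolynomial.X i + MvPolynomial.C (j : S) : MvPolynomial V S).totalDegree ≤ 1 := by
    intro j
    refine (MvPolynomial.totalDegree_add _ _).trans
      (max_le ?_ ((MvPolynomial.totalDegree_C _).trans_le zero_le_one))
    refine MvPolynomial.totalDegree_finsetSum_le fun i _ => ?_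
    exact (MvPolynomial.totalDegree_monomial_le _ _).trans (by simp)
  rw [cartierPoly]
  refine (MvPolynomial.totalDegree_mul _ _).trans ?_
  have h3 : (∏ i, ∏ j ∈ Finset.range (Φ.coord u i),
      (MvPolynomial.X i - MvPolynomial.C (j : S)) : MvPolynomial V S).totalDegree ≤
      Φ.degree u := by
    refine (MvPolynomial.totalDegree_finsetProd _ _).trans ?_
    rw [degree, Finsupp.degree_eq_sum]
    refine Finset.sum_le_sum fun i _ => (MvPolynomial.totalDegree_finsetProd _ _).trans ?_
    exact (Finset.sum_le_sum fun j _ => h1 i j).trans (by simp)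
  have h4 : (∏ j ∈ Finset.range (k - Φ.degree u),
      (∑ i, MvPolynomial.X i + MvPolynomial.C (j : S)) : MvPolynomial V S).totalDegree ≤
      k - Φ.degree u :=
    (MvPolynomial.totalDegree_finsetProd _ _).trans
      ((Finset.sum_le_sum fun j _ => h2 j).trans (by simp))
  omega

variable {k : ℕ} {s : Finset Λ} (hs : ∀ u, u ∈ s ↔ Φ.degree u ≤ k)
include hs

/-- On points whose coordinates are supported in a cone of the fan, only the monomials supported
in cones contribute to the value of a polynomial. -/
theorem eval_sub_sum_mem (I : Ideal S) (P : MvPolynomial V S) (b : Λ) (x : V → S)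
    (hx : ∀ i, Φ.coord b i = 0 → x i = 0)
    (hP : ∀ m : V →₀ ℕ, k < m.degree → P.coeff m * ∏ i, x i ^ m i ∈ I) :
    MvPolynomial.eval x P - ∑ j ∈ s, P.coeff (Φ.coord j) * ∏ i, x i ^ Φ.coord j i ∈ I := by
  classical
  rw [MvPolynomial.eval_eq', ← Finset.sum_image (s := s) (g := Φ.coord)
    (f := fun m => P.coeff m * ∏ i, x i ^ m i) Φ.coord_injective.injOn]
  have h1 : ∑ m ∈ s.image Φ.coord, P.coeff m * ∏ i, x i ^ m i =
      ∑ m ∈ P.support ∩ s.image Φ.coord, P.coeff m * ∏ i, x i ^ m i := by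
    refine (Finset.sum_subset Finset.inter_subset_right fun m hm hm' => ?_).symm
    have : m ∉ P.support := fun h => hm' (Finset.mem_inter.2 ⟨h, hm⟩)
    rw [MvPolynomial.notMem_support_iff.1 this, zero_mul]
  rw [h1, ← Finset.sum_sdiff (s₁ := P.support ∩ s.image Φ.coord) Finset.inter_subset_left,
    add_sub_cancel_right]
  refine I.sum_mem fun m hm => ?_
  by_cases hsupp : m.support ⊆ (Φ.coord b).support
  · refine hP m (not_le.1 fun hle => ?_)
    obtain ⟨j, hj⟩ := Φ.exists_coord_eq hsupp
    have hjs : j ∈ s := (hs j).2 (by rw [degree, hj]; exact hle)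
    simp only [Finset.mem_sdiff, Finset.mem_inter, not_and] at hm
    exact hm.2 hm.1 (Finset.mem_image.2 ⟨j, hjs, hj⟩)
  · obtain ⟨i, hi, hi'⟩ := Finset.not_subset.1 hsupp
    rw [Finset.prod_eq_zero (Finset.mem_univ i), mul_zero]
    · exact I.zero_mem
    · rw [hx i (Finsupp.notMem_support_iff.1 hi'), zero_pow (Finsupp.mem_support_iff.1 hi)]

/-- Divisors of a monomial supported in a cone are supported in that cone, so multiplication by `R`
acts on the coefficients indexed by `s` alone. -/
theorem coeff_mul_eq_sum_coord (P R : MvPolynomial V S) {j : Λ} (hj : j ∈ s) :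
    open Classical in
    (P * R).coeff (Φ.coord j) = ∑ j' ∈ s, P.coeff (Φ.coord j') *
      if Φ.coord j' ≤ Φ.coord j then R.coeff (Φ.coord j - Φ.coord j') else 0 := by
  classical
  rw [MvPolynomial.coeff_mul]
  simp only [mul_ite, mul_zero]
  rw [← Finset.sum_filter]
  refine (Finset.sum_bij (fun j' _ => (Φ.coord j', Φ.coord j - Φ.coord j')) ?_ ?_ ?_ ?_).symm
  · intro j' hj'
    rw [Finset.HasAntidiagonal.mem_antidiagonal]
    exact add_tsub_cancel_of_le (Finset.mem_filter.1 hj').2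
  · intro a _ b _ hab
    exact Φ.coord_injective (Prod.ext_iff.1 hab).1
  · rintro ⟨m, m'⟩ hm
    rw [Finset.HasAntidiagonal.mem_antidiagonal] at hm
    dsimp only at hm
    have hle : m ≤ Φ.coord j := hm ▸ le_self_add
    obtain ⟨a, ha⟩ := Φ.exists_coord_eq (Finsupp.support_mono hle)
    refine ⟨a, Finset.mem_filter.2 ⟨(hs a).2 ?_, ha ▸ hle⟩, ?_⟩
    · rw [degree, ha]
      exact (Finsupp.degree_mono hle).trans ((hs j).1 hj)
    · rw [ha, ← hm, add_tsub_cancel_left]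
  · intro j' _
    rfl

end Polynomials

/-! ### The determinant of a matrix satisfying the Cartier congruences -/

section CartierCongruence

variable {p : ℕ} [hp : Fact p.Prime] {g : AddMonoidAlgebra ℤ Λ}

/-- The normalization factor `γ ^ u (k - 1)!` of the row `u`, where `γ` is the vector of the
coefficients of `g` at the vertices. -/
def rowFactor (p : ℕ) [Fact p.Prime] (g : AddMonoidAlgebra ℤ Λ) (k : ℕ) (u : Λ) : ℤ_[p] :=
  (∏ i, (g.coeff (Φ.vert i) : ℤ_[p]) ^ Φ.coord u i) * ((k - 1).factorial : ℕ)

theorem testCoeff_mul_rowFactor (hg : ∀ w, g.coeff w ≠ 0 → Φ.degree w ≤ 1)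
    {k : ℕ} (hk : 0 < k) {u b : Λ} (hu : Φ.degree u ≤ k) (hb : b ≠ 0) :
    Φ.rowFactor p g k u * (Φ.testCoeff g k u b : ℤ_[p]) *
        ∏ i, ((Φ.coord b i).factorial : ℤ_[p]) =
      (Φ.degree b - 1).factorial *
        MvPolynomial.eval (fun i => (Φ.coord b i : ℤ_[p])) (Φ.cartierPoly ℤ_[p] k u) *
        ∏ i, (g.coeff (Φ.vert i) : ℤ_[p]) ^ Φ.coord b i := by
  have h := congrArg (Int.cast : ℤ → ℤ_[p]) (Φ.testCoeff_formula hg hk hu hb)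
  push_cast at h
  rw [eval_cartierPoly, rowFactor, ← degree]
  linear_combination h

/-- The factorials of multiples of `p` are split by `factorial_mul_eq`. With `d = deg b`, the factor
`p` on the left compensates for `(p d - 1)!` having one factor `p` fewer than the denominator `p^d`.
-/
theorem testCoeff_nsmul_mul_rowFactor (hg : ∀ w, g.coeff w ≠ 0 → Φ.degree w ≤ 1)
    {k : ℕ} (hk : 0 < k) {u b : Λ} (hu : Φ.degree u ≤ k) (hb : b ≠ 0) :
    (p : ℤ_[p]) * (Φ.rowFactor p g k u * (Φ.testCoeff g k u (p • b) : ℤ_[p])) *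
        (∏ i, ((Φ.coord b i).factorial : ℤ_[p])) *
        ∏ i, (primeToFactorial p (Φ.coord b i) : ℤ_[p]) =
      (Φ.degree b - 1).factorial * primeToFactorial p (Φ.degree b) *
        MvPolynomial.eval (fun i => (p : ℤ_[p]) * (Φ.coord b i : ℤ_[p]))
          (Φ.cartierPoly ℤ_[p] k u) *
        ((∏ i, (g.coeff (Φ.vert i) : ℤ_[p]) ^ ((p - 1) * Φ.coord b i)) *
          ∏ i, (g.coeff (Φ.vert i) : ℤ_[p]) ^ Φ.coord b i) := by
  have hp0 := hp.out.pos
  have hd : 0 < Φ.degree b := Nat.pos_of_ne_zero fun h => hb (Φ.degree_eq_zero.1 h)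
  have hpb : p • b ≠ 0 := by
    rw [Ne, ← Φ.degree_eq_zero, Φ.degree_nsmul]
    exact (Nat.mul_pos hp0 hd).ne'
  have h := Φ.testCoeff_mul_rowFactor (p := p) hg hk hu hpb
  rw [Φ.degree_nsmul, Φ.coord_nsmul] at h
  simp only [Finsupp.smul_apply, smul_eq_mul, factorial_mul_eq hp0] at h
  push_cast at h
  rw [Finset.prod_mul_distrib, Finset.prod_mul_distrib, Finset.prod_pow_eq_pow_sum,
    ← Finsupp.degree_eq_sum, ← degree] at h
  have hfac : p * (p * Φ.degree b - 1).factorial =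
      p ^ Φ.degree b * ((Φ.degree b - 1).factorial * primeToFactorial p (Φ.degree b)) := by
    refine Nat.eq_of_mul_eq_mul_left hd ?_
    have h1 := factorial_mul_eq hp0 (Φ.degree b)
    rw [← Nat.mul_factorial_pred (Nat.mul_pos hp0 hd).ne', ← Nat.mul_factorial_pred hd.ne'] at h1
    linarith
  have hfac' := congrArg (Nat.cast : ℕ → ℤ_[p]) hfac
  push_cast at hfac'
  have hpow : ∀ i, (g.coeff (Φ.vert i) : ℤ_[p]) ^ (p * Φ.coord b i) =
      (g.coeff (Φ.vert i) : ℤ_[p]) ^ ((p - 1) * Φ.coord b i) *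
        (g.coeff (Φ.vert i) : ℤ_[p]) ^ Φ.coord b i := by
    intro i
    rw [← pow_add, ← Nat.succ_mul, Nat.succ_eq_add_one, Nat.sub_add_cancel hp0]
  simp only [hpow, Finset.prod_mul_distrib] at h
  have hpd : (p : ℤ_[p]) ^ Φ.degree b ≠ 0 :=
    pow_ne_zero _ (by exact_mod_cast hp.out.ne_zero)
  refine mul_left_cancel₀ hpd ?_
  linear_combination (p : ℤ_[p]) * h +
    (MvPolynomial.eval (fun i => (p : ℤ_[p]) * (Φ.coord b i : ℤ_[p]))
      (Φ.cartierPoly ℤ_[p] k u) *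
      ((∏ i, (g.coeff (Φ.vert i) : ℤ_[p]) ^ ((p - 1) * Φ.coord b i)) *
          ∏ i, (g.coeff (Φ.vert i) : ℤ_[p]) ^ Φ.coord b i)) * hfac'

/-- A square matrix over `ℤ_p` that maps the test vectors `testCoeff · b` to the test vectors
`testCoeff · (p b)` modulo `p ^ k` has determinant `p ^ ∑ (deg u - 1)` up to a unit. -/
theorem det_eq_of_cartier_congruence (hg : ∀ w, g.coeff w ≠ 0 → Φ.degree w ≤ 1)
    (hunit : ∀ i, IsUnit (g.coeff (Φ.vert i) : ℤ_[p])) {k : ℕ} (hk0 : 0 < k) (hk : k < p)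
    {s : Finset Λ} (hs : ∀ u, u ∈ s ↔ Φ.degree u ≤ k) [DecidableEq s] (H : Matrix s s ℤ_[p])
    (hH : ∀ u b : s, (p : ℤ_[p]) ^ k ∣
      ∑ v : s, H u v * (Φ.testCoeff g k v b : ℤ_[p]) - (Φ.testCoeff g k u (p • (b : Λ)) : ℤ_[p])) :
    ∃ c : ℤ_[p], IsUnit c ∧ H.det = (p : ℤ_[p]) ^ (∑ u : s, (Φ.degree u - 1)) * c := by
  classical
  have hfacU : ∀ j : ℕ, j < p → IsUnit ((j.factorial : ℕ) : ℤ_[p]) :=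
    fun j => isUnit_factorial_padic p
  obtain ⟨R, hR0, hR⟩ := exists_mvPolynomial_gammaQuotient p hk0 hk
    (fun i => (g.coeff (Φ.vert i) : ℤ_[p])) hunit
  -- the ingredients of the factorization
  let a : s → ℤ_[p] := fun u => Φ.rowFactor p g k u
  have ha : ∀ u, IsUnit (a u) := fun u =>
    (IsUnit.prod_univ_iff.2 fun i => (hunit i).pow _).mul (hfacU _ (by omega))
  let N : Λ → ℤ_[p] := fun b => ∏ i, ((Φ.coord b i).factorial : ℤ_[p])
  have hN : ∀ b ∈ s, IsUnit (N b) := fun b hb => IsUnit.prod_univ_iff.2 fun i =>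
    hfacU _ (((Finsupp.le_degree i _).trans ((hs b).1 hb)).trans_lt hk)
  let γ : Λ → ℤ_[p] := fun b => ∏ i, (g.coeff (Φ.vert i) : ℤ_[p]) ^ Φ.coord b i
  -- The part of the coefficient at `b` that does not depend on the row. For `b ∈ s` all coordinates
  -- are below `p`, so `N b` is truly inverted.
  let M : Λ → ℤ_[p] := fun b => (Φ.degree b - 1).factorial * Ring.inverse (N b) * γ b
  have hM : ∀ b ∈ s, M b * N b = (Φ.degree b - 1).factorial * γ b := by
    intro b hb
    have := Ring.inverse_mul_cancel _ (hN b hb)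
    simp only [M]
    linear_combination ((Φ.degree b - 1).factorial * γ b) * this
  let Q : Λ → MvPolynomial V ℤ_[p] := fun u => Φ.cartierPoly ℤ_[p] k u
  have hQ0 : ∀ u, (Q u).coeff 0 = 0 := fun u => Φ.constantCoeff_cartierPoly hk0 u
  let f0 : ℤ_[p] := ((k - 1).factorial : ℕ)
  let A : Matrix s s ℤ_[p] := Matrix.diagonal a
  let X : Matrix s s ℤ_[p] := Matrix.of fun v b => (Φ.testCoeff g k v b : ℤ_[p])
  -- No `Q u` has a constant term, so the column of the origin would vanish; it is filled by `f0`,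
  -- the row factor of `u = 0`, to account for the test point `b = 0`.
  let U : Matrix s s ℤ_[p] := Matrix.of fun u j =>
    (Q u).coeff (Φ.coord j) + if (u : Λ) = 0 ∧ (j : Λ) = 0 then f0 else 0
  let U' : Matrix s s ℤ_[p] := Matrix.of fun u j =>
    (Q u * R).coeff (Φ.coord j) + if (u : Λ) = 0 ∧ (j : Λ) = 0 then f0 else 0
  -- Multiplication by `R` on coefficient vectors, with the row of the origin replaced by a unit
  -- vector.
  let T : Matrix s s ℤ_[p] := Matrix.of fun j' j =>
    if (j' : Λ) = 0 then (if (j : Λ) = 0 then 1 else 0) else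
      if Φ.coord j' ≤ Φ.coord j then R.coeff (Φ.coord j - Φ.coord j') else 0
  let W : Matrix s s ℤ_[p] := Matrix.of fun j b =>
    if (j : Λ) = 0 then (if (b : Λ) = 0 then 1 else 0) else
      M b * ∏ i, (Φ.coord b i : ℤ_[p]) ^ Φ.coord j i
  have h0s : (0 : Λ) ∈ s := (hs 0).2 (by simp)
  have htest0 : ∀ u : Λ, Φ.testCoeff g k u 0 = if u = 0 then 1 else 0 := by
    intro u
    split_ifs with hu
    · rw [hu, testCoeff_self]
    · rw [testCoeff, if_neg]
      intro h
      refine hu (Φ.coord_injective ?_)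
      rw [Φ.coord_zero] at h ⊢
      exact le_antisymm h (zero_le)
  have hW0 : ∀ j b : s, (b : Λ) = 0 → W j b = if (j : Λ) = 0 then 1 else 0 := by
    intro j b hb
    simp only [W, Matrix.of_apply, hb, if_true]
    split_ifs with hj
    · rfl
    · obtain ⟨i, hi⟩ : ∃ i, Φ.coord j i ≠ 0 := by
        by_contra hne
        push Not at hne
        exact hj (Φ.coord_injective ((Finsupp.ext hne).trans Φ.coord_zero.symm))
      rw [Finset.prod_eq_zero (Finset.mem_univ i) (by simp [hi]), mul_zero]
  have hWne : ∀ j b : s, (b : Λ) ≠ 0 → (j : Λ) ≠ 0 →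
      W j b = M b * ∏ i, (Φ.coord b i : ℤ_[p]) ^ Φ.coord j i := by
    intro j b hb hj
    simp only [W, Matrix.of_apply, hj, if_false]
  have hWz : ∀ j b : s, (b : Λ) ≠ 0 → (j : Λ) = 0 → W j b = 0 := by
    intro j b hb hj
    simp only [W, Matrix.of_apply, hj, hb, if_false, if_true]
  have htri : ∀ {u v : s}, Φ.coord u ≤ Φ.coord v → u = v ∨ Φ.degree u < Φ.degree v := by
    intro u v h
    have hd := Φ.degree_add_degree_sub h
    by_cases h0 : Φ.degree ((v : Λ) - u) = 0
    · exact Or.inl (Subtype.ext (sub_eq_zero.1 (Φ.degree_eq_zero.1 h0)).symm)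
    · exact Or.inr (by omega)
  have hXdet : X.det = 1 := by
    rw [det_of_graded_triangular X (fun u => Φ.degree u)]
    · exact Finset.prod_eq_one fun u _ => by simp [X, testCoeff_self]
    · intro u v huv
      by_cases hle : Φ.coord u ≤ Φ.coord v
      · exact htri hle
      · simp [X, testCoeff, hle] at huv
  have hTdet : T.det = 1 := by
    rw [det_of_graded_triangular T (fun u => Φ.degree u)]
    · refine Finset.prod_eq_one fun u _ => ?_
      simp only [T, Matrix.of_apply, le_refl, if_true, tsub_self]
      rw [← MvPolynomial.constantCoeff_eq, hR0]
      simp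
    · intro u v huv
      by_cases hu : (u : Λ) = 0
      · by_cases hv : (v : Λ) = 0
        · exact Or.inl (Subtype.ext (hu.trans hv.symm))
        · simp [T, hu, hv] at huv
      · by_cases hle : Φ.coord u ≤ Φ.coord v
        · exact htri hle
        · simp [T, hu, hle] at huv
  have hAdet : IsUnit A.det := by
    rw [Matrix.det_diagonal]
    exact IsUnit.prod_univ_iff.2 ha
  have hUT : U * T = U' := by
    ext u j
    simp only [U', Matrix.of_apply]
    rw [Φ.coeff_mul_eq_sum_coord hs (Q u) R j.2, Matrix.mul_apply,
      ← Finset.sum_coe_sort s (fun j' => (Q u).coeff (Φ.coord j') *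
        if Φ.coord j' ≤ Φ.coord j then R.coeff (Φ.coord j - Φ.coord j') else 0),
      ← Finset.add_sum_erase _ _ (Finset.mem_univ (⟨0, h0s⟩ : s)),
      ← Finset.add_sum_erase _ (fun j' : s => (Q u).coeff (Φ.coord j') *
        if Φ.coord j' ≤ Φ.coord j then R.coeff (Φ.coord j - Φ.coord j') else 0)
        (Finset.mem_univ (⟨0, h0s⟩ : s))]
    have hrest : ∀ j' ∈ Finset.univ.erase (⟨0, h0s⟩ : s), U u j' * T j' j =
        (Q u).coeff (Φ.coord j') *
          if Φ.coord j' ≤ Φ.coord j then R.coeff (Φ.coord j - Φ.coord j') else 0 := by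
      intro j' hj'
      have hne : (j' : Λ) ≠ 0 := fun h => Finset.ne_of_mem_erase hj' (Subtype.ext h)
      simp [U, T, hne]
    rw [Finset.sum_congr rfl hrest]
    simp only [U, T, Matrix.of_apply, Φ.coord_zero, hQ0, zero_mul, zero_add, if_true, and_true]
    by_cases hu : (u : Λ) = 0 <;> by_cases hj : (j : Λ) = 0 <;> simp [hu, hj, add_comm]
  -- `A X = U W`
  have hAX : A * X = U * W := by
    ext u b
    rw [Matrix.diagonal_mul, Matrix.mul_apply]
    simp only [X, Matrix.of_apply]
    by_cases hb : (b : Λ) = 0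
    · simp only [hW0 _ b hb, hb, htest0]
      rw [Finset.sum_eq_single (⟨0, h0s⟩ : s)]
      · simp only [U, Matrix.of_apply, Φ.coord_zero, hQ0]
        by_cases hu : (u : Λ) = 0
        · simp [hu, a, rowFactor, f0]
        · simp [hu]
      · intro j _ hj
        rw [if_neg fun h => hj (Subtype.ext h), mul_zero]
      · simp
    · have hf := Φ.testCoeff_mul_rowFactor (p := p) hg hk0 ((hs u).1 u.2) hb
      -- `Q u` has total degree at most `k`, so its expansion over `s` is exact.
      have hev := Φ.eval_sub_sum_mem hs (⊥ : Ideal ℤ_[p]) (Q u) b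
        (fun i => (Φ.coord b i : ℤ_[p])) (fun i hi => by simp [hi]) (fun m hm => by
          rw [MvPolynomial.coeff_eq_zero_of_totalDegree_lt, zero_mul]
          · exact Submodule.zero_mem _
          · exact (Φ.totalDegree_cartierPoly_le ((hs u).1 u.2)).trans_lt hm)
      rw [Ideal.mem_bot, sub_eq_zero, ← Finset.sum_coe_sort s] at hev
      have hsum : ∑ j, U u j * W j b = M b * MvPolynomial.eval
          (fun i => (Φ.coord b i : ℤ_[p])) (Q u) := by
        rw [hev, Finset.mul_sum]
        refine Finset.sum_congr rfl fun j _ => ?_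
        by_cases hj : (j : Λ) = 0
        · rw [hWz j b hb hj, hj, Φ.coord_zero, hQ0]
          ring
        · rw [hWne j b hb hj]
          simp only [U, Matrix.of_apply, hj, and_false, if_false]
          ring
      rw [hsum]
      refine (hN b b.2).mul_right_cancel ?_
      have := hM b b.2
      simp only [a, N, γ, Q] at hf this ⊢
      linear_combination hf - MvPolynomial.eval (fun i => (Φ.coord b i : ℤ_[p]))
        (Φ.cartierPoly ℤ_[p] k u) * this
  -- `A Xₚ ≡ U' D W`
  have hAXp : ∀ u b : s, (p : ℤ_[p]) ^ k ∣ a u * (Φ.testCoeff g k u (p • (b : Λ)) : ℤ_[p]) -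
      ∑ j, U' u j * (p : ℤ_[p]) ^ (Φ.degree j - 1) * W j b := by
    intro u b
    have hQR0 : (Q u * R).coeff 0 = 0 := by
      rw [← MvPolynomial.constantCoeff_eq, map_mul, MvPolynomial.constantCoeff_eq, hQ0, zero_mul]
    by_cases hb : (b : Λ) = 0
    · simp only [hW0 _ b hb, hb, smul_zero, htest0]
      rw [Finset.sum_eq_single (⟨0, h0s⟩ : s)]
      · simp only [U', Matrix.of_apply, Φ.coord_zero, hQR0]
        by_cases hu : (u : Λ) = 0
        · simp [hu, a, rowFactor, f0]
        · simp [hu]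
      · intro j _ hj
        rw [if_neg fun h => hj (Subtype.ext h), mul_zero]
      · simp
    · have hp0 : (p : ℤ_[p]) ≠ 0 := by exact_mod_cast hp.out.ne_zero
      have hf := Φ.testCoeff_nsmul_mul_rowFactor (p := p) hg hk0 ((hs u).1 u.2) hb
      set x : V → ℤ_[p] := fun i => (p : ℤ_[p]) * (Φ.coord b i : ℤ_[p]) with hx
      have hxpow : ∀ m : V →₀ ℕ, ∏ i, x i ^ m i =
          (p : ℤ_[p]) ^ m.degree * ∏ i, (Φ.coord b i : ℤ_[p]) ^ m i := by
        intro m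
        simp only [hx, mul_pow, Finset.prod_mul_distrib, Finset.prod_pow_eq_pow_sum,
          ← Finsupp.degree_eq_sum]
      -- `Q u * R` may have monomials of degree above `k`, but at `p b` these are divisible by
      -- `p^(k+1)`. The extra power is spent on a later division by `p`.
      have hev := Φ.eval_sub_sum_mem hs (Ideal.span {(p : ℤ_[p]) ^ (k + 1)}) (Q u * R) b x
        (fun i hi => by simp [hx, hi]) (fun m hm => by
          rw [hxpow, Ideal.mem_span_singleton, mul_left_comm]
          exact (pow_dvd_pow _ hm).mul_right _)
      rw [Ideal.mem_span_singleton, ← Finset.sum_coe_sort s] at hev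
      have hsum : (p : ℤ_[p]) * ∑ j, U' u j * (p : ℤ_[p]) ^ (Φ.degree j - 1) * W j b =
          M b * ∑ j : s, (Q u * R).coeff (Φ.coord j) * ∏ i, x i ^ Φ.coord j i := by
        rw [Finset.mul_sum, Finset.mul_sum]
        refine Finset.sum_congr rfl fun j _ => ?_
        by_cases hj : (j : Λ) = 0
        · rw [hWz j b hb hj, hj, Φ.coord_zero, hQR0]
          ring
        · rw [hWne j b hb hj, hxpow]
          simp only [U', Matrix.of_apply, hj, and_false, if_false]
          have hd : (p : ℤ_[p]) ^ (Φ.coord j).degree = p * p ^ (Φ.degree j - 1) := by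
            rw [← pow_succ', Nat.sub_add_cancel, degree]
            exact Nat.pos_of_ne_zero fun h => hj (Φ.degree_eq_zero.1 h)
          rw [hd]
          ring
      set E : ℤ_[p] := ∏ i, (primeToFactorial p (Φ.coord b i) : ℤ_[p])
      have hE : IsUnit E := IsUnit.prod_univ_iff.2 fun i => isUnit_primeToFactorial p _
      -- This lifts the congruence for the gamma quotient from `p^k` to `p^(k+1)`.
      have hQp : (p : ℤ_[p]) ∣ MvPolynomial.eval x (Q u) := by
        rw [MvPolynomial.eval_eq']
        refine Finset.dvd_sum fun m hm => ?_
        rw [hxpow]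
        have hm0 : m.degree ≠ 0 := by
          rw [Ne, Finsupp.degree_eq_zero_iff]
          rintro rfl
          exact MvPolynomial.mem_support_iff.1 hm (hQ0 u)
        exact ((dvd_pow_self _ hm0).mul_right _).mul_left _
      obtain ⟨q, hq⟩ := hQp
      obtain ⟨r, hr⟩ := hR (Φ.coord b)
      obtain ⟨r', hr'⟩ := hev
      have hgoal : (p : ℤ_[p]) ^ (k + 1) ∣ (N b * E) * (p * (a u *
          (Φ.testCoeff g k u (p • (b : Λ)) : ℤ_[p]) -
          ∑ j, U' u j * (p : ℤ_[p]) ^ (Φ.degree j - 1) * W j b)) := by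
        refine ⟨(Φ.degree b - 1).factorial * γ b * (q * r) + N b * E * M b * r', ?_⟩
        have hMb := hM b b.2
        rw [map_mul] at hr'
        simp only [Q] at hq hr' hsum
        simp only [a, N, γ, degree] at hf hMb hsum ⊢
        rw [mul_sub (p : ℤ_[p]), hsum]
        rw [hq] at hf hr'
        linear_combination hf + ((((Φ.coord b).degree - 1).factorial : ℕ) : ℤ_[p]) * p * q *
          (∏ i, (g.coeff (Φ.vert i) : ℤ_[p]) ^ Φ.coord b i) * hr +
          (∏ i, ((Φ.coord b i).factorial : ℤ_[p])) * E * M b * hr' - 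
          E * p * q * (MvPolynomial.eval x R) * hMb
      rw [((hN b b.2).mul hE).dvd_mul_left, pow_succ'] at hgoal
      exact (mul_dvd_mul_iff_left hp0).1 hgoal
  -- conclusion
  choose Y₁ hY₁ using hH
  choose Y₂ hY₂ using hAXp
  -- Conjugation by the unit row factors turns the hypothesis on `X` into one on `A X = U W`.
  have hconj : (A * H * A⁻¹).det = H.det := by
    rw [Matrix.det_mul, Matrix.det_mul, mul_right_comm, ← Matrix.det_mul,
      Matrix.mul_nonsing_inv _ hAdet, Matrix.det_one, one_mul]
  rw [← hconj]
  refine det_eq_of_congruence (X := A * X) (U := U) (T := T) (V := W)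
    (Y := A * Matrix.of Y₁ + Matrix.of Y₂) (k := k) (fun u => ?_) ?_ hAX (by rw [hTdet]; simp) ?_
  · have := (hs u).1 u.2
    omega
  · rw [Matrix.det_mul, hXdet, mul_one]
    exact hAdet
  · rw [← Matrix.mul_assoc, Matrix.mul_assoc (A * H), Matrix.nonsing_inv_mul _ hAdet,
      Matrix.mul_one, Matrix.mul_assoc A H X, hUT]
    ext u b
    rw [Matrix.diagonal_mul, Matrix.mul_apply, Matrix.add_apply, Matrix.mul_apply,
      Matrix.smul_apply, Matrix.add_apply, Matrix.diagonal_mul]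
    simp only [Matrix.mul_diagonal, X, Matrix.of_apply, smul_eq_mul]
    linear_combination a u * hY₁ u b + hY₂ u b

end CartierCongruence

end UnimodularFan

/-! ### The Cartier operator on Laurent polynomials -/

section Cartier

variable {S : Type*} [CommRing S] {n : ℕ}

theorem nsmul_lattice_injective {p : ℕ} (hp : p ≠ 0) :
    Function.Injective (fun v : Fin n → ℤ => p • v) := fun u v h => by
  funext i
  have := congrFun h i
  simpa [hp] using this

/-- The Cartier operator: it picks the monomials whose exponents are divisible by `p`. -/
def cartier {p : ℕ} (hp : p ≠ 0) : Laurent S n →ₗ[S] Laurent S n where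
  toFun P := .ofCoeff (P.coeff.comapDomain (fun v => p • v) (nsmul_lattice_injective hp).injOn)
  map_add' P Q := by ext; simp
  map_smul' a P := by ext; simp

theorem coeff_cartier {p : ℕ} (hp : p ≠ 0) (P : Laurent S n) (v : Fin n → ℤ) :
    (cartier hp P).coeff v = P.coeff (p • v) := rfl

theorem substPow_single (p : ℕ) (v : Fin n → ℤ) (a : S) :
    substPow p (AddMonoidAlgebra.single v a : Laurent S n) =
      AddMonoidAlgebra.single (p • v) a := by
  simp [substPow]

theorem substPow_smul (p : ℕ) (a : S) (P : Laurent S n) :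
    substPow p (a • P) = a • substPow p P := by
  induction P using AddMonoidAlgebra.induction_linear with
  | zero => simp
  | add P Q hP hQ => rw [smul_add, map_add, hP, hQ, map_add, smul_add]
  | single v b => simp [substPow_single]

theorem coeff_substPow_nsmul {p : ℕ} (hp : p ≠ 0) (P : Laurent S n) (v : Fin n → ℤ) :
    (substPow p P).coeff (p • v) = P.coeff v := by
  classical
  induction P using AddMonoidAlgebra.induction_linear with
  | zero => simp
  | add P Q hP hQ => rw [map_add, AddMonoidAlgebra.coeff_add, Finsupp.add_apply, hP, hQ]; rfl
  | single u b =>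
    simp only [substPow_single, AddMonoidAlgebra.coeff_single, Finsupp.single_apply,
      (nsmul_lattice_injective hp).eq_iff]

theorem coeff_substPow_of_ne {p : ℕ} (P : Laurent S n) {w : Fin n → ℤ} (hw : ∀ v, p • v ≠ w) :
    (substPow p P).coeff w = 0 := by
  classical
  induction P using AddMonoidAlgebra.induction_linear with
  | zero => simp
  | add P Q hP hQ => simp [hP, hQ]
  | single u b =>
    simp only [substPow_single, AddMonoidAlgebra.coeff_single, Finsupp.single_apply, hw u, if_false]

/-- The projection formula: functions of `x^p` pass through the Cartier operator. -/
theorem cartier_substPow_mul {p : ℕ} (hp : p ≠ 0) (P Q : Laurent S n) :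
    cartier hp (substPow p P * Q) = P * cartier hp Q := by
  induction P using AddMonoidAlgebra.induction_linear with
  | zero => simp
  | add P P' hP hP' => rw [map_add, add_mul, map_add, hP, hP', add_mul]
  | single u b =>
    ext v
    rw [substPow_single, coeff_cartier, AddMonoidAlgebra.coeff_single_mul_apply,
      AddMonoidAlgebra.coeff_single_mul_apply, coeff_cartier, nsmul_add, smul_neg]

/-- Modulo `p`, the `p`-th power of a Laurent polynomial with integral coefficients is obtained by
the substitution `x ↦ x ^ p`. -/
theorem dvd_pow_sub_substPow (p : ℕ) [hp : Fact p.Prime] (P : Laurent ℤ n) :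
    (p : Laurent ℤ n) ∣ P ^ p - substPow p P := by
  induction P using AddMonoidAlgebra.induction_linear with
  | zero => simp [hp.out.ne_zero]
  | add P Q hP hQ =>
    obtain ⟨r, hr⟩ := exists_add_pow_prime_eq hp.out P Q
    rw [hr, map_add]
    have : P ^ p + Q ^ p + p * P * Q * r - (substPow p P + substPow p Q) =
        (P ^ p - substPow p P) + (Q ^ p - substPow p Q) + p * (P * Q * r) := by ring
    rw [this]
    exact dvd_add (dvd_add hP hQ) (dvd_mul_right _ _)
  | single v a =>
    rw [AddMonoidAlgebra.single_pow, substPow_single, sub_eq_add_neg,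
      ← AddMonoidAlgebra.single_neg, ← AddMonoidAlgebra.single_add, ← sub_eq_add_neg]
    have h : (p : ℤ) ∣ a ^ p - a := by
      rw [← ZMod.intCast_zmod_eq_zero_iff_dvd]
      simp
    obtain ⟨b, hb⟩ := h
    refine ⟨AddMonoidAlgebra.single (p • v) b, ?_⟩
    rw [hb, ← nsmul_eq_mul, ← nsmul_eq_mul, AddMonoidAlgebra.smul_single]

end Cartier

/-! ### The filtration by degree -/

namespace UnimodularFan

section Filtration

variable {S : Type*} [CommRing S] {n : ℕ} {V : Type*} [Fintype V]
  (Φ : UnimodularFan (Fin n → ℤ) V) (t : S)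

/-- Laurent polynomials of degree at most `l` whose coefficient at `x ^ w` is divisible by
`t ^ (q deg w)`. -/
def filtration (q l : ℕ) : Submodule S (Laurent S n) where
  carrier := {P | ∀ w, t ^ (q * Φ.degree w) ∣ P.coeff w ∧ (l < Φ.degree w → P.coeff w = 0)}
  add_mem' {P Q} hP hQ w := by
    refine ⟨dvd_add (hP w).1 (hQ w).1, fun h => ?_⟩
    rw [AddMonoidAlgebra.coeff_add, Finsupp.add_apply, (hP w).2 h, (hQ w).2 h, add_zero]
  zero_mem' w := by simp
  smul_mem' a P hP w := by
    refine ⟨Dvd.dvd.mul_left (hP w).1 _, fun h => ?_⟩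
    rw [AddMonoidAlgebra.coeff_smul, Finsupp.smul_apply, (hP w).2 h, smul_zero]

variable {Φ t} {q l : ℕ}

theorem filtration_mono {l' : ℕ} (h : l ≤ l') : Φ.filtration t q l ≤ Φ.filtration t q l' :=
  fun _ hP w => ⟨(hP w).1, fun h' => (hP w).2 (h.trans_lt h')⟩

theorem mul_mem_filtration {l' : ℕ} {P Q : Laurent S n} (hP : P ∈ Φ.filtration t q l)
    (hQ : Q ∈ Φ.filtration t q l') : P * Q ∈ Φ.filtration t q (l + l') := by
  intro w
  rw [coeff_mul_eq_sum]
  refine ⟨Finset.dvd_sum fun a _ => ?_, fun h => Finset.sum_eq_zero fun a _ => ?_⟩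
  · refine dvd_trans (pow_dvd_pow t ?_) ((pow_add t _ _).dvd.trans
      (mul_dvd_mul (hP a).1 (hQ (w - a)).1))
    rw [← mul_add]
    exact Nat.mul_le_mul_left _ (Φ.degree_le_add_sub a w)
  · have := Φ.degree_le_add_sub a w
    by_cases ha : l < Φ.degree a
    · rw [(hP a).2 ha, zero_mul]
    · rw [(hQ (w - a)).2 (by omega), mul_zero]

theorem single_mem_filtration {v : Fin n → ℤ} (hv : Φ.degree v ≤ l) {a : S}
    (ha : t ^ (q * Φ.degree v) ∣ a) : AddMonoidAlgebra.single v a ∈ Φ.filtration t q l := by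
  classical
  intro w
  rw [AddMonoidAlgebra.coeff_single, Finsupp.single_apply]
  split_ifs with h
  · subst h
    exact ⟨ha, fun h => absurd hv (not_le.2 h)⟩
  · simp

theorem one_mem_filtration : (1 : Laurent S n) ∈ Φ.filtration t q l :=
  single_mem_filtration (by simp) (by simp)

theorem pow_mem_filtration {P : Laurent S n} (hP : P ∈ Φ.filtration t q l) (m : ℕ) :
    P ^ m ∈ Φ.filtration t q (m * l) := by
  induction m with
  | zero => exact one_mem_filtration
  | succ m ih =>
    rw [pow_succ, Nat.succ_mul]
    exact mul_mem_filtration ih hP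

theorem oneSub_mem_filtration {g : Laurent ℤ n} (hg : ∀ w, g.coeff w ≠ 0 → Φ.degree w ≤ 1)
    {a : S} (ha : t ^ q ∣ a) : oneSub a g ∈ Φ.filtration t q 1 := by
  refine Submodule.sub_mem _ one_mem_filtration fun w => ?_
  rw [AddMonoidAlgebra.coeff_smul, Finsupp.smul_apply, AddMonoidAlgebra.coeff_mapRingHom,
    smul_eq_mul]
  by_cases hw : g.coeff w = 0
  · simp [hw]
  · have := hg w hw
    refine ⟨Dvd.dvd.mul_right (dvd_trans (pow_dvd_pow t ?_) ha) _, fun h => by omega⟩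
    calc q * Φ.degree w ≤ q * 1 := Nat.mul_le_mul_left _ this
      _ = q := mul_one q

/-- Degrees are multiplied by `p`, so a weight of `p` per degree in `x` becomes a weight of `1` per
degree in `x^p`. -/
theorem substPow_mem_filtration {p : ℕ} (hp : p ≠ 0) {P : Laurent S n}
    (hP : P ∈ Φ.filtration t p l) : substPow p P ∈ Φ.filtration t 1 (p * l) := by
  intro w
  by_cases hw : ∃ v, p • v = w
  · obtain ⟨v, rfl⟩ := hw
    rw [coeff_substPow_nsmul hp, Φ.degree_nsmul, one_mul]
    exact ⟨(hP v).1, fun h => (hP v).2 (lt_of_mul_lt_mul_left h (Nat.zero_le p))⟩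
  · push Not at hw
    simp [coeff_substPow_of_ne P hw]

theorem cartier_mem_filtration {p : ℕ} (hp : p ≠ 0) {P : Laurent S n}
    (hP : P ∈ Φ.filtration t 1 (p * l)) : cartier hp P ∈ Φ.filtration t p l := by
  intro v
  have := hP (p • v)
  rw [Φ.degree_nsmul, one_mul] at this
  rw [coeff_cartier]
  exact ⟨this.1, fun h => this.2 (Nat.mul_lt_mul_of_pos_left h (Nat.pos_of_ne_zero hp))⟩

theorem filtration_eq_span {k : ℕ} {s : Finset (Fin n → ℤ)} (hs : ∀ u, u ∈ s ↔ Φ.degree u ≤ k)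
    (hl : l ≤ k) : Φ.filtration t q l = Submodule.span S
      ((fun v => AddMonoidAlgebra.single v (t ^ (q * Φ.degree v))) ''
        (s.filter fun v => Φ.degree v ≤ l : Set (Fin n → ℤ))) := by
  apply le_antisymm
  · intro P hP
    rw [← P.sum_coeff_single]
    refine Submodule.sum_mem _ fun v hv => ?_
    have hv0 := Finsupp.mem_support_iff.1 hv
    have hvl : Φ.degree v ≤ l := not_lt.1 fun h => hv0 ((hP v).2 h)
    obtain ⟨c, hc⟩ := (hP v).1
    rw [hc, mul_comm, ← smul_eq_mul c, ← AddMonoidAlgebra.smul_single]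
    refine Submodule.smul_mem _ _ (Submodule.subset_span ⟨v, ?_, rfl⟩)
    simp [hs, hvl, hvl.trans hl]
  · rw [Submodule.span_le]
    rintro _ ⟨v, hv, rfl⟩
    simp only [Finset.coe_filter, Set.mem_ofPred_eq] at hv
    exact single_mem_filtration hv.2 dvd_rfl

theorem filtration_fg {k : ℕ} {s : Finset (Fin n → ℤ)} (hs : ∀ u, u ∈ s ↔ Φ.degree u ≤ k)
    (hl : l ≤ k) : (Φ.filtration t q l).FG := by
  rw [filtration_eq_span hs hl]
  exact Submodule.fg_span ((Finset.finite_toSet _).image _)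

end Filtration

end UnimodularFan

/-! ### Frobenius structure modulo `p` -/

section Frobenius

variable {n : ℕ}

theorem substPow_mapRingHom {S S' : Type*} [CommRing S] [CommRing S'] (φ : S →+* S') (p : ℕ)
    (P : Laurent S n) :
    substPow p (AddMonoidAlgebra.mapRingHom (Fin n → ℤ) φ P) =
      AddMonoidAlgebra.mapRingHom (Fin n → ℤ) φ (substPow p P) := by
  induction P using AddMonoidAlgebra.induction_linear with
  | zero => simp
  | add P Q hP hQ => simp only [map_add, hP, hQ]
  | single v a => simp [substPow_single]

/-- Modulo `p`, the `p`-th power is additive, it acts on `g` as `x ↦ x^p`, and `t^σ` agrees with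
`t^p`. -/
theorem exists_frobenius_lift (p : ℕ) [hp : Fact p.Prime] {tσ w₀ : PowerSeries ℤ_[p]}
    (htσ : tσ = PowerSeries.X ^ p * (1 + (p : PowerSeries ℤ_[p]) * PowerSeries.X * w₀))
    (g : Laurent ℤ n) :
    ∃ G : Laurent (PowerSeries ℤ_[p]) n,
      substPow p (oneSub tσ g) - oneSub PowerSeries.X g ^ p =
        (p : PowerSeries ℤ_[p]) • G := by
  set ψ := AddMonoidAlgebra.mapRingHom (Fin n → ℤ) (Int.castRingHom (PowerSeries ℤ_[p])) with hψ
  obtain ⟨E, hE⟩ := dvd_pow_sub_substPow p g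
  have hE' : substPow p (ψ g) = ψ g ^ p - (p : Laurent (PowerSeries ℤ_[p]) n) * ψ E := by
    rw [hψ, substPow_mapRingHom, ← map_pow, sub_eq_iff_eq_add.1 hE]
    simp
  -- The sign `(-1)^p` is `-1` modulo `p` also for `p = 2`.
  obtain ⟨c, hc⟩ : ∃ c : Laurent (PowerSeries ℤ_[p]) n, (-1) ^ p = -1 + p * c := by
    obtain ⟨c, hc⟩ : ∃ c : ℤ, (-1) ^ p = -1 + p * c := by
      rcases hp.out.eq_two_or_odd' with h | h
      · exact ⟨1, by rw [h]; norm_num⟩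
      · exact ⟨0, by rw [h.neg_one_pow]; simp⟩
    exact ⟨c, by exact_mod_cast congrArg (Int.cast : ℤ → Laurent (PowerSeries ℤ_[p]) n) hc⟩
  let α := algebraMap (PowerSeries ℤ_[p]) (Laurent (PowerSeries ℤ_[p]) n)
  obtain ⟨r, hr⟩ := exists_add_pow_prime_eq hp.out (1 : Laurent (PowerSeries ℤ_[p]) n)
    (-(α PowerSeries.X * ψ g))
  have hα : α tσ = α PowerSeries.X ^ p * (1 + p * α PowerSeries.X * α w₀) := by
    rw [htσ]; simp
  refine ⟨-(α PowerSeries.X ^ (p + 1) * α w₀ * ψ g ^ p) + α tσ * ψ E -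
    c * α PowerSeries.X ^ p * ψ g ^ p + α PowerSeries.X * ψ g * r, ?_⟩
  rw [oneSub, oneSub, map_sub, map_one, substPow_smul, hE', Algebra.smul_def, Algebra.smul_def,
    Algebra.smul_def, map_natCast, sub_eq_add_neg 1 (_ * ψ g), hr, neg_pow, hc, mul_pow, hα]
  ring

/-- The truncation of `(1 - x) ^ (-k)` at order `N`. -/
def truncInv (k N : ℕ) : Polynomial ℤ :=
  ∑ m ∈ Finset.range N, Polynomial.C ((m + (k - 1)).choose (k - 1) : ℤ) * Polynomial.X ^ m

/-- A truncated inverse with controlled error keeps the argument inside Laurent polynomials, with no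
completion. -/
theorem exists_one_sub_pow_mul_truncInv {k : ℕ} (hk : 0 < k) (N : ℕ) :
    ∃ Y : Polynomial ℤ, (1 - Polynomial.X) ^ k * truncInv k N = 1 + Polynomial.X ^ N * Y := by
  have h : Polynomial.X ^ N ∣ (1 - Polynomial.X) ^ k * truncInv k N - 1 := by
    rw [Polynomial.X_pow_dvd_iff]
    intro d hd
    have hcoeff : ∀ j < N, (truncInv k N).coeff j = ((k - 1 + j).choose (k - 1) : ℤ) := by
      intro j hj
      simp only [truncInv, Polynomial.finsetSum_coeff, Polynomial.coeff_C_mul,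
        Polynomial.coeff_X_pow, mul_ite, mul_one, mul_zero]
      rw [Finset.sum_ite_eq, if_pos (Finset.mem_range.2 hj), add_comm]
    have h1 := PowerSeries.mk_add_choose_mul_one_sub_pow_eq_one ℤ (k - 1)
    rw [Nat.sub_add_cancel hk, mul_comm] at h1
    have h2 := congrArg (PowerSeries.coeff d) h1
    rw [PowerSeries.coeff_mul] at h2
    rw [Polynomial.coeff_sub, Polynomial.coeff_mul, sub_eq_zero]
    have h3 : (PowerSeries.coeff d (1 : PowerSeries ℤ)) = (1 : Polynomial ℤ).coeff d := by
      rw [PowerSeries.coeff_one, Polynomial.coeff_one]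
    rw [← h3, ← h2]
    refine Finset.sum_congr rfl fun x hx => ?_
    have hx := Finset.HasAntidiagonal.mem_antidiagonal.1 hx
    rw [hcoeff _ (by omega), PowerSeries.coeff_mk]
    congr 1
    have : (1 - PowerSeries.X : PowerSeries ℤ) ^ k =
        (((1 - Polynomial.X) ^ k : Polynomial ℤ) : PowerSeries ℤ) := by simp
    rw [this, Polynomial.coeff_coe]
  obtain ⟨Y, hY⟩ := h
  exact ⟨Y, by rw [← hY]; ring⟩

end Frobenius

namespace UnimodularFan

variable {n : ℕ} {V : Type*} [Fintype V] {Φ : UnimodularFan (Fin n → ℤ) V} {g : Laurent ℤ n}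

/-! ### Expansion according to pole order -/

section PoleOrder

variable {S : Type*} [CommRing S] {t τ η : S} {p : ℕ}

/-- The element `t ^ (p deg v) x ^ v (1 - τ g) ^ (k - max (deg v) 1)`. -/
def poleBasis (Φ : UnimodularFan (Fin n → ℤ) V) (p : ℕ) (g : Laurent ℤ n) (t τ : S) (k : ℕ)
    (v : Fin n → ℤ) : Laurent S n :=
  AddMonoidAlgebra.single v (t ^ (p * Φ.degree v)) * oneSub τ g ^ (k - 1 - (Φ.degree v - 1))

/-- Induction on the pole order `l`: numerators of low degree are traded for an extra factor `1 - τ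
g`, those of top degree are basis elements, and everything left over is divisible by `t`, where
Nakayama's lemma applies. -/
theorem mul_pow_mem_span_poleBasis (hg : ∀ w, g.coeff w ≠ 0 → Φ.degree w ≤ 1)
    (hp : p ≠ 0) (hτ : τ = t ^ p * η) (ht : Ideal.span {t} ≤ Ideal.jacobson ⊥)
    {k : ℕ} {s : Finset (Fin n → ℤ)} (hs : ∀ u, u ∈ s ↔ Φ.degree u ≤ k) {l : ℕ} (hl1 : 1 ≤ l)
    (hlk : l ≤ k) {P : Laurent S n} (hP : P ∈ Φ.filtration t p l) :
    P * oneSub τ g ^ (k - l) ∈ Submodule.span S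
      (Φ.poleBasis p g t τ k '' {v | Φ.degree v ≤ l}) := by
  set B : ℕ → Submodule S (Laurent S n) := fun l => Submodule.span S
    (Φ.poleBasis p g t τ k '' {v | Φ.degree v ≤ l}) with hB
  have hBmono : ∀ {l l'}, l ≤ l' → B l ≤ B l' := fun h =>
    Submodule.span_mono (Set.image_mono fun v (hv : _ ≤ _) => hv.trans h)
  induction l, hl1 using Nat.le_induction generalizing P with
  | base =>
    rw [filtration_eq_span hs hlk] at hP
    induction hP using Submodule.span_induction with
    | mem x hx =>
      obtain ⟨v, hv, rfl⟩ := hx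
      simp only [Finset.coe_filter, Set.mem_ofPred_eq] at hv
      refine Submodule.subset_span ⟨v, hv.2, ?_⟩
      -- Degrees `0` and `1` share the exponent `k - 1`, by truncated subtraction.
      rw [poleBasis]
      congr 2
      omega
    | zero => rw [zero_mul]; exact Submodule.zero_mem _
    | add x y _ _ hx hy => rw [add_mul]; exact Submodule.add_mem _ hx hy
    | smul a x _ hx => rw [smul_mul_assoc]; exact Submodule.smul_mem _ a hx
  | succ l hl ih =>
    set μ : Laurent S n →ₗ[S] Laurent S n :=
      LinearMap.mulRight S (oneSub τ g ^ (k - (l + 1))) with hμ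
    set W : Submodule S (Laurent S n) :=
      (Φ.filtration (t : S) p (l + 1)).map μ with hW
    suffices hWB : W ≤ B (l + 1) by
      have hPW : μ P ∈ W := Submodule.mem_map_of_mem hP
      have hPB := hWB hPW
      rwa [hμ, LinearMap.mulRight_apply] at hPB
    refine Submodule.le_of_le_smul_of_le_jacobson_bot ((filtration_fg hs hlk).map μ)
      ht ?_
    -- Descending induction on `deg v`; `j` is its distance from the top degree `l + 1`.
    have hgen : ∀ (j : ℕ) (v : Fin n → ℤ), Φ.degree v + j = l + 1 →
        AddMonoidAlgebra.single v (t ^ (p * Φ.degree v)) *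
          oneSub τ g ^ (k - (l + 1)) ∈
          B (l + 1) ⊔ Ideal.span {(t : S)} • W := by
      intro j
      induction j with
      | zero =>
        intro v hv
        refine Submodule.mem_sup_left (Submodule.subset_span ⟨v, by
          simp only [Set.mem_ofPred_eq]; omega, ?_⟩)
        rw [poleBasis]
        congr 2
        omega
      | succ j ihj =>
        -- The identity `1 = (1 - τ g) + τ g` raises either the exponent of `1 - τ g` or the
        -- monomial.
        intro v hv
        have hsplit : AddMonoidAlgebra.single v (t ^ (p * Φ.degree v) : S) *
            oneSub τ g ^ (k - (l + 1)) =
            AddMonoidAlgebra.single v (t ^ (p * Φ.degree v)) *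
              oneSub τ g ^ (k - l) +
            ∑ w ∈ g.coeff.support, AddMonoidAlgebra.single (v + w)
              (t ^ (p * Φ.degree v) * (τ * (g.coeff w : S))) *
              oneSub τ g ^ (k - (l + 1)) := by
          have h1 : k - l = (k - (l + 1)) + 1 := by omega
          have h2 : ∑ w ∈ g.coeff.support, AddMonoidAlgebra.single (v + w)
              (t ^ (p * Φ.degree v) * (τ * (g.coeff w : S))) =
              AddMonoidAlgebra.single v (t ^ (p * Φ.degree v)) *
                (1 - oneSub τ g) := by
            have h3 : (1 : Laurent S n) - oneSub τ g =
                ∑ w ∈ g.coeff.support, AddMonoidAlgebra.single w (τ * (g.coeff w : S)) := by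
              rw [oneSub, sub_sub_cancel]
              conv_lhs => rw [← g.sum_coeff_single]
              rw [Finsupp.sum, map_sum, Finset.smul_sum]
              refine Finset.sum_congr rfl fun w _ => ?_
              rw [AddMonoidAlgebra.mapRingHom_single, AddMonoidAlgebra.smul_single]
              simp
            rw [h3, Finset.mul_sum]
            exact Finset.sum_congr rfl fun w _ => (AddMonoidAlgebra.single_mul_single ..).symm
          rw [← Finset.sum_mul, h2, h1, pow_succ]
          ring
        rw [hsplit]
        refine Submodule.add_mem _ (Submodule.mem_sup_left (hBmono (Nat.le_succ l) (ih (by omega)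
          (single_mem_filtration (by omega) dvd_rfl)))) (Submodule.sum_mem _ fun w hw => ?_)
        have hw1 := hg w (Finsupp.mem_support_iff.1 hw)
        have hdeg := Φ.degree_add v w
        set ζ : S := η * (g.coeff w : S) with hζ
        -- If the degree rises, `t^p` from `τ` is exactly the weight required. Otherwise powers of
        -- `t` are left over, and the term lies in `t W`.
        by_cases hvw : Φ.degree (v + w) = Φ.degree v + 1
        · have h4 : AddMonoidAlgebra.single (v + w)
              (t ^ (p * Φ.degree v) * (τ * (g.coeff w : S))) =
              ζ • AddMonoidAlgebra.single (v + w)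
                (t ^ (p * Φ.degree (v + w)) : S) := by
            rw [AddMonoidAlgebra.smul_single, hvw, hτ, hζ, smul_eq_mul]
            congr 1
            ring
          rw [h4, smul_mul_assoc]
          exact Submodule.smul_mem _ _ (ihj (v + w) (by omega))
        · obtain ⟨d, hd⟩ : ∃ d, Φ.degree v = Φ.degree (v + w) + d :=
            Nat.exists_eq_add_of_le (by omega)
          obtain ⟨q, hq⟩ : ∃ q, p = q + 1 := ⟨p - 1, (Nat.sub_add_cancel (Nat.pos_of_ne_zero hp)).symm⟩
          have h4 : AddMonoidAlgebra.single (v + w)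
              (t ^ (p * Φ.degree v) * (τ * (g.coeff w : S))) =
              (t : S) • AddMonoidAlgebra.single (v + w)
                (t ^ (p * Φ.degree (v + w)) *
                  (t ^ (p * d + q) * ζ) : S) := by
            rw [AddMonoidAlgebra.smul_single, hτ, hζ, smul_eq_mul, hd]
            congr 1
            have : (t : S) ^ p = t ^ q * t := by
              rw [← pow_succ, ← hq]
            rw [this]
            ring
          rw [h4, smul_mul_assoc]
          refine Submodule.mem_sup_right (Submodule.smul_mem_smul
            (Ideal.mem_span_singleton_self _) (Submodule.mem_map_of_mem
              (single_mem_filtration (by omega) (dvd_mul_right _ _))))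
    rw [hW, Submodule.map_le_iff_le_comap, ← hW]
    conv_lhs => rw [filtration_eq_span hs hlk]
    rw [Submodule.span_le]
    rintro _ ⟨v, hv, rfl⟩
    simp only [Finset.coe_filter, Set.mem_ofPred_eq] at hv
    exact hgen (l + 1 - Φ.degree v) v (by omega)

end PoleOrder

end UnimodularFan

namespace UnimodularFan

variable {p : ℕ} [hp : Fact p.Prime] {n : ℕ} {V : Type*} [Fintype V]
  {Φ : UnimodularFan (Fin n → ℤ) V} {g : Laurent ℤ n} {tσ w₀ : PowerSeries ℤ_[p]}

/-! ### The rows of the Hasse–Witt matrix -/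

section Rows

theorem X_mem_jacobson : Ideal.span {(PowerSeries.X : PowerSeries ℤ_[p])} ≤
    Ideal.jacobson ⊥ := by
  rw [IsLocalRing.jacobson_eq_maximalIdeal ⊥ bot_ne_top, Ideal.span_singleton_le_iff_mem,
    IsLocalRing.mem_maximalIdeal, mem_nonunits_iff, PowerSeries.isUnit_iff_constantCoeff]
  simp

theorem natCast_powerSeries_ne_zero : (p : PowerSeries ℤ_[p]) ≠ 0 := by
  intro h
  have := congrArg PowerSeries.constantCoeff h
  rw [map_natCast, map_zero] at this
  exact hp.out.ne_zero (by exact_mod_cast this)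

/-- Divisibility by a power of `X` is the vanishing of low coefficients, and `p` is not a zero
divisor. -/
theorem mem_filtration_of_natCast_smul_mem {q l : ℕ} {G : Laurent (PowerSeries ℤ_[p]) n}
    (h : (p : PowerSeries ℤ_[p]) • G ∈ Φ.filtration PowerSeries.X q l) :
    G ∈ Φ.filtration PowerSeries.X q l := by
  intro w
  have hw := h w
  rw [AddMonoidAlgebra.coeff_smul, Finsupp.smul_apply, smul_eq_mul] at hw
  refine ⟨?_, fun hl => (mul_eq_zero.1 (hw.2 hl)).resolve_left natCast_powerSeries_ne_zero⟩
  rw [PowerSeries.X_pow_dvd_iff]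
  intro m hm
  have h1 := PowerSeries.X_pow_dvd_iff.1 hw.1 m hm
  rw [← map_natCast (PowerSeries.C (R := ℤ_[p])), PowerSeries.coeff_C_mul] at h1
  exact (mul_eq_zero.1 h1).resolve_left (by exact_mod_cast hp.out.ne_zero)

/-- The Laurent polynomial `∑_v (coefficient of x ^ (p v - u) in t ^ (deg u) F) x ^ v`. -/
def hwRow (Φ : UnimodularFan (Fin n → ℤ) V) (p : ℕ) [hp : Fact p.Prime] (g : Laurent ℤ n)
    (tσ : PowerSeries ℤ_[p]) (k : ℕ) (u : Fin n → ℤ) : Laurent (PowerSeries ℤ_[p]) n :=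
  cartier hp.out.ne_zero
    (AddMonoidAlgebra.single u (PowerSeries.X ^ Φ.degree u) * hwPolynomial p g tσ k)

theorem coeff_hwRow (k : ℕ) (u v : Fin n → ℤ) : (Φ.hwRow p g tσ k u).coeff v =
    PowerSeries.X ^ Φ.degree u * (hwPolynomial p g tσ k).coeff (p • v - u) := by
  rw [hwRow, coeff_cartier, AddMonoidAlgebra.coeff_single_mul_apply, neg_add_eq_sub]

/-- The powers of `f^σ(x^p)` leave the Cartier operator by the projection formula, and each
difference contributes a factor `p`. -/
theorem hwRow_eq_sum {k : ℕ} {G : Laurent (PowerSeries ℤ_[p]) n}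
    (hG : substPow p (oneSub tσ g) - oneSub PowerSeries.X g ^ p = (p : PowerSeries ℤ_[p]) • G)
    (u : Fin n → ℤ) :
    Φ.hwRow p g tσ k u = ∑ r ∈ Finset.range k, (p : PowerSeries ℤ_[p]) ^ r •
      (cartier hp.out.ne_zero (AddMonoidAlgebra.single u (PowerSeries.X ^ Φ.degree u) *
        oneSub PowerSeries.X g ^ (p - k) * G ^ r) * oneSub tσ g ^ (k - 1 - r)) := by
  rw [hwRow, hwPolynomial]
  rw [hG, Finset.mul_sum, Finset.mul_sum, map_sum]
  refine Finset.sum_congr rfl fun r _ => ?_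
  rw [mul_comm (cartier hp.out.ne_zero _), ← cartier_substPow_mul, ← map_smul, map_pow, smul_pow]
  congr 1
  rw [Algebra.smul_def, Algebra.smul_def]
  ring

variable (hg : ∀ w, g.coeff w ≠ 0 → Φ.degree w ≤ 1)
  (htσ : tσ = PowerSeries.X ^ p * (1 + (p : PowerSeries ℤ_[p]) * PowerSeries.X * w₀))
include hg htσ

theorem frobenius_lift_mem_filtration {G : Laurent (PowerSeries ℤ_[p]) n}
    (hG : substPow p (oneSub tσ g) - oneSub PowerSeries.X g ^ p = (p : PowerSeries ℤ_[p]) • G) :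
    G ∈ Φ.filtration PowerSeries.X 1 p := by
  refine mem_filtration_of_natCast_smul_mem ?_
  rw [← hG]
  refine Submodule.sub_mem _ ?_ ?_
  · have := substPow_mem_filtration hp.out.ne_zero (oneSub_mem_filtration (q := p) hg
      (show PowerSeries.X ^ p ∣ tσ from ⟨_, htσ⟩))
    rwa [mul_one] at this
  · have := pow_mem_filtration (oneSub_mem_filtration (q := 1) hg
      (show (PowerSeries.X : PowerSeries ℤ_[p]) ^ 1 ∣ PowerSeries.X by simp)) p
    rwa [mul_one] at this

/-- The degrees add up to `k + (p - k) + p r = p (r + 1)`, which the Cartier operator divides by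
`p`. -/
theorem cartier_mem_filtration_succ {k : ℕ} (hk : k ≤ p) {G : Laurent (PowerSeries ℤ_[p]) n}
    (hG : substPow p (oneSub tσ g) - oneSub PowerSeries.X g ^ p = (p : PowerSeries ℤ_[p]) • G)
    {u : Fin n → ℤ} (hu : Φ.degree u ≤ k) (r : ℕ) :
    cartier hp.out.ne_zero (AddMonoidAlgebra.single u (PowerSeries.X ^ Φ.degree u) *
        oneSub PowerSeries.X g ^ (p - k) * G ^ r) ∈ Φ.filtration PowerSeries.X p (r + 1) := by
  refine cartier_mem_filtration hp.out.ne_zero ?_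
  have h1 : AddMonoidAlgebra.single u (PowerSeries.X ^ Φ.degree u : PowerSeries ℤ_[p]) ∈
      Φ.filtration PowerSeries.X 1 k := single_mem_filtration hu (by simp)
  have h2 := pow_mem_filtration (oneSub_mem_filtration (q := 1) hg
      (show (PowerSeries.X : PowerSeries ℤ_[p]) ^ 1 ∣ PowerSeries.X by simp)) (p - k)
  have h3 := pow_mem_filtration (frobenius_lift_mem_filtration hg htσ hG) r
  refine filtration_mono (le_of_eq ?_) (mul_mem_filtration (mul_mem_filtration h1 h2) h3)
  rw [mul_one, Nat.add_sub_cancel' hk]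
  ring

variable {k : ℕ} {s : Finset (Fin n → ℤ)}

/-- The `r`-th term involves only basis elements with `deg v ≤ r + 1`, so its factor `p^r` covers
`p^(deg v - 1)`. -/
theorem hwRow_mem_span (hk : k ≤ p) (hs : ∀ u, u ∈ s ↔ Φ.degree u ≤ k) {u : Fin n → ℤ} (hu : Φ.degree u ≤ k) :
    Φ.hwRow p g tσ k u ∈ Submodule.span (PowerSeries ℤ_[p]) (Set.range fun v : s =>
      (p : PowerSeries ℤ_[p]) ^ (Φ.degree v - 1) • Φ.poleBasis p g PowerSeries.X tσ k v) := by
  obtain ⟨G, hG⟩ := exists_frobenius_lift p htσ g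
  rw [hwRow_eq_sum hG]
  refine Submodule.sum_mem _ fun r hr => ?_
  have hr := Finset.mem_range.1 hr
  have h := mul_pow_mem_span_poleBasis (k := k) hg hp.out.ne_zero htσ X_mem_jacobson hs
    (Nat.le_add_left 1 r) hr (cartier_mem_filtration_succ hg htσ hk hG hu r)
  rw [show k - (r + 1) = k - 1 - r by omega] at h
  generalize cartier hp.out.ne_zero (AddMonoidAlgebra.single u (PowerSeries.X ^ Φ.degree u) *
    oneSub PowerSeries.X g ^ (p - k) * G ^ r) * oneSub tσ g ^ (k - 1 - r) = y at h ⊢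
  induction h using Submodule.span_induction with
  | mem x hx =>
    obtain ⟨v, hv, rfl⟩ := hx
    simp only [Set.mem_ofPred_eq] at hv
    obtain ⟨d, hd⟩ : ∃ d, r = d + (Φ.degree v - 1) := ⟨r - (Φ.degree v - 1), by omega⟩
    rw [hd, pow_add, mul_smul]
    exact Submodule.smul_mem _ _ (Submodule.subset_span ⟨⟨v, (hs v).2 (by omega)⟩, rfl⟩)
  | zero => rw [smul_zero]; exact Submodule.zero_mem _
  | add x y _ _ hx hy => rw [smul_add]; exact Submodule.add_mem _ hx hy
  | smul a x _ hx => rw [smul_comm]; exact Submodule.smul_mem _ a hx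

theorem hwRow_mem_filtration (hk : k ≤ p) {u : Fin n → ℤ} (hu : Φ.degree u ≤ k) :
    Φ.hwRow p g tσ k u ∈ Φ.filtration PowerSeries.X p k := by
  obtain ⟨G, hG⟩ := exists_frobenius_lift p htσ g
  rw [hwRow_eq_sum hG]
  refine Submodule.sum_mem _ fun r hr => Submodule.smul_mem _ _ ?_
  have hr := Finset.mem_range.1 hr
  have h1 := pow_mem_filtration (oneSub_mem_filtration (q := p) hg
      (show PowerSeries.X ^ p ∣ tσ from ⟨_, htσ⟩)) (k - 1 - r)
  refine filtration_mono ?_ (mul_mem_filtration (cartier_mem_filtration_succ hg htσ hk hG hu r) h1)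
  omega

theorem poleBasis_mem_filtration {v : Fin n → ℤ} (hv : Φ.degree v ≤ k) :
    Φ.poleBasis p g PowerSeries.X tσ k v ∈ Φ.filtration PowerSeries.X p k := by
  rw [poleBasis]
  have h1 := pow_mem_filtration (oneSub_mem_filtration (q := p) hg
      (show PowerSeries.X ^ p ∣ tσ from ⟨_, htσ⟩)) (k - 1 - (Φ.degree v - 1))
  refine filtration_mono ?_ (mul_mem_filtration (single_mem_filtration le_rfl dvd_rfl) h1)
  omega

/-- The normalized Hasse–Witt matrix over `ℤ_p[[t]]` exists, and its determinant is divisible by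
`p ^ ∑ (deg v - 1)`. -/
theorem exists_matrix_det_dvd (hk : k ≤ p)
    (hs : ∀ u, u ∈ s ↔ Φ.degree u ≤ k) [DecidableEq s] : ∃ H : Matrix s s (PowerSeries ℤ_[p]),
    (∀ u v : s, PowerSeries.X ^ (p * Φ.degree v) * H u v = (Φ.hwRow p g tσ k u).coeff v) ∧
    (p : PowerSeries ℤ_[p]) ^ (∑ v : s, (Φ.degree v - 1)) ∣ H.det := by
  choose H hH using fun u v : s =>
    (hwRow_mem_filtration hg htσ hk ((hs u).1 u.2) v).1
  choose N hN using fun v v' : s =>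
    (poleBasis_mem_filtration hg htσ ((hs v).1 v.2) v').1
  choose M hM using fun u : s => (Submodule.mem_span_range_iff_exists_fun _).1
    (hwRow_mem_span hg htσ hk hs ((hs u).1 u.2))
  refine ⟨Matrix.of H, fun u v => (hH u v).symm, ?_⟩
  -- `M` expresses the rows in the scaled pole basis, and `N` expresses the pole basis in the
  -- monomials `t^(p deg v) x^v`.
  have hfac : Matrix.of H = Matrix.of M *
      Matrix.diagonal (fun v : s => (p : PowerSeries ℤ_[p]) ^ (Φ.degree v - 1)) *
      Matrix.of N := by
    ext1 u v
    refine mul_left_cancel₀ (pow_ne_zero (p * Φ.degree v) PowerSeries.X_ne_zero) ?_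
    rw [Matrix.of_apply, ← hH, ← hM, Matrix.mul_apply, Finset.mul_sum,
      AddMonoidAlgebra.coeff_sum, Finsupp.finsetSum_apply]
    refine Finset.sum_congr rfl fun v' _ => ?_
    rw [Matrix.mul_diagonal, AddMonoidAlgebra.coeff_smul, AddMonoidAlgebra.coeff_smul,
      Finsupp.smul_apply, Finsupp.smul_apply, hN v' v, Matrix.of_apply, Matrix.of_apply,
      smul_eq_mul, smul_eq_mul]
    ring
  rw [hfac, Matrix.det_mul, Matrix.det_mul, Matrix.det_diagonal, Finset.prod_pow_eq_pow_sum]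
  exact ⟨(Matrix.of M).det * (Matrix.of N).det, by ring⟩

end Rows

/-! ### Reduction modulo `t` -/

section Reduction

/-- Since `g^m` lives in degrees at most `m`, the lowest power of `t` at `x^w` comes from `m = deg
w` alone. -/
theorem coeff_aeval_truncInv (hg : ∀ w, g.coeff w ≠ 0 → Φ.degree w ≤ 1) {q : ℕ} (hq : 0 < q)
    {a η : PowerSeries ℤ_[p]} (ha : a = PowerSeries.X ^ q * η)
    (hη : PowerSeries.constantCoeff η = 1) (k N : ℕ) (w : Fin n → ℤ) :
    ∃ y : PowerSeries ℤ_[p],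
      (Polynomial.aeval (1 - oneSub a g) (truncInv k N)).coeff w =
        PowerSeries.X ^ (q * Φ.degree w) * y ∧
      (Φ.degree w < N → PowerSeries.constantCoeff y = (Φ.leadCoeff g k w : ℤ_[p])) := by
  have hterm : ∀ m, ((1 - oneSub a g) ^ m).coeff w = a ^ m * ((g ^ m).coeff w : PowerSeries ℤ_[p]) := by
    intro m
    rw [oneSub, sub_sub_cancel, smul_pow, ← map_pow, AddMonoidAlgebra.coeff_smul,
      Finsupp.smul_apply, AddMonoidAlgebra.coeff_mapRingHom, smul_eq_mul, eq_intCast]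
  have hexp : (Polynomial.aeval (1 - oneSub a g) (truncInv k N)).coeff w =
      ∑ m ∈ Finset.range N, ((m + (k - 1)).choose (k - 1) : PowerSeries ℤ_[p]) *
        (a ^ m * ((g ^ m).coeff w : PowerSeries ℤ_[p])) := by
    rw [truncInv, map_sum, AddMonoidAlgebra.coeff_sum, Finsupp.finsetSum_apply]
    refine Finset.sum_congr rfl fun m _ => ?_
    rw [map_mul, map_pow, Polynomial.aeval_X, ← hterm, Polynomial.aeval_C]
    simp only [map_natCast]
    rw [← nsmul_eq_mul, ← nsmul_eq_mul]
    rfl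
  refine ⟨∑ m ∈ Finset.range N, ((m + (k - 1)).choose (k - 1) : PowerSeries ℤ_[p]) *
    (PowerSeries.X ^ (q * (m - Φ.degree w)) * η ^ m * ((g ^ m).coeff w : PowerSeries ℤ_[p])),
    ?_, fun hw => ?_⟩
  · rw [hexp, Finset.mul_sum]
    refine Finset.sum_congr rfl fun m _ => ?_
    by_cases h0 : (g ^ m).coeff w = 0
    · simp [h0]
    · obtain ⟨d, hd⟩ := Nat.exists_eq_add_of_le (Φ.degree_le_of_coeff_pow_ne_zero hg m h0)
      rw [ha, hd, Nat.add_sub_cancel_left]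
      ring
  · rw [map_sum, Finset.sum_eq_single_of_mem (Φ.degree w) (Finset.mem_range.2 hw)]
    · simp [leadCoeff, hη]
    · intro m _ hm
      by_cases h0 : (g ^ m).coeff w = 0
      · simp [h0]
      · have h1 := Φ.degree_le_of_coeff_pow_ne_zero hg m h0
        have h2 : q * (m - Φ.degree w) ≠ 0 := (Nat.mul_pos hq (by omega)).ne'
        simp [h2]

/-- Geometric sum for `a = f^σ(x^p) - f^p` and `b = f^σ(x^p)`, whose difference is `-f^p`. -/
theorem hwPolynomial_mul_oneSub_pow {k : ℕ} (hk : k ≤ p) {G : Laurent (PowerSeries ℤ_[p]) n}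
    (hG : substPow p (oneSub tσ g) - oneSub PowerSeries.X g ^ p = (p : PowerSeries ℤ_[p]) • G) :
    hwPolynomial p g tσ k * oneSub PowerSeries.X g ^ k =
      substPow p (oneSub tσ g) ^ k - (p : PowerSeries ℤ_[p]) ^ k • G ^ k := by
  rw [← smul_pow, ← hG, hwPolynomial]
  have h := geom_sum₂_mul (substPow p (oneSub tσ g) - oneSub PowerSeries.X g ^ p)
    (substPow p (oneSub tσ g)) k
  have hpk : oneSub (PowerSeries.X : PowerSeries ℤ_[p]) g ^ p =
      oneSub PowerSeries.X g ^ (p - k) * oneSub PowerSeries.X g ^ k := by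
    rw [← pow_add, Nat.sub_add_cancel hk]
  linear_combination (-1) * h - (∑ r ∈ Finset.range k,
    (substPow p (oneSub tσ g) - oneSub PowerSeries.X g ^ p) ^ r *
      substPow p (oneSub tσ g) ^ (k - 1 - r)) * hpk

theorem exists_hwPolynomial_congruence {k : ℕ} (hk0 : 0 < k) (hk : k ≤ p)
    (htσ : tσ = PowerSeries.X ^ p * (1 + (p : PowerSeries ℤ_[p]) * PowerSeries.X * w₀)) (N : ℕ) :
    ∃ E₁ E₂ : Laurent (PowerSeries ℤ_[p]) n,
      substPow p (Polynomial.aeval (1 - oneSub tσ g) (truncInv k N)) * hwPolynomial p g tσ k -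
        Polynomial.aeval (1 - oneSub PowerSeries.X g) (truncInv k N) =
      (PowerSeries.X : PowerSeries ℤ_[p]) ^ N • E₁ + (p : PowerSeries ℤ_[p]) ^ k • E₂ := by
  obtain ⟨G, hG⟩ := exists_frobenius_lift p htσ g
  have hF := hwPolynomial_mul_oneSub_pow hk hG
  obtain ⟨Y, hY⟩ := exists_one_sub_pow_mul_truncInv hk0 N
  set f := oneSub (PowerSeries.X : PowerSeries ℤ_[p]) g with hf
  set φ := oneSub tσ g with hφ
  set I := Polynomial.aeval (1 - f) (truncInv k N) with hI
  set J := Polynomial.aeval (1 - φ) (truncInv k N) with hJ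
  have h1 := congrArg (Polynomial.aeval (1 - f)) hY
  have h2 := congrArg (substPow p) (congrArg (Polynomial.aeval (1 - φ)) hY)
  simp only [map_mul, map_pow, map_sub, map_one, map_add, Polynomial.aeval_X, sub_sub_cancel,
    ← hI, ← hJ] at h1 h2
  set ψ := AddMonoidAlgebra.mapRingHom (Fin n → ℤ) (Int.castRingHom (PowerSeries ℤ_[p]))
  have hz1 : (1 - f) ^ N = (PowerSeries.X : PowerSeries ℤ_[p]) ^ N • ψ g ^ N := by
    rw [hf, oneSub, sub_sub_cancel, smul_pow]
  have hz2 : (1 - substPow p φ) ^ N = (PowerSeries.X : PowerSeries ℤ_[p]) ^ N •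
      ((PowerSeries.X ^ (p - 1) * (1 + (p : PowerSeries ℤ_[p]) * PowerSeries.X * w₀)) ^ N •
        substPow p (ψ g) ^ N) := by
    rw [smul_smul, ← mul_pow, ← mul_assoc, ← pow_succ', Nat.sub_add_cancel hp.out.one_le, ← htσ,
      ← smul_pow, ← substPow_smul, hφ, oneSub, map_sub, map_one, sub_sub_cancel]
  refine ⟨(PowerSeries.X ^ (p - 1) * (1 + (p : PowerSeries ℤ_[p]) * PowerSeries.X * w₀)) ^ N •
    substPow p (ψ g) ^ N * substPow p (Polynomial.aeval (1 - φ) Y) * I -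
    ψ g ^ N * Polynomial.aeval (1 - f) Y * hwPolynomial p g tσ k * substPow p J,
    -(G ^ k * I * substPow p J), ?_⟩
  rw [hz1] at h1
  rw [hz2] at h2
  simp only [Algebra.smul_def] at h1 h2 hF ⊢
  linear_combination (-(hwPolynomial p g tσ k * substPow p J)) * h1 + I * h2 +
    I * substPow p J * hF

/-- The product starts in order `q (deg v + deg (b - v))`, which is at least `q deg b`, with
equality exactly when `v` and `b - v` lie in a common cone. This is how `testCoeff` acquires its
case distinction. -/
theorem coeff_mul_degree (Φ : UnimodularFan (Fin n → ℤ) V) (q : ℕ) (hq : 0 < q) (v b : Fin n → ℤ)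
    (h y : PowerSeries ℤ_[p]) [Decidable (Φ.coord v ≤ Φ.coord b)] :
    PowerSeries.coeff (q * Φ.degree b)
      (PowerSeries.X ^ (q * Φ.degree v) * h * (PowerSeries.X ^ (q * Φ.degree (b - v)) * y)) =
    if Φ.coord v ≤ Φ.coord b then PowerSeries.constantCoeff h * PowerSeries.constantCoeff y
    else 0 := by
  have hX : PowerSeries.X ^ (q * Φ.degree v) * h * (PowerSeries.X ^ (q * Φ.degree (b - v)) * y) =
      PowerSeries.X ^ (q * (Φ.degree v + Φ.degree (b - v))) * (h * y) := by ring
  rw [hX, PowerSeries.coeff_X_pow_mul']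
  split_ifs with h1 h2 h2
  · rw [Φ.degree_add_degree_sub h2, Nat.sub_self, PowerSeries.coeff_zero_eq_constantCoeff_apply,
      map_mul]
  · exact absurd (Φ.coord_le_iff.2 (le_antisymm (Nat.le_of_mul_le_mul_left h1 hq)
      (Φ.degree_le_add_sub v b))) h2
  · exact absurd (Nat.mul_le_mul_left q (Φ.degree_add_degree_sub h2).le) h1
  · rfl

theorem constantCoeff_matrix_congruence (hg : ∀ w, g.coeff w ≠ 0 → Φ.degree w ≤ 1)
    (htσ : tσ = PowerSeries.X ^ p * (1 + (p : PowerSeries ℤ_[p]) * PowerSeries.X * w₀))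
    {k : ℕ} (hk0 : 0 < k) (hk : k ≤ p) {s : Finset (Fin n → ℤ)}
    (hs : ∀ u, u ∈ s ↔ Φ.degree u ≤ k) {H : Matrix s s (PowerSeries ℤ_[p])}
    (hH : ∀ u v : s, PowerSeries.X ^ (p * Φ.degree v) * H u v = (Φ.hwRow p g tσ k u).coeff v)
    (u b : s) : (p : ℤ_[p]) ^ k ∣
      ∑ v : s, PowerSeries.constantCoeff (H u v) * (Φ.testCoeff g k v b : ℤ_[p]) -
        (Φ.testCoeff g k u (p • (b : Fin n → ℤ)) : ℤ_[p]) := by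
  classical
  -- The coefficients of `t^(p deg b) x^b` are compared after applying the Cartier operator.
  -- Truncation at order `p deg b + 1` makes the error `E₁` invisible there.
  obtain ⟨E₁, E₂, hE⟩ := exists_hwPolynomial_congruence (g := g) hk0 hk htσ (p * Φ.degree b + 1)
  have hη : PowerSeries.constantCoeff (1 + (p : PowerSeries ℤ_[p]) * PowerSeries.X * w₀) = 1 := by
    simp
  choose yJ hyJ hyJ' using coeff_aeval_truncInv hg hp.out.pos htσ hη k (p * Φ.degree b + 1)
  choose yI hyI hyI' using coeff_aeval_truncInv (p := p) hg one_pos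
    (show PowerSeries.X = PowerSeries.X ^ 1 * 1 by simp) (map_one _) k (p * Φ.degree b + 1)
  have h1 := congrArg (fun P => PowerSeries.coeff (p * Φ.degree b) ((cartier hp.out.ne_zero
    (AddMonoidAlgebra.single (u : Fin n → ℤ) (PowerSeries.X ^ Φ.degree u) * P)).coeff b)) hE
  simp only [mul_sub, mul_add, map_sub, map_add, AddMonoidAlgebra.coeff_sub,
    AddMonoidAlgebra.coeff_add, Finsupp.sub_apply, Finsupp.add_apply, mul_smul_comm, map_smul,
    AddMonoidAlgebra.coeff_smul, Finsupp.smul_apply, smul_eq_mul] at h1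
  rw [mul_left_comm, cartier_substPow_mul, ← hwRow, mul_comm (Polynomial.aeval _ _),
    coeff_mul_eq_sum, coeff_cartier, AddMonoidAlgebra.coeff_single_mul_apply, neg_add_eq_sub,
    PowerSeries.coeff_X_pow_mul' _ (p * Φ.degree b + 1),
    if_neg (Nat.not_succ_le_self _), zero_add, hyI, ← Nat.cast_pow,
    ← map_natCast (PowerSeries.C (R := ℤ_[p])), PowerSeries.coeff_C_mul] at h1
  have hsub : (Φ.hwRow p g tσ k u).coeff.support ⊆ s := fun v hv => by
    by_contra hv'
    rw [hs, not_le] at hv'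
    exact Finsupp.mem_support_iff.1 hv
      ((hwRow_mem_filtration hg htσ hk ((hs u).1 u.2) v).2 hv')
  rw [Finset.sum_subset hsub fun v _ hv => by rw [Finsupp.notMem_support_iff.1 hv, zero_mul],
    ← Finset.sum_coe_sort, map_sum] at h1
  have hlhs : ∀ v : s, PowerSeries.coeff (p * Φ.degree b) ((Φ.hwRow p g tσ k u).coeff v *
      (Polynomial.aeval (1 - oneSub tσ g) (truncInv k (p * Φ.degree b + 1))).coeff (b - v)) =
      PowerSeries.constantCoeff (H u v) * (Φ.testCoeff g k v b : ℤ_[p]) := by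
    intro v
    rw [hyJ, ← hH, coeff_mul_degree Φ p hp.out.pos, testCoeff]
    split_ifs with h
    · rw [hyJ']
      have h2 := Φ.degree_add_degree_sub h
      have h3 := Nat.le_mul_of_pos_left (Φ.degree b) hp.out.pos
      omega
    · simp
  have hrhs : PowerSeries.coeff (p * Φ.degree b) (PowerSeries.X ^ Φ.degree u *
      (PowerSeries.X ^ (1 * Φ.degree (p • (b : Fin n → ℤ) - u)) * yI (p • (b : Fin n → ℤ) - u))) =
      (Φ.testCoeff g k u (p • (b : Fin n → ℤ)) : ℤ_[p]) := by
    have h2 := coeff_mul_degree Φ 1 one_pos u (p • (b : Fin n → ℤ)) 1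
      (yI (p • (b : Fin n → ℤ) - u))
    rw [mul_one, Φ.degree_nsmul, one_mul, one_mul] at h2
    rw [h2, testCoeff]
    split_ifs with h
    · rw [hyI', map_one, one_mul]
      have h2 := Φ.degree_add_degree_sub h
      rw [Φ.degree_nsmul] at h2
      omega
    · simp
  rw [Finset.sum_congr rfl fun v _ => hlhs v, hrhs] at h1
  rw [h1, Nat.cast_pow]
  exact dvd_mul_right _ _

/-- The determinant of the normalized Hasse–Witt matrix. -/
theorem exists_normalized_matrix (hg : ∀ w, g.coeff w ≠ 0 → Φ.degree w ≤ 1)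
    (hunit : ∀ i, IsUnit (g.coeff (Φ.vert i) : ℤ_[p]))
    (htσ : tσ = PowerSeries.X ^ p * (1 + (p : PowerSeries ℤ_[p]) * PowerSeries.X * w₀))
    {k : ℕ} (hk0 : 0 < k) (hk : k < p) {s : Finset (Fin n → ℤ)}
    (hs : ∀ u, u ∈ s ↔ Φ.degree u ≤ k) [DecidableEq s] :
    ∃ H : Matrix s s (PowerSeries ℤ_[p]),
      (∀ u v : s, PowerSeries.X ^ (p * Φ.degree v) * H u v =
        PowerSeries.X ^ Φ.degree u * (hwPolynomial p g tσ k).coeff (p • v.1 - u.1)) ∧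
      ∃ hw : (PowerSeries ℤ_[p])ˣ,
        H.det = (p : PowerSeries ℤ_[p]) ^ (∑ u : s, (Φ.degree u - 1)) * hw := by
  obtain ⟨H, hH, d, hd⟩ := exists_matrix_det_dvd hg htσ hk.le hs
  refine ⟨H, fun u v => by rw [hH, coeff_hwRow], ?_⟩
  obtain ⟨c, hc, hdet⟩ := Φ.det_eq_of_cartier_congruence hg hunit hk0 hk hs
    (PowerSeries.constantCoeff.mapMatrix H)
    (constantCoeff_matrix_congruence hg htσ hk0 hk.le hs hH)
  rw [← RingHom.map_det, hd, map_mul, map_pow, map_natCast] at hdet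
  have hp0 : (p : ℤ_[p]) ≠ 0 := by exact_mod_cast hp.out.ne_zero
  -- The same power of `p` occurs on both sides, so the cofactor `d` has a unit as constant term.
  have hdc := mul_left_cancel₀ (pow_ne_zero _ hp0) hdet
  have hdu : IsUnit d := PowerSeries.isUnit_iff_constantCoeff.2 (hdc ▸ hc)
  exact ⟨hdu.unit, by rw [hd, IsUnit.unit_spec]⟩

end Reduction

end UnimodularFan

/-! ### The origin is an interior point -/

section Interior

variable {E : Type*} [NormedAddCommGroup E] [NormedSpace ℝ E]

theorem le_on_convexHull {T : Set E} {f : E →L[ℝ] ℝ} {c : ℝ} (h : ∀ x ∈ T, f x ≤ c) :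
    ∀ x ∈ convexHull ℝ T, f x ≤ c := fun _ hx =>
  convexHull_min (t := {x | f x ≤ c}) h (convex_halfSpace_le f.isLinear c) hx

theorem exists_supporting_of_notMem_interior {Δ : Set E} (hΔ : Convex ℝ Δ)
    (hne : (interior Δ).Nonempty) {x : E} (hx : x ∉ interior Δ) :
    ∃ f : E →L[ℝ] ℝ, (∀ a ∈ interior Δ, f a < f x) ∧ ∀ a ∈ Δ, f a ≤ f x := by
  obtain ⟨f, hf⟩ := geometric_hahn_banach_open_point hΔ.interior isOpen_interior hx
  refine ⟨f, hf, fun a ha => ?_⟩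
  have h1 : a ∈ closure (interior Δ) := by
    rw [hΔ.closure_interior_eq_closure_of_nonempty_interior hne]
    exact subset_closure ha
  exact closure_minimal (fun y hy => (hf y hy).le) (isClosed_le f.continuous continuous_const) h1

/-- A nonzero functional that is nonpositive on a finite spanning set can be moved so that its
kernel is spanned by points of the set. -/
theorem exists_ker_eq_span [FiniteDimensional ℝ E] {T : Set E} (hT : T.Finite)
    (hspan : Submodule.span ℝ T = ⊤) {f₀ : E →L[ℝ] ℝ} (hf₀ : f₀ ≠ 0) (hle : ∀ x ∈ T, f₀ x ≤ 0) :
    ∃ f : E →L[ℝ] ℝ, f ≠ 0 ∧ (∀ x ∈ T, f x ≤ 0) ∧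
      LinearMap.ker (f : E →ₗ[ℝ] ℝ) = Submodule.span ℝ {x ∈ T | f x = 0} := by
  classical
  have hfin : ∀ f : E →L[ℝ] ℝ, {x ∈ T | f x = 0}.Finite := fun f => hT.subset fun x hx => hx.1
  let A : Set (E →L[ℝ] ℝ) := {f | f ≠ 0 ∧ ∀ x ∈ T, f x ≤ 0}
  -- Among the admissible functionals, one with the most zeros on `T` is chosen; if its zeros failed
  -- to span its kernel, tilting would produce one more.
  obtain ⟨f, hfA, hmax⟩ : ∃ f ∈ A, ∀ f' ∈ A, {x ∈ T | f' x = 0}.ncard ≤ {x ∈ T | f x = 0}.ncard := by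
    have hb : BddAbove ((fun f : E →L[ℝ] ℝ => {x ∈ T | f x = 0}.ncard) '' A) := by
      refine ⟨T.ncard, ?_⟩
      rintro _ ⟨f, _, rfl⟩
      exact Set.ncard_le_ncard (fun x hx => hx.1) hT
    obtain ⟨f, hf, hf'⟩ := Nat.sSup_mem (Set.Nonempty.image _
      (show A.Nonempty from ⟨f₀, hf₀, hle⟩)) hb
    exact ⟨f, hf, fun f' h' => (le_csSup hb ⟨f', h', rfl⟩).trans hf'.ge⟩
  refine ⟨f, hfA.1, hfA.2, ?_⟩
  have hWle : Submodule.span ℝ {x ∈ T | f x = 0} ≤ LinearMap.ker (f : E →ₗ[ℝ] ℝ) :=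
    Submodule.span_le.2 fun x hx => hx.2
  by_contra hne
  obtain ⟨y, hyk, hyW⟩ := SetLike.exists_of_lt (lt_of_le_of_ne hWle (Ne.symm hne))
  obtain ⟨h₀, hh₀y, hh₀W⟩ := Submodule.exists_le_ker_of_notMem hyW
  obtain ⟨h, hy, hW, x₀, hx₀, hpos⟩ : ∃ h : E →L[ℝ] ℝ, h y ≠ 0 ∧ (∀ x ∈ T, f x = 0 → h x = 0) ∧
      ∃ x ∈ T, 0 < h x := by
    obtain ⟨x, hx, hx'⟩ : ∃ x ∈ T, h₀ x ≠ 0 := by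
      by_contra! hall
      have : Submodule.span ℝ T ≤ LinearMap.ker h₀ := Submodule.span_le.2 hall
      rw [hspan] at this
      exact hh₀y (this Submodule.mem_top)
    have hz : ∀ x ∈ T, f x = 0 → h₀ x = 0 := fun x hx hfx => hh₀W (Submodule.subset_span ⟨hx, hfx⟩)
    rcases lt_or_gt_of_ne hx' with hlt | hgt
    · refine ⟨-LinearMap.toContinuousLinearMap h₀, by simpa using hh₀y, fun x hx hfx => ?_, x, hx, ?_⟩
      · simpa using hz x hx hfx
      · simpa using hlt
    · exact ⟨LinearMap.toContinuousLinearMap h₀, by simpa using hh₀y, by simpa using hz, x, hx,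
        by simpa using hgt⟩
  -- The tilt `f + s h` stops at the first point of `T` where it reaches zero; old zeros persist
  -- because `h` vanishes on them.
  obtain ⟨x₁, ⟨hx₁, hx₁pos⟩, hmin⟩ := Set.exists_min_image {x ∈ T | 0 < h x}
    (fun x => - f x / h x) (hT.subset fun x hx => hx.1) ⟨x₀, hx₀, hpos⟩
  set s := - f x₁ / h x₁ with hs
  have hfx₁ : f x₁ < 0 := lt_of_le_of_ne (hfA.2 x₁ hx₁) fun h0 => hx₁pos.ne' (hW x₁ hx₁ h0)
  have hspos : 0 < s := div_pos (by linarith) hx₁pos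
  have hsx₁ : f x₁ + s * h x₁ = 0 := by rw [hs]; field_simp; ring
  have hA : f + s • h ∈ A := by
    refine ⟨fun h0 => ?_, fun x hx => ?_⟩
    · have h1 := DFunLike.congr_fun h0 y
      have h2 : f y = 0 := hyk
      simp [h2, hspos.ne', hy] at h1
    · rcases le_or_gt (h x) 0 with hx0 | hx0
      · have := hfA.2 x hx
        have := mul_nonneg hspos.le (neg_nonneg.2 hx0)
        simp only [add_apply, smul_apply, smul_eq_mul]
        linarith
      · have h1 := hmin x ⟨hx, hx0⟩
        rw [le_div_iff₀ hx0] at h1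
        simp only [add_apply, smul_apply, smul_eq_mul]
        linarith
  refine absurd (hmax _ hA) (not_le.2 (Set.ncard_lt_ncard ⟨fun x hx => ⟨hx.1, ?_⟩, fun hsub => ?_⟩
    (hfin _)))
  · simp [hx.2, hW x hx.1 hx.2]
  · exact hfx₁.ne (hsub ⟨hx₁, by simpa using hsx₁⟩).2

end Interior

/-! ### Reflexive polytopes contain the origin in their interior. -/

section Reflexive

variable {n : ℕ} {Δ : Set (Fin n → ℝ)}

/-- Otherwise a supporting functional at the origin can be tilted until it cuts out a facet through
the origin, but facets lie on hyperplanes `∑ aᵢ xᵢ = 1`. -/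
theorem IsReflexive.zero_mem_interior (h : IsReflexive Δ) : (0 : Fin n → ℝ) ∈ interior Δ := by
  obtain ⟨S, hS⟩ := h.isLatticePolytope
  set T := toReal '' (S : Set (Fin n → ℤ)) with hT
  have hTfin : T.Finite := (Finset.finite_toSet S).image _
  have hconv : Convex ℝ Δ := hS ▸ convex_convexHull ℝ T
  have hvs : vectorSpan ℝ Δ = ⊤ := Submodule.eq_top_of_finrank_eq (by
    have := h.dim_eq
    rw [dim] at this
    rw [this, Module.finrank_fin_fun])
  have haff : affineSpan ℝ Δ = ⊤ :=
    (AffineSubspace.affineSpan_eq_top_iff_vectorSpan_eq_top_of_nonempty ℝ (Fin n → ℝ) (Fin n → ℝ)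
      ⟨0, h.zero_mem⟩).2 hvs
  have hne : (interior Δ).Nonempty := hconv.interior_nonempty_iff_affineSpan_eq_top.2 haff
  by_contra h0
  obtain ⟨f₀, hf₀, hf₀'⟩ := exists_supporting_of_notMem_interior hconv hne h0
  rw [map_zero] at hf₀ hf₀'
  have hf₀ne : f₀ ≠ 0 := by
    rintro rfl
    obtain ⟨a, ha⟩ := hne
    simpa using hf₀ a ha
  have hsp : ∀ τ : Set (Fin n → ℝ), (0 : Fin n → ℝ) ∈ τ → vectorSpan ℝ τ = Submodule.span ℝ τ := by
    intro τ hτ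
    rw [vectorSpan_eq_span_vsub_set_right ℝ hτ]
    simp
  have hspan : Submodule.span ℝ T = ⊤ := by
    rw [eq_top_iff, ← hvs, hsp Δ h.zero_mem, Submodule.span_le, hS]
    exact convexHull_min Submodule.subset_span (Submodule.convex _)
  have hTΔ : T ⊆ Δ := hS ▸ subset_convexHull ℝ T
  obtain ⟨f, hf, hfT, hker⟩ := exists_ker_eq_span hTfin hspan hf₀ne fun x hx => hf₀' x (hTΔ hx)
  have hfΔ : ∀ x ∈ Δ, f x ≤ 0 := hS ▸ le_on_convexHull hfT
  set τ := {x ∈ Δ | f x = 0} with hτ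
  have h0τ : (0 : Fin n → ℝ) ∈ τ := ⟨h.zero_mem, map_zero f⟩
  have hvτ : vectorSpan ℝ τ = LinearMap.ker (f : (Fin n → ℝ) →ₗ[ℝ] ℝ) := by
    rw [hsp τ h0τ]
    refine le_antisymm (Submodule.span_le.2 fun x hx => hx.2) ?_
    rw [hker]
    exact Submodule.span_mono fun x hx => ⟨hTΔ hx.1, hx.2⟩
  have hdim : dim τ + 1 = n := by
    have := Module.Dual.finrank_ker_add_one_of_ne_zero (f := (f : (Fin n → ℝ) →ₗ[ℝ] ℝ))
      (by simpa [← ContinuousLinearMap.coe_inj] using hf)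
    rw [dim, hvτ, this, Module.finrank_fin_fun]
  have hface : IsProperFace Δ τ := by
    refine ⟨⟨0, h0τ⟩, fun _ => ⟨f, ?_⟩, fun heq => ?_⟩
    · ext x
      refine ⟨fun hx => ⟨hx.1, fun y hy => (hfΔ y hy).trans hx.2.ge⟩, fun hx => ⟨hx.1, ?_⟩⟩
      exact le_antisymm (hfΔ x hx.1) (by simpa using hx.2 0 h.zero_mem)
    · have := h.dim_eq
      rw [← heq] at this
      omega
  obtain ⟨a, ha⟩ := h.facet τ hface hdim
  rw [ha] at h0τ
  simpa using h0τ.2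

end Reflexive

/-! ### The fan over the faces of a polytope with unimodular faces -/

section Fan

variable {n : ℕ} {Δ : Set (Fin n → ℝ)}

theorem toReal_injective : Function.Injective (toReal : (Fin n → ℤ) → Fin n → ℝ) := fun u v h => by
  funext i
  have := congrFun h i
  simpa [toReal] using this

@[simp] theorem toReal_zero : toReal (0 : Fin n → ℤ) = 0 := by
  funext i; simp [toReal]

theorem toReal_add (u v : Fin n → ℤ) : toReal (u + v) = toReal u + toReal v := by
  funext i; simp [toReal]

theorem toReal_sum_nsmul {V : Type*} [Fintype V] (m : V → ℕ) (e : V → Fin n → ℤ) :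
    toReal (∑ i, m i • e i) = ∑ i, (m i : ℝ) • toReal (e i) := by
  funext j; simp [toReal, Finset.sum_apply]

/-- The nonzero lattice points among the vertices of `Δ`. -/
abbrev Vertex (Δ : Set (Fin n → ℝ)) : Type :=
  {e : Fin n → ℤ // e ≠ 0 ∧ toReal e ∈ Set.extremePoints ℝ Δ}

/-- A lattice polytope around the origin whose proper faces are simplices of volume one. -/
structure IsUnimodularPolytope (Δ : Set (Fin n → ℝ)) : Prop where
  isLatticePolytope : ∃ V : Finset (Fin n → ℤ), Δ = convexHull ℝ (toReal '' (V : Set (Fin n → ℤ)))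
  zero_mem_interior : (0 : Fin n → ℝ) ∈ interior Δ
  face : ∀ τ, IsProperFace Δ τ → IsUnimodularSimplex τ

namespace IsUnimodularPolytope

/-! ### The gauge of the polytope and its supporting functionals. -/

variable (h : IsUnimodularPolytope Δ)
include h

theorem convex : Convex ℝ Δ := by
  obtain ⟨S, rfl⟩ := h.isLatticePolytope
  exact convex_convexHull ℝ _

theorem isCompact : IsCompact Δ := by
  obtain ⟨S, rfl⟩ := h.isLatticePolytope
  exact ((Finset.finite_toSet S).image _).isCompact_convexHull ℝ

theorem exists_finset_extremePoints : ∃ S : Finset (Fin n → ℤ),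
    Set.extremePoints ℝ Δ ⊆ toReal '' (S : Set (Fin n → ℤ)) := by
  obtain ⟨S, rfl⟩ := h.isLatticePolytope
  exact ⟨S, extremePoints_convexHull_subset⟩

theorem finite_vertex : Finite (Vertex Δ) := by
  obtain ⟨S, hS⟩ := h.exists_finset_extremePoints
  refine Set.Finite.subset (Finset.finite_toSet S) fun e he => ?_
  obtain ⟨u, hu, hue⟩ := hS he.2
  rwa [← toReal_injective hue]

theorem mem_nhds : Δ ∈ nhds (0 : Fin n → ℝ) := mem_interior_iff_mem_nhds.1 h.zero_mem_interior

theorem zero_mem : (0 : Fin n → ℝ) ∈ Δ := interior_subset h.zero_mem_interior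

theorem gauge_add (x y : Fin n → ℝ) : gauge Δ (x + y) ≤ gauge Δ x + gauge Δ y :=
  gauge_add_le h.convex (absorbent_nhds_zero h.mem_nhds) x y

theorem gauge_pos {x : Fin n → ℝ} (hx : x ≠ 0) : 0 < gauge Δ x :=
  (_root_.gauge_pos (absorbent_nhds_zero h.mem_nhds)
    (NormedSpace.isVonNBounded_iff ℝ |>.2 h.isCompact.isBounded)).2 hx

theorem gauge_le_one {x : Fin n → ℝ} : gauge Δ x ≤ 1 ↔ x ∈ Δ := by
  rw [gauge_le_one_iff_mem_closure h.convex h.mem_nhds, h.isCompact.isClosed.closure_eq]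

theorem inv_gauge_smul_mem (x : Fin n → ℝ) : (gauge Δ x)⁻¹ • x ∈ Δ := by
  rw [← h.gauge_le_one, gauge_smul_of_nonneg (inv_nonneg.2 (gauge_nonneg x)), smul_eq_mul]
  exact inv_mul_le_one

/-- Functionals bounded by one on `Δ` are bounded by the gauge. -/
theorem le_gauge {φ : (Fin n → ℝ) →L[ℝ] ℝ} (hφ : ∀ x ∈ Δ, φ x ≤ 1) (x : Fin n → ℝ) :
    φ x ≤ gauge Δ x := by
  rcases eq_or_ne x 0 with rfl | hx
  · simp
  · have h1 := hφ _ (h.inv_gauge_smul_mem x)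
    rw [map_smul, smul_eq_mul, inv_mul_le_iff₀ (h.gauge_pos hx), mul_one] at h1
    exact h1

theorem exists_eq_gauge (x : Fin n → ℝ) :
    ∃ φ : (Fin n → ℝ) →L[ℝ] ℝ, (∀ y ∈ Δ, φ y ≤ 1) ∧ φ x = gauge Δ x := by
  rcases eq_or_ne x 0 with rfl | hx
  · exact ⟨0, by simp, by simp⟩
  have hr := h.gauge_pos hx
  have hint : (gauge Δ x)⁻¹ • x ∉ interior Δ := by
    rw [← gauge_lt_one_iff_mem_interior h.convex h.mem_nhds,
      gauge_smul_of_nonneg (inv_nonneg.2 hr.le), smul_eq_mul, inv_mul_cancel₀ hr.ne']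
    exact lt_irrefl 1
  obtain ⟨f, hf, hf'⟩ := exists_supporting_of_notMem_interior h.convex
    ⟨0, h.zero_mem_interior⟩ hint
  have hpos := hf 0 h.zero_mem_interior
  rw [map_zero] at hpos
  refine ⟨(f ((gauge Δ x)⁻¹ • x))⁻¹ • f, fun y hy => ?_, ?_⟩
  · rw [smul_apply, smul_eq_mul, inv_mul_le_iff₀ hpos, mul_one]
    exact hf' y hy
  · rw [map_smul, smul_eq_mul] at hpos
    have hfx : f x ≠ 0 := fun h0 => by simp [h0] at hpos
    rw [smul_apply, map_smul, smul_eq_mul, smul_eq_mul]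
    field_simp

/-! ### Faces of the form `φ = 1` and the cones over them. -/

variable {φ : (Fin n → ℝ) →L[ℝ] ℝ} (hφ : ∀ x ∈ Δ, φ x ≤ 1)
include hφ

theorem isProperFace (hne : {x ∈ Δ | φ x = 1}.Nonempty) : IsProperFace Δ {x ∈ Δ | φ x = 1} := by
  refine ⟨hne, fun _ => ⟨φ, ?_⟩, fun heq => ?_⟩
  · obtain ⟨z, hz, hz1⟩ := hne
    ext x
    exact ⟨fun hx => ⟨hx.1, fun y hy => (hφ y hy).trans hx.2.ge⟩,
      fun hx => ⟨hx.1, le_antisymm (hφ x hx.1) (hz1.ge.trans (hx.2 z hz))⟩⟩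
  · have := heq ▸ h.zero_mem
    simpa using this.2

theorem range_vertex (hne : {x ∈ Δ | φ x = 1}.Nonempty) :
    Set.range (fun e : {e : Vertex Δ // φ (toReal e.1) = 1} => toReal e.1.1) =
      Set.extremePoints ℝ {x ∈ Δ | φ x = 1} := by
  rw [(h.isProperFace hφ hne).isExposed.isExtreme.extremePoints_eq]
  ext x
  constructor
  · rintro ⟨e, rfl⟩
    exact ⟨⟨extremePoints_subset e.1.2.2, e.2⟩, e.1.2.2⟩
  · rintro ⟨hx, hx'⟩
    obtain ⟨S, hS⟩ := h.exists_finset_extremePoints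
    obtain ⟨e, -, rfl⟩ := hS hx'
    refine ⟨⟨⟨e, ?_, hx'⟩, hx.2⟩, rfl⟩
    rintro rfl
    simpa using hx.2

theorem face_eq_convexHull (hne : {x ∈ Δ | φ x = 1}.Nonempty) :
    {x ∈ Δ | φ x = 1} = convexHull ℝ
      (Set.range (fun e : {e : Vertex Δ // φ (toReal e.1) = 1} => toReal e.1.1)) := by
  have := h.finite_vertex
  have hexp := (h.isProperFace hφ hne).isExposed
  have hcl : IsClosed (convexHull ℝ
      (Set.range (fun e : {e : Vertex Δ // φ (toReal e.1) = 1} => toReal e.1.1))) :=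
    (Set.finite_range _).isClosed_convexHull ℝ
  rw [← hcl.closure_eq, h.range_vertex hφ hne,
    closure_convexHull_extremePoints (hexp.isCompact h.isCompact) (hexp.convex h.convex)]

/-- The vertices span the affine hull of the face and exceed its dimension by only one in number. -/
theorem affineIndependent_vertex (hne : {x ∈ Δ | φ x = 1}.Nonempty) :
    AffineIndependent ℝ (fun e : {e : Vertex Δ // φ (toReal e.1) = 1} => toReal e.1.1) := by
  have := h.finite_vertex
  have := Fintype.ofFinite {e : Vertex Δ // φ (toReal e.1) = 1}
  have hcard := (h.face _ (h.isProperFace hφ hne)).card_vertices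
  have hinj : Function.Injective
      (fun e : {e : Vertex Δ // φ (toReal e.1) = 1} => toReal e.1.1) :=
    toReal_injective.comp (Subtype.val_injective.comp Subtype.val_injective)
  rw [← h.range_vertex hφ hne, ← Set.image_univ, Set.ncard_image_of_injective _ hinj,
    Set.ncard_univ, Nat.card_eq_fintype_card] at hcard
  rw [affineIndependent_iff_finrank_vectorSpan_eq ℝ _ hcard, dim]
  conv_rhs => rw [h.face_eq_convexHull hφ hne]
  rw [← direction_affineSpan, ← direction_affineSpan, affineSpan_convexHull]

variable [Fintype (Vertex Δ)]

/-- Applying `φ` shows that the weights sum to zero, so affine independence gives linear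
independence. -/
theorem eq_zero_of_sum_smul_eq_zero {w : Vertex Δ → ℝ}
    (hw : ∀ e, w e ≠ 0 → φ (toReal e.1) = 1) (hsum : ∑ e, w e • toReal e.1 = 0) : w = 0 := by
  classical
  by_contra hne
  obtain ⟨e, he⟩ := Function.ne_iff.1 hne
  have hind := h.affineIndependent_vertex hφ ⟨_, extremePoints_subset e.2.2, hw e he⟩
  have hs : ∀ {M : Type} [AddCommMonoid M] (F : Vertex Δ → M), (∀ e, w e = 0 → F e = 0) →
      ∑ e : {e : Vertex Δ // φ (toReal e.1) = 1}, F e.1 = ∑ e, F e := by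
    intro M _ F hF
    rw [← Finset.sum_subtype (Finset.univ.filter fun e : Vertex Δ => φ (toReal e.1) = 1)
      (by simp) F, Finset.sum_filter_of_ne]
    exact fun e _ hFe => hw e fun h0 => hFe (hF e h0)
  have h1 : ∑ e, w e = 0 := by
    have h2 := congrArg φ hsum
    rw [map_sum, map_zero] at h2
    rw [← h2]
    refine Finset.sum_congr rfl fun e _ => ?_
    rw [map_smul, smul_eq_mul]
    by_cases h0 : w e = 0
    · simp [h0]
    · rw [hw e h0, mul_one]
  refine he (affineIndependent_iff.1 hind Finset.univ (fun e => w e.1) ?_ ?_ ⟨e, hw e he⟩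
    (Finset.mem_univ _))
  · rw [hs w fun _ h0 => h0, h1]
  · rw [hs (fun e => w e • toReal e.1) fun e h0 => by rw [h0, zero_smul], hsum]

theorem gauge_sum {m : Vertex Δ → ℕ} (hm : ∀ e, m e ≠ 0 → φ (toReal e.1) = 1) :
    φ (toReal (∑ e, m e • e.1)) = ∑ e, (m e : ℝ) ∧
      gauge Δ (toReal (∑ e, m e • e.1)) = ∑ e, (m e : ℝ) := by
  have h1 : φ (toReal (∑ e, m e • e.1)) = ∑ e, (m e : ℝ) := by
    rw [toReal_sum_nsmul, map_sum]
    refine Finset.sum_congr rfl fun e _ => ?_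
    rw [map_smul, smul_eq_mul]
    by_cases h0 : m e = 0
    · simp [h0]
    · rw [hm e h0, mul_one]
  refine ⟨h1, le_antisymm ?_ (h1 ▸ h.le_gauge hφ _)⟩
  rw [toReal_sum_nsmul]
  refine (Finset.le_sum_of_subadditive (gauge Δ) gauge_zero.le h.gauge_add _ _).trans ?_
  refine Finset.sum_le_sum fun e _ => ?_
  rw [gauge_smul_of_nonneg (Nat.cast_nonneg _), smul_eq_mul]
  exact mul_le_of_le_one_right (Nat.cast_nonneg _) (h.gauge_le_one.2 (extremePoints_subset e.2.2))

theorem sum_smul_injective {m m' : Vertex Δ → ℕ} (hm : ∀ e, m e ≠ 0 → φ (toReal e.1) = 1)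
    (hm' : ∀ e, m' e ≠ 0 → φ (toReal e.1) = 1) (heq : ∑ e, m e • e.1 = ∑ e, m' e • e.1) :
    m = m' := by
  have h1 := h.eq_zero_of_sum_smul_eq_zero hφ (w := fun e => (m e : ℝ) - m' e) (fun e he => ?_) ?_
  · funext e
    have := congrFun h1 e
    simp only [Pi.zero_apply, sub_eq_zero] at this
    exact_mod_cast this
  · by_cases h0 : m e = 0
    · exact hm' e fun h0' => he (by simp [h0, h0'])
    · exact hm e h0
  · simp only [sub_smul]
    rw [Finset.sum_sub_distrib, ← toReal_sum_nsmul, ← toReal_sum_nsmul, heq, sub_self]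

/-- Lattice points in the cone over a face are sums of vertices of the face. -/
theorem exists_sum_eq {u : Fin n → ℤ} (hu : φ (toReal u) = gauge Δ (toReal u)) :
    ∃ m : Vertex Δ → ℕ, (∀ e, m e ≠ 0 → φ (toReal e.1) = 1) ∧ ∑ e, m e • e.1 = u := by
  classical
  rcases eq_or_ne u 0 with rfl | hu0
  · exact ⟨0, by simp, by simp⟩
  have hr : 0 < gauge Δ (toReal u) := h.gauge_pos fun h0 => hu0 (toReal_injective (by simpa using h0))
  set x := (gauge Δ (toReal u))⁻¹ • toReal u with hx
  have hux : toReal u = gauge Δ (toReal u) • x := by rw [hx, smul_inv_smul₀ hr.ne']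
  have hxτ : x ∈ {x ∈ Δ | φ x = 1} :=
    ⟨h.inv_gauge_smul_mem _, by rw [hx, map_smul, hu, smul_eq_mul, inv_mul_cancel₀ hr.ne']⟩
  have hne : {x ∈ Δ | φ x = 1}.Nonempty := ⟨x, hxτ⟩
  -- Convexity supplies nonnegative real coefficients, unimodularity supplies integral ones, and
  -- linear independence identifies the two after scaling by the gauge.
  obtain ⟨c, hc0, hc1, hcx⟩ : ∃ c : Vertex Δ → ℝ, (∀ e, 0 ≤ c e) ∧
      (∀ e, c e ≠ 0 → φ (toReal e.1) = 1) ∧ ∑ e, c e • toReal e.1 = x := by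
    have hx' := hxτ
    rw [h.face_eq_convexHull hφ hne] at hx'
    refine convexHull_min (t := {x | ∃ c : Vertex Δ → ℝ, (∀ e, 0 ≤ c e) ∧
      (∀ e, c e ≠ 0 → φ (toReal e.1) = 1) ∧ ∑ e, c e • toReal e.1 = x}) ?_ ?_ hx'
    · rintro _ ⟨e, rfl⟩
      refine ⟨Pi.single e.1 1, fun e' => ?_, fun e' he' => ?_, ?_⟩
      · rw [Pi.single_apply]; split_ifs <;> norm_num
      · rw [Pi.single_apply] at he'
        split_ifs at he' with heq
        · rw [heq]; exact e.2
        · exact absurd rfl he'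
      · simp [Pi.single_apply]
    · rintro y ⟨c, hc, hc', rfl⟩ z ⟨d, hd, hd', rfl⟩ a b ha hb -
      refine ⟨fun e => a * c e + b * d e, fun e => ?_, fun e he => ?_, ?_⟩
      · exact add_nonneg (mul_nonneg ha (hc e)) (mul_nonneg hb (hd e))
      · by_cases h0 : c e = 0
        · exact hd' e fun h0' => he (by simp [h0, h0'])
        · exact hc' e h0
      · simp only [add_smul, mul_smul, Finset.sum_add_distrib, Finset.smul_sum]
  obtain ⟨z, hz1, hzu⟩ : ∃ z : Vertex Δ → ℤ,
      (∀ e, z e ≠ 0 → φ (toReal e.1) = 1) ∧ ∑ e, z e • toReal e.1 = toReal u := by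
    have hmem : toReal u ∈ PointedCone.hull ℝ {x ∈ Δ | φ x = 1} := by
      rw [hux]
      exact Submodule.smul_mem _ (⟨gauge Δ (toReal u), hr.le⟩ : {c : ℝ // 0 ≤ c})
        (Submodule.subset_span hxτ)
    have hspan := (h.face _ (h.isProperFace hφ hne)).lattice u hmem
    rw [← h.range_vertex hφ hne] at hspan
    generalize toReal u = y at hspan ⊢
    induction hspan using Submodule.span_induction with
    | mem y hy =>
      obtain ⟨e, rfl⟩ := hy
      refine ⟨Pi.single e.1 1, fun e' he' => ?_, ?_⟩
      · rw [Pi.single_apply] at he'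
        split_ifs at he' with heq
        · rw [heq]; exact e.2
        · exact absurd rfl he'
      · simp [Pi.single_apply]
    | zero => exact ⟨0, by simp, by simp⟩
    | add y y' _ _ hy hy' =>
      obtain ⟨z, hz, rfl⟩ := hy
      obtain ⟨z', hz', rfl⟩ := hy'
      refine ⟨z + z', fun e he => ?_, by simp [add_smul, Finset.sum_add_distrib]⟩
      by_cases h0 : z e = 0
      · exact hz' e fun h0' => he (by simp [h0, h0'])
      · exact hz e h0
    | smul a y _ hy =>
      obtain ⟨z, hz, rfl⟩ := hy
      exact ⟨a • z, fun e he => hz e fun h0 => he (by simp [h0]),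
        by simp [mul_smul, Finset.smul_sum]⟩
  have hcz := h.eq_zero_of_sum_smul_eq_zero hφ
    (w := fun e => gauge Δ (toReal u) * c e - z e) (fun e he => ?_) ?_
  · have hzn : ∀ e, ((z e).toNat : ℤ) = z e := fun e => by
      refine Int.toNat_of_nonneg ?_
      have h1 := congrFun hcz e
      simp only [Pi.zero_apply, sub_eq_zero] at h1
      have h2 : (0 : ℝ) ≤ z e := h1 ▸ mul_nonneg hr.le (hc0 e)
      exact_mod_cast h2
    refine ⟨fun e => (z e).toNat, fun e he => hz1 e fun h0 => he (by simp [h0]),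
      toReal_injective ?_⟩
    rw [toReal_sum_nsmul, ← hzu]
    refine Finset.sum_congr rfl fun e _ => ?_
    have h3 : ((z e).toNat : ℝ) = (z e : ℝ) := by exact_mod_cast congrArg (Int.cast (R := ℝ)) (hzn e)
    rw [h3, Int.cast_smul_eq_zsmul]
  · by_cases h0 : z e = 0
    · exact hc1 e fun h0' => he (by simp [h0, h0'])
    · exact hz1 e h0
  · simp only [sub_smul, mul_smul, Int.cast_smul_eq_zsmul]
    rw [Finset.sum_sub_distrib, ← Finset.smul_sum, hcx, hzu, ← hux, sub_self]

omit hφ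

/-- The functional `(φ + φ') / 2` cuts out the intersection of the two faces and still attains the
gauge at the point. The resulting expansion over common vertices agrees with both given ones. -/
theorem eq_of_sum_eq {φ' : (Fin n → ℝ) →L[ℝ] ℝ} (hφ : ∀ x ∈ Δ, φ x ≤ 1)
    (hφ' : ∀ x ∈ Δ, φ' x ≤ 1) {m m' : Vertex Δ → ℕ} (hm : ∀ e, m e ≠ 0 → φ (toReal e.1) = 1)
    (hm' : ∀ e, m' e ≠ 0 → φ' (toReal e.1) = 1) (heq : ∑ e, m e • e.1 = ∑ e, m' e • e.1) :
    m = m' := by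
  have h1 := h.gauge_sum hφ hm
  have h2 := h.gauge_sum hφ' hm'
  rw [← heq] at h2
  have hψ : ∀ x ∈ Δ, ((1 / 2 : ℝ) • (φ + φ')) x ≤ 1 := fun x hx => by
    have := hφ x hx
    have := hφ' x hx
    simp only [smul_apply, add_apply, smul_eq_mul]
    linarith
  obtain ⟨m'', hm'', heq''⟩ := h.exists_sum_eq hψ (u := ∑ e, m e • e.1) (by
    simp only [smul_apply, add_apply, smul_eq_mul]
    linarith [h1.1, h1.2, h2.1, h2.2])
  have hboth : ∀ e, m'' e ≠ 0 → φ (toReal e.1) = 1 ∧ φ' (toReal e.1) = 1 := fun e he => by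
    have h3 := hm'' e he
    have h4 := hφ _ (extremePoints_subset e.2.2)
    have h5 := hφ' _ (extremePoints_subset e.2.2)
    simp only [smul_apply, add_apply, smul_eq_mul] at h3
    constructor <;> linarith
  rw [← h.sum_smul_injective hφ (fun e he => (hboth e he).1) hm heq'',
    ← h.sum_smul_injective hφ' (fun e he => (hboth e he).2) hm' (heq''.trans heq)]

/-! ### The coordinates and degree of the fan. -/

theorem exists_coord (u : Fin n → ℤ) : ∃ m : Vertex Δ →₀ ℕ,
    (∃ φ : (Fin n → ℝ) →L[ℝ] ℝ, (∀ x ∈ Δ, φ x ≤ 1) ∧ ∀ e, m e ≠ 0 → φ (toReal e.1) = 1) ∧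
      ∑ e, m e • e.1 = u := by
  obtain ⟨φ, hφ, hu⟩ := h.exists_eq_gauge (toReal u)
  obtain ⟨m, hm, hmu⟩ := h.exists_sum_eq hφ hu
  exact ⟨Finsupp.equivFunOnFinite.symm m, ⟨φ, hφ, by simpa using hm⟩, by simpa using hmu⟩

/-- The coefficients of a lattice point in terms of the vertices of a face whose cone contains
it. -/
def coord (u : Fin n → ℤ) : Vertex Δ →₀ ℕ := (h.exists_coord u).choose

theorem exists_coord_supporting (u : Fin n → ℤ) :
    ∃ φ : (Fin n → ℝ) →L[ℝ] ℝ, (∀ x ∈ Δ, φ x ≤ 1) ∧ ∀ e, h.coord u e ≠ 0 → φ (toReal e.1) = 1 :=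
  (h.exists_coord u).choose_spec.1

theorem sum_coord (u : Fin n → ℤ) : ∑ e, h.coord u e • e.1 = u :=
  (h.exists_coord u).choose_spec.2

theorem coord_eq (hφ : ∀ x ∈ Δ, φ x ≤ 1) {m : Vertex Δ →₀ ℕ}
    (hm : ∀ e, m e ≠ 0 → φ (toReal e.1) = 1) : h.coord (∑ e, m e • e.1) = m := by
  obtain ⟨φ', hφ', hm'⟩ := h.exists_coord_supporting (∑ e, m e • e.1)
  exact DFunLike.coe_injective (h.eq_of_sum_eq hφ' hφ hm' hm (h.sum_coord _))

theorem gauge_eq_degree_coord (u : Fin n → ℤ) : gauge Δ (toReal u) = (h.coord u).degree := by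
  obtain ⟨φ, hφ, hm⟩ := h.exists_coord_supporting u
  have h1 := (h.gauge_sum hφ hm).2
  rw [h.sum_coord] at h1
  rw [h1, Finsupp.degree_eq_sum, Nat.cast_sum]

/-- The fan of cones over the faces of `Δ`. -/
def fan : UnimodularFan (Fin n → ℤ) (Vertex Δ) where
  vert e := e.1
  coord := h.coord
  sum_coord := h.sum_coord
  degree_add_le u v := by
    have h1 := h.gauge_add (toReal u) (toReal v)
    rw [← toReal_add, h.gauge_eq_degree_coord, h.gauge_eq_degree_coord,
      h.gauge_eq_degree_coord] at h1
    exact_mod_cast h1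
  coord_add u v huv := by
    -- A functional attaining the gauge at `u + v` attains it at `u` and at `v`, because gauges add
    -- here; all three points lie in the cone over one face.
    obtain ⟨φ, hφ, hφuv⟩ := h.exists_eq_gauge (toReal (u + v))
    have h1 : gauge Δ (toReal (u + v)) = gauge Δ (toReal u) + gauge Δ (toReal v) := by
      rw [h.gauge_eq_degree_coord, h.gauge_eq_degree_coord, h.gauge_eq_degree_coord]
      exact_mod_cast huv
    rw [h1, toReal_add, map_add] at hφuv
    have hu := h.le_gauge hφ (toReal u)
    have hv := h.le_gauge hφ (toReal v)
    obtain ⟨m, hm, hmu⟩ := h.exists_sum_eq hφ (le_antisymm hu (by linarith))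
    obtain ⟨m', hm', hmv⟩ := h.exists_sum_eq hφ (le_antisymm hv (by linarith))
    have hcu := h.coord_eq hφ (m := Finsupp.equivFunOnFinite.symm m) (by simpa using hm)
    have hcv := h.coord_eq hφ (m := Finsupp.equivFunOnFinite.symm m') (by simpa using hm')
    have hcuv := h.coord_eq hφ (m := Finsupp.equivFunOnFinite.symm m +
      Finsupp.equivFunOnFinite.symm m') (fun e he => by
        by_cases h0 : m e = 0
        · exact hm' e fun h0' => he (by simp [h0, h0'])
        · exact hm e h0)
    simp only [Finsupp.add_apply, Finsupp.equivFunOnFinite_symm_apply_apply, add_smul,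
      Finset.sum_add_distrib, hmu, hmv] at hcu hcv hcuv
    rw [hcu, hcv, hcuv]
  coord_sum v m hm := by
    obtain ⟨φ, hφ, hφv⟩ := h.exists_coord_supporting v
    exact h.coord_eq hφ fun e he => hφv e
      (Finsupp.mem_support_iff.1 (hm (Finsupp.mem_support_iff.2 he)))

theorem gauge_eq_degree (u : Fin n → ℤ) : gauge Δ (toReal u) = h.fan.degree u :=
  h.gauge_eq_degree_coord u

theorem mem_smul_iff {k : ℕ} (hk : 0 < k) (u : Fin n → ℤ) :
    toReal u ∈ (k : ℝ) • Δ ↔ h.fan.degree u ≤ k := by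
  have hk' : (0 : ℝ) < k := by exact_mod_cast hk
  rw [Set.mem_smul_set_iff_inv_smul_mem₀ hk'.ne', ← h.gauge_le_one,
    gauge_smul_of_nonneg (inv_nonneg.2 hk'.le), smul_eq_mul, inv_mul_le_iff₀ hk', mul_one,
    h.gauge_eq_degree, Nat.cast_le]

theorem mem_frontier_iff {k : ℕ} (hk : 0 < k) (u : Fin n → ℤ) :
    toReal u ∈ frontier ((k : ℝ) • Δ) ↔ h.fan.degree u = k := by
  have hk' : (0 : ℝ) < k := by exact_mod_cast hk
  have hfr : frontier ((k : ℝ) • Δ) = (k : ℝ) • frontier Δ :=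
    ((Homeomorph.smulOfNeZero (k : ℝ) hk'.ne').image_frontier Δ).symm
  rw [hfr, Set.mem_smul_set_iff_inv_smul_mem₀ hk'.ne',
    ← gauge_eq_one_iff_mem_frontier h.convex h.mem_nhds,
    gauge_smul_of_nonneg (inv_nonneg.2 hk'.le), smul_eq_mul, inv_mul_eq_one₀ hk'.ne',
    h.gauge_eq_degree, Nat.cast_inj, eq_comm]

/-- For `d > 0` the boundary of `d Δ` is the level set `d` of the gauge; the value `d = 0` and the
origin need separate care. -/
theorem deg_eq_degree (u : Fin n → ℤ) : deg Δ u = h.fan.degree u := by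
  rw [deg]
  have hz : (0 : ℝ) • Δ = {0} := Set.zero_smul_set ⟨0, h.zero_mem⟩
  rcases eq_or_ne u 0 with rfl | hu
  · rw [UnimodularFan.degree_zero, Nat.sInf_eq_zero]
    rcases Nat.eq_zero_or_pos n with rfl | hn
    -- In dimension zero all frontiers are empty, and the infimum of the empty set is `0`.
    · right
      ext d
      simp
    · left
      have : Nonempty (Fin n) := ⟨⟨0, hn⟩⟩
      rw [Set.mem_ofPred_eq, Nat.cast_zero, hz, toReal_zero, frontier, interior_singleton,
        closure_singleton, Set.sdiff_empty]
      exact Set.mem_singleton 0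
  · have hset : {d : ℕ | toReal u ∈ frontier ((d : ℝ) • Δ)} = {h.fan.degree u} := by
      ext d
      rcases Nat.eq_zero_or_pos d with rfl | hd
      · have h1 : toReal u ∉ frontier ((0 : ℝ) • Δ) := fun h1 => hu (toReal_injective (by
          rw [hz] at h1
          simpa using isClosed_singleton.frontier_subset h1))
        have h2 : 0 ≠ h.fan.degree u := fun h2 => hu (h.fan.degree_eq_zero.1 h2.symm)
        simp [h1, h2]
      · simp [h.mem_frontier_iff hd, eq_comm]
    rw [hset, csInf_singleton]

end IsUnimodularPolytope

end Fan

/-! ### The Hasse–Witt condition -/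

section Condition

variable {n : ℕ} {g : Laurent ℤ n}

theorem coeff_oneSub_X (w : Fin n → ℤ) : (oneSub (Polynomial.X : Polynomial ℤ) g).coeff w =
    (if w = 0 then 1 else 0) - Polynomial.X * Polynomial.C (g.coeff w) := by
  classical
  rw [oneSub, AddMonoidAlgebra.coeff_sub, Finsupp.sub_apply, AddMonoidAlgebra.coeff_smul,
    Finsupp.smul_apply, AddMonoidAlgebra.coeff_mapRingHom, smul_eq_mul, AddMonoidAlgebra.one_def,
    AddMonoidAlgebra.coeff_single, Finsupp.single_apply]
  simp [eq_comm]

/-- The coefficient of `t` in the coefficient of `x^w` is `-g_w`, which the constant `1` cannot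
cancel. -/
theorem toReal_mem_polytope {w : Fin n → ℤ} (hw : g.coeff w ≠ 0) : toReal w ∈ polytope g := by
  refine subset_convexHull ℝ _ ⟨w, Finsupp.mem_support_iff.2 fun h0 => hw ?_, rfl⟩
  rw [coeff_oneSub_X] at h0
  have := congrArg (Polynomial.coeff · 1) h0
  split_ifs at this <;> simpa [Polynomial.coeff_one] using this

theorem coeff_ne_zero_of_mem_extremePoints {e : Fin n → ℤ} (he0 : e ≠ 0)
    (he : toReal e ∈ Set.extremePoints ℝ (polytope g)) : g.coeff e ≠ 0 := by
  obtain ⟨w, hw, hwe⟩ := extremePoints_convexHull_subset he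
  obtain rfl := toReal_injective hwe
  intro h0
  refine Finsupp.mem_support_iff.1 hw ?_
  rw [coeff_oneSub_X, if_neg he0, h0]
  simp

theorem mem_latticePoints {k : ℕ} {u : Fin n → ℤ} :
    u ∈ latticePoints g k ↔ toReal u ∈ (k : ℝ) • polytope g := by
  simp [latticePoints]

/-- `L(k)` counts each lattice point `u` of `kΔ` with multiplicity `deg u - 1`. -/
theorem hwExponent_eq_sum {D : (Fin n → ℤ) → ℕ} {k : ℕ} (hk : 0 < k)
    (hD : ∀ l : ℕ, 0 < l → ∀ u, u ∈ latticePoints g l ↔ D u ≤ l) :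
    hwExponent g k = ∑ u : latticePoints g k, (D u - 1) := by
  classical
  have hcard : ∀ l ∈ Finset.Icc 1 k, (latticePoints g k).card - (latticePoints g l).card =
      ∑ u ∈ latticePoints g k, if l < D u then 1 else 0 := by
    intro l hl
    obtain ⟨hl1, hlk⟩ := Finset.mem_Icc.1 hl
    have hsub : latticePoints g l ⊆ latticePoints g k := fun u hu => by
      rw [hD k (by omega)]
      exact ((hD l hl1 u).1 hu).trans hlk
    rw [← Finset.card_sdiff_of_subset hsub, ← Finset.card_filter]
    congr 1
    ext u
    simp [hD l hl1]
  rw [hwExponent, Finset.sum_congr rfl hcard, Finset.sum_comm,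
    Finset.sum_coe_sort (latticePoints g k) fun u => D u - 1]
  refine Finset.sum_congr rfl fun u hu => ?_
  rw [← Finset.card_filter]
  have huk := (hD k hk u).1 hu
  -- A point `u` is missing from `lΔ` exactly for `1 ≤ l < D u`; the origin is never missing, in
  -- accordance with truncated subtraction.
  have : (Finset.Icc 1 k).filter (fun l => l < D u) = Finset.Ico 1 (D u) := by
    ext l
    simp only [Finset.mem_filter, Finset.mem_Icc, Finset.mem_Ico]
    omega
  rw [this, Nat.card_Ico]

variable {p : ℕ} [hp : Fact p.Prime] {tσ w₀ : PowerSeries ℤ_[p]}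

theorem single_mul_ofPowerSeries {a b : ℕ} {x y : PowerSeries ℤ_[p]}
    (hxy : PowerSeries.X ^ a * x = PowerSeries.X ^ b * y) :
    HahnSeries.single (-((a : ℤ) - b)) (1 : ℤ_[p]) * HahnSeries.ofPowerSeries ℤ ℤ_[p] y =
      HahnSeries.ofPowerSeries ℤ ℤ_[p] x := by
  have h1 := congrArg (HahnSeries.ofPowerSeries ℤ ℤ_[p]) hxy
  rw [map_mul, map_mul, HahnSeries.ofPowerSeries_X_pow, HahnSeries.ofPowerSeries_X_pow] at h1
  have h2 := congrArg (HahnSeries.single (-(a : ℤ)) (1 : ℤ_[p]) * ·) h1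
  simp only [← mul_assoc, HahnSeries.single_mul_single, mul_one] at h2
  rw [neg_add_cancel, HahnSeries.single_zero_one, one_mul] at h2
  rw [h2, neg_sub, sub_eq_neg_add]

theorem hasseWittCondition_of_isUnimodularPolytope (h : IsUnimodularPolytope (polytope g))
    (htσ : tσ = PowerSeries.X ^ p * (1 + (p : PowerSeries ℤ_[p]) * PowerSeries.X * w₀))
    (hunits : ∀ u ∈ g.coeff.support, IsUnit ((g.coeff u : ℤ) : ℤ_[p])) {k : ℕ} (hk : k < p) :
    HasseWittCondition p g tσ k := by
  classical
  intro l hl1 hlk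
  have := h.finite_vertex
  have := Fintype.ofFinite (Vertex (polytope g))
  have hg : ∀ w, g.coeff w ≠ 0 → h.fan.degree w ≤ 1 := fun w hw => by
    have h1 := h.gauge_le_one.2 (toReal_mem_polytope hw)
    rw [h.gauge_eq_degree] at h1
    exact_mod_cast h1
  have hmem : ∀ l : ℕ, 0 < l → ∀ u, u ∈ latticePoints g l ↔ h.fan.degree u ≤ l :=
    fun l hl u => by rw [mem_latticePoints, h.mem_smul_iff hl]
  obtain ⟨H, hH, hw, hdet⟩ := UnimodularFan.exists_normalized_matrix hg
    (fun e => hunits _ (Finsupp.mem_support_iff.2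
      (coeff_ne_zero_of_mem_extremePoints e.2.1 e.2.2)))
    htσ hl1 (hlk.trans_lt hk) (hmem l hl1)
  have hmat : hwMatrix p g tσ l = (HahnSeries.ofPowerSeries ℤ ℤ_[p]).mapMatrix H := by
    ext1 u v
    rw [hwMatrix, h.deg_eq_degree, h.deg_eq_degree, RingHom.mapMatrix_apply, Matrix.map_apply,
      ← Nat.cast_mul]
    exact single_mul_ofPowerSeries (hH u v)
  refine ⟨hw, ?_⟩
  rw [hmat, ← RingHom.map_det, hwExponent_eq_sum hl1 hmem, ← map_natCast
    (HahnSeries.ofPowerSeries ℤ ℤ_[p]), ← map_pow, ← map_mul, ← hdet]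

end Condition

end HasseWitt

end

theorem theorem4 (p : ℕ) [Fact p.Prime] (n : ℕ) (g : HasseWitt.Laurent ℤ n)
    (tσ : PowerSeries ℤ_[p])
    (htσ : ∃ w : PowerSeries ℤ_[p],
      tσ = PowerSeries.X ^ p * (1 + (p : PowerSeries ℤ_[p]) * PowerSeries.X * w))
    (hreflexive : HasseWitt.IsReflexive (HasseWitt.polytope g))
    (hpn : n < p)
    (hfaces : ∀ τ : Set (Fin n → ℝ), HasseWitt.IsProperFace (HasseWitt.polytope g) τ →
      HasseWitt.IsUnimodularSimplex τ)
    (hunits : ∀ u ∈ g.coeff.support, IsUnit ((g.coeff u : ℤ) : ℤ_[p])) :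
    ∀ k : ℕ, k < p → HasseWitt.HasseWittCondition p g tσ k := by
  obtain ⟨w, hw⟩ := htσ
  exact fun k hk => HasseWitt.hasseWittCondition_of_isUnimodularPolytope
    ⟨hreflexive.isLatticePolytope, hreflexive.zero_mem_interior, hfaces⟩ hw hunits hk
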